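/- Let $\mathbb F$ be a field, let $S,\ell,K_c,p,m,n,\lambda,\kappa,\mu$ be positive integers with $m\mid\lambda$, $n\mid\mu$, $p\mid\kappa$, put $L=\ell K_c$, $R'=pmn$ and $$R=pmn\big((\ell+1)K_c-1\big)+p-1,$$ and assume $L+S\le|\mathbb F|$ and $R\le S$. The task is to compute $(\mathbf A_1\mathbf B_1,\dots,\mathbf A_L\mathbf B_L)$ for arbitrary $\mathbf A_i\in\mathbb F^{\lambda\times\kappa}$, $\mathbf B_i\in\mathbb F^{\kappa\times\mu}$ with the help of $S$ servers. A code for this task consists of encoding functions (server $s$ receives $\widetilde A^s$, a function of $\mathbf A_1,\dots,\mathbf A_L$, and $\widetilde B^s$, a function of $\mathbf B_1,\dots,\mathbf B_L$), answer functions $Y_s=h_s(\widetilde A^s,\widetilde B^s)$, and a decoding function $d_{\mathcal R}$ of $(Y_s)_{s\in\mathcal R}$ for every $\mathcal R\subseteq\{1,\dots,S\}$. It is $r$-recoverable if for all $\mathcal R$ with $|\mathcal R|=r$ and all inputs $d_{\mathcal R}$ returns all $L$ products; its recovery threshold is the least $r$ for which it is $r$-recoverable. Write $|X|$ for the number of field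 elements in $X$. There exist $S+L$ distinct elements $f_{l,k}$ ($1\le l\le\ell$, $1\le k\le K_c$), $\alpha_1,\dots,\alpha_S$ of $\mathbb F$. For every such choice the GCSA code is defined as follows. Put $\mathbf A_{l,k}=\mathbf A_{K_c(l-1)+k}$, $\mathbf B_{l,k}=\mathbf B_{K_c(l-1)+k}$, partition $\mathbf A_{l,k}$ into $m\times p$ blocks $\mathbf A_{l,k}^{m',p'}$ and $\mathbf B_{l,k}$ into $p\times n$ blocks $\mathbf B_{l,k}^{p',n'}$ of equal size, and let $$P_s^{l,k}=\sum_{m'=1}^m\sum_{p'=1}^p\mathbf A_{l,k}^{m',p'}(f_{l,k}-\alpha_s)^{p'-1+p(m'-1)},\qquad Q_s^{l,k}=\sum_{p'=1}^p\sum_{n'=1}^n\mathbf B_{l,k}^{p',n'}(f_{l,k}-\alpha_s)^{p-p'+pm(n'-1)},$$ $$\widetilde A_l^s=\prod_{k=1}^{K_c}(f_{l,k}-\alpha_s)^{R'}\sum_{k=1}^{K_c}\frac{P_s^{l,k}}{(f_{l,k}-\alpha_s)^{R'}},\qquad \widetilde B_l^s=\sum_{k=1}^{K_c}\frac{Q_s^{l,k}}{(f_{l,k}-\alpha_s)^{R'}},$$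 $$\widetilde A^s=(\widetilde A^s_1,\dots,\widetilde A^s_\ell),\qquad \widetilde B^s=(\widetilde B^s_1,\dots,\widetilde B^s_\ell),\qquad Y_s=\sum_{l=1}^{\ell}\widetilde A_l^s\widetilde B_l^s .$$ Then there are decoding functions with which this code is $R$-recoverable and has 1. recovery threshold $R$; 2. upload costs $U_A=\sum_s|\widetilde A^s|/(L\lambda\kappa)=\dfrac{S}{K_cpm}$ and $U_B=\sum_s|\widetilde B^s|/(L\kappa\mu)=\dfrac{S}{K_cpn}$; 3. download cost $D=\max_{|\mathcal R|=R}\sum_{s\in\mathcal R}|Y_s|/(L\lambda\mu)=\dfrac{R}{mn\ell K_c}$; 4. server complexity $\mathcal C_s=\mathcal O\!\left(\dfrac{\lambda\kappa\mu}{K_cpmn}\right)$ at every server; 5. encoding complexities $\mathcal C_{eA}=\widetilde{\mathcal O}\!\left(\dfrac{\lambda\kappa S\log^2S}{K_cpm}\right)$ and $\mathcal C_{eB}=\widetilde{\mathcal O}\!\left(\dfrac{\kappa\mu S\log^2S}{K_cpn}\right)$; 6. decoding complexity $\mathcal C_d=\widetilde{\mathcal O}\!\left(\lambda\mu p\log^2R\right)$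 for every set of $R$ responding servers. Here a complexity is the number of arithmetic operations over $\mathbb F$ (in a straight-line computation in which constants of $\mathbb F$ are free) that suffice to compute, respectively, $h_s$, all the $\widetilde A^s$ together, all the $\widetilde B^s$ together, and $d_{\mathcal R}$, divided by $L$. The constants in all the bounds are absolute (independent of $\mathbb F$ and of all the parameters). $\widetilde{\mathcal O}(a\log^2b)$ stands for $\mathcal O(a\log^2b)$ if $\mathbb F$ supports the fast Fourier transform of length $b$ (it has a primitive $2^t$-th root of unity for some $2^t\ge b$), and for $\mathcal O(a\log^2b\,\log\log b)$ otherwise; $\log x$ is read as $\max(1,\log x)$. -/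

import Mathlib

open scoped NNRat

/-! ### Counting arithmetic operations -/

/-- `StraightLine inp t V`: there is a straight-line computation with exactly `t` arithmetic
operations over `F` (additions, subtractions, multiplications) after which exactly the functions in
`V` of the input `x : X` are available.  At the start, the input coordinates `inp i` and all the
constants of `F` are available. -/
inductive StraightLine {F X ι : Type*} [Field F] (inp : ι → X → F) : ℕ → Set (X → F) → Prop
  | start : StraightLine inp 0 (Set.range inp ∪ {u | ∃ c : F, u = fun _ => c})
  | add {t : ℕ} {V : Set (X → F)} {u v : X → F} :
      StraightLine inp t V → u ∈ V → v ∈ V → StraightLine inp (t + 1) (insert (u + v) V)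
  | sub {t : ℕ} {V : Set (X → F)} {u v : X → F} :
      StraightLine inp t V → u ∈ V → v ∈ V → StraightLine inp (t + 1) (insert (u - v) V)
  | mul {t : ℕ} {V : Set (X → F)} {u v : X → F} :
      StraightLine inp t V → u ∈ V → v ∈ V → StraightLine inp (t + 1) (insert (u * v) V)

/-- All the output coordinates `out o` can be computed together, from the input coordinates
`inp i`, with `t` arithmetic operations. -/
def ComputableWithOps {F X ι ο : Type*} [Field F] (inp : ι → X → F) (out : ο → X → F)
    (t : ℕ) : Prop :=
  ∃ V : Set (X → F), StraightLine inp t V ∧ ∀ o, out o ∈ V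

/-! ### Codes for coded distributed batch matrix multiplication (CDBMM) -/

/-- A CDBMM code `(f, g, h, d)` with `S` servers for batches of `L` products of a `lam × kap` by a
`kap × mu` matrix over `F`.  A coded share or an answer is a finite family of elements of `F`; the
index types `ShareA s`, `ShareB s`, `Ans s` record how many elements it has. -/
structure CDBMMCode (F : Type*) (S L lam kap mu : ℕ) where
  /-- index set of the elements of the `A`-share of server `s` -/
  ShareA : Fin S → Type
  /-- index set of the elements of the `B`-share of server `s` -/
  ShareB : Fin S → Type
  /-- index set of the elements of the answer of server `s` -/
  Ans : Fin S → Type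
  [fintypeA : ∀ s, Fintype (ShareA s)]
  [fintypeB : ∀ s, Fintype (ShareB s)]
  [fintypeAns : ∀ s, Fintype (Ans s)]
  /-- encoding functions for `A` -/
  f : ∀ s, (Fin L → Matrix (Fin lam) (Fin kap) F) → ShareA s → F
  /-- encoding functions for `B` -/
  g : ∀ s, (Fin L → Matrix (Fin kap) (Fin mu) F) → ShareB s → F
  /-- answer functions -/
  h : ∀ s, (ShareA s → F) → (ShareB s → F) → Ans s → F
  /-- decoding functions, one for each set of responsive servers -/
  d : ∀ 𝓡 : Finset (Fin S), (∀ s : 𝓡, Ans s → F) → Fin L → Matrix (Fin lam) (Fin mu) F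

namespace CDBMMCode

attribute [instance] fintypeA fintypeB fintypeAns

variable {F : Type*} [Field F] {S L lam kap mu : ℕ}

/-- The answer `Y_s` of server `s`. -/
def answer (𝒞 : CDBMMCode F S L lam kap mu) (A : Fin L → Matrix (Fin lam) (Fin kap) F)
    (B : Fin L → Matrix (Fin kap) (Fin mu) F) (s : Fin S) : 𝒞.Ans s → F :=
  𝒞.h s (𝒞.f s A) (𝒞.g s B)

/-- The user recovers all the products from the answers of any `r` servers. -/
def IsRecoverable (𝒞 : CDBMMCode F S L lam kap mu) (r : ℕ) : Prop :=
  ∀ 𝓡 : Finset (Fin S), 𝓡.card = r →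
    ∀ (A : Fin L → Matrix (Fin lam) (Fin kap) F) (B : Fin L → Matrix (Fin kap) (Fin mu) F),
      𝒞.d 𝓡 (fun s => 𝒞.answer A B s) = fun l => A l * B l

/-- The recovery threshold: the least `r` for which the code is `r`-recoverable (the set is never
empty, since it contains `S + 1`). -/
noncomputable def recoveryThreshold (𝒞 : CDBMMCode F S L lam kap mu) : ℕ :=
  sInf {r | 𝒞.IsRecoverable r}

/-- Normalized upload cost of the `A`-shares. -/
def uploadCostA (𝒞 : CDBMMCode F S L lam kap mu) : ℚ≥0 :=
  (∑ s, (Fintype.card (𝒞.ShareA s) : ℚ≥0)) / (L * lam * kap)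

/-- Normalized upload cost of the `B`-shares. -/
def uploadCostB (𝒞 : CDBMMCode F S L lam kap mu) : ℚ≥0 :=
  (∑ s, (Fintype.card (𝒞.ShareB s) : ℚ≥0)) / (L * kap * mu)

/-- Normalized download cost: the maximum, over the sets of responsive servers whose size is the
recovery threshold, of the normalized number of downloaded elements. -/
noncomputable def downloadCost (𝒞 : CDBMMCode F S L lam kap mu) : ℚ≥0 :=
  (Finset.powersetCard 𝒞.recoveryThreshold Finset.univ).sup
    (fun 𝓡 => (∑ s ∈ 𝓡, (Fintype.card (𝒞.Ans s) : ℚ≥0)) / (L * lam * mu))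

/-- Each single answer function `h_s` can be computed with at most `L * B` operations, i.e. the
normalized server computation complexity is at most `B`. -/
def ServerComplexityLE (𝒞 : CDBMMCode F S L lam kap mu) (B : ℝ) : Prop :=
  ∀ s : Fin S, ∃ t : ℕ, (t : ℝ) / L ≤ B ∧
    ComputableWithOps
      (fun (i : 𝒞.ShareA s ⊕ 𝒞.ShareB s) (x : (𝒞.ShareA s → F) × (𝒞.ShareB s → F)) =>
        Sum.elim x.1 x.2 i)
      (fun (o : 𝒞.Ans s) (x : (𝒞.ShareA s → F) × (𝒞.ShareB s → F)) => 𝒞.h s x.1 x.2 o) t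

/-- The normalized complexity of computing the `A`-shares of all the servers is at most `B`. -/
def EncodingComplexityALE (𝒞 : CDBMMCode F S L lam kap mu) (B : ℝ) : Prop :=
  ∃ t : ℕ, (t : ℝ) / L ≤ B ∧
    ComputableWithOps
      (fun (i : Fin L × Fin lam × Fin kap) (A : Fin L → Matrix (Fin lam) (Fin kap) F) =>
        A i.1 i.2.1 i.2.2)
      (fun (o : Σ s, 𝒞.ShareA s) (A : Fin L → Matrix (Fin lam) (Fin kap) F) =>
        𝒞.f o.1 A o.2) t

/-- The normalized complexity of computing the `B`-shares of all the servers is at most `B`. -/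
def EncodingComplexityBLE (𝒞 : CDBMMCode F S L lam kap mu) (B : ℝ) : Prop :=
  ∃ t : ℕ, (t : ℝ) / L ≤ B ∧
    ComputableWithOps
      (fun (i : Fin L × Fin kap × Fin mu) (M : Fin L → Matrix (Fin kap) (Fin mu) F) =>
        M i.1 i.2.1 i.2.2)
      (fun (o : Σ s, 𝒞.ShareB s) (M : Fin L → Matrix (Fin kap) (Fin mu) F) =>
        𝒞.g o.1 M o.2) t

/-- The normalized decoding complexity, maximized over the sets of responsive servers whose size is
the recovery threshold, is at most `B`. -/
def DecodingComplexityLE (𝒞 : CDBMMCode F S L lam kap mu) (B : ℝ) : Prop :=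
  ∀ 𝓡 : Finset (Fin S), 𝓡.card = 𝒞.recoveryThreshold → ∃ t : ℕ, (t : ℝ) / L ≤ B ∧
    ComputableWithOps
      (fun (i : Σ s : 𝓡, 𝒞.Ans s) (y : ∀ s : 𝓡, 𝒞.Ans s → F) => y i.1 i.2)
      (fun (o : Fin L × Fin lam × Fin mu) (y : ∀ s : 𝓡, 𝒞.Ans s → F) =>
        𝒞.d 𝓡 y o.1 o.2.1 o.2.2) t

end CDBMMCode

/-! ### Quasi-linear bounds -/

/-- `log`, bounded below by `1`. -/
noncomputable def lg (x : ℝ) : ℝ := max 1 (Real.log x)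

/-- The field has a primitive `2 ^ t`-th root of unity for some `2 ^ t ≥ N`, so that the radix-2
fast Fourier transform is available for length `N`. -/
def SupportsFFT (F : Type*) [Field F] (N : ℕ) : Prop :=
  ∃ t : ℕ, N ≤ 2 ^ t ∧ ∃ ω : F, IsPrimitiveRoot ω (2 ^ t)

open Classical in
/-- The function inside the soft-O `Õ(a log² b)`: it is `a log² b` if the field supports the FFT of
length `b`, and `a log² b log log b` if it does not. -/
noncomputable def softLogSq (F : Type*) [Field F] (a : ℝ) (b : ℕ) : ℝ :=
  a * lg b ^ 2 * (if SupportsFFT F b then 1 else lg (lg b))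

/-! ### Generalized cross-subspace alignment (GCSA) codes

All indices start at `0`. -/

/-- The position in `Fin N` of entry `i` of block `b`, when `Fin N` is cut into `q` consecutive
blocks of length `N / q`. -/
def blockIndex {q N : ℕ} (h : q ∣ N) (b : Fin q) (i : Fin (N / q)) : Fin N :=
  Fin.cast (Nat.mul_div_cancel' h) (finProdFinEquiv (b, i))

/-- Block `(u, v)` of a matrix that is partitioned into `q × r` blocks of equal size. -/
def matrixBlock {F : Type*} {q r M N : ℕ} (hq : q ∣ M) (hr : r ∣ N)
    (A : Matrix (Fin M) (Fin N) F) (u : Fin q) (v : Fin r) :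
    Matrix (Fin (M / q)) (Fin (N / r)) F :=
  Matrix.of fun i j => A (blockIndex hq u i) (blockIndex hr v j)

section GCSA

variable {F : Type*} [Field F] {S ℓ Kc p m n lam kap mu : ℕ}

/-- The `S + ℓ Kc` evaluation points `f l k`, `α s` are distinct. -/
def DistinctPoints (f : Fin ℓ → Fin Kc → F) (α : Fin S → F) : Prop :=
  Function.Injective (Sum.elim (fun x : Fin ℓ × Fin Kc => f x.1 x.2) α)

/-- Entangled polynomial of the matrix `A`, in the variable `x`. -/
def epA (hm : m ∣ lam) (hp : p ∣ kap) (A : Matrix (Fin lam) (Fin kap) F) (x : F) :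
    Matrix (Fin (lam / m)) (Fin (kap / p)) F :=
  ∑ m' : Fin m, ∑ p' : Fin p, x ^ ((p' : ℕ) + p * m') • matrixBlock hm hp A m' p'

/-- Entangled polynomial of the matrix `B`, in the variable `x`; the parameter `m` enters the
exponents. -/
def epB (m : ℕ) (hp : p ∣ kap) (hn : n ∣ mu) (B : Matrix (Fin kap) (Fin mu) F) (x : F) :
    Matrix (Fin (kap / p)) (Fin (mu / n)) F :=
  ∑ p' : Fin p, ∑ n' : Fin n, x ^ ((p - 1 - (p' : ℕ)) + p * m * n') • matrixBlock hp hn B p' n'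

/-- The `l`-th component of the `A`-share at evaluation point `a`.  The batch is split into `ℓ`
groups of `Kc` matrices, with `A_{l,k}` at position `Kc * l + k`. -/
def gcsaShareA (n : ℕ) (hm : m ∣ lam) (hp : p ∣ kap) (f : Fin ℓ → Fin Kc → F)
    (A : Fin (ℓ * Kc) → Matrix (Fin lam) (Fin kap) F) (a : F) (l : Fin ℓ) :
    Matrix (Fin (lam / m)) (Fin (kap / p)) F :=
  (∏ k : Fin Kc, (f l k - a) ^ (p * m * n)) •
    ∑ k : Fin Kc, (1 / (f l k - a) ^ (p * m * n)) •
      epA hm hp (A (finProdFinEquiv (l, k))) (f l k - a)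

/-- The `l`-th component of the `B`-share at evaluation point `a`. -/
def gcsaShareB (m : ℕ) (hp : p ∣ kap) (hn : n ∣ mu) (f : Fin ℓ → Fin Kc → F)
    (B : Fin (ℓ * Kc) → Matrix (Fin kap) (Fin mu) F) (a : F) (l : Fin ℓ) :
    Matrix (Fin (kap / p)) (Fin (mu / n)) F :=
  ∑ k : Fin Kc, (1 / (f l k - a) ^ (p * m * n)) •
    epB m hp hn (B (finProdFinEquiv (l, k))) (f l k - a)

/-- The GCSA code with evaluation points `f`, `α` and decoding functions `d`: server `s` gets `ℓ`
coded blocks of each kind and answers with the sum of their `ℓ` products. -/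
def gcsaCode (hm : m ∣ lam) (hn : n ∣ mu) (hp : p ∣ kap) (f : Fin ℓ → Fin Kc → F)
    (α : Fin S → F)
    (d : ∀ 𝓡 : Finset (Fin S), (∀ _ : 𝓡, Fin (lam / m) × Fin (mu / n) → F) →
      Fin (ℓ * Kc) → Matrix (Fin lam) (Fin mu) F) :
    CDBMMCode F S (ℓ * Kc) lam kap mu where
  ShareA _ := Fin ℓ × Fin (lam / m) × Fin (kap / p)
  ShareB _ := Fin ℓ × Fin (kap / p) × Fin (mu / n)
  Ans _ := Fin (lam / m) × Fin (mu / n)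
  f s A x := gcsaShareA n hm hp f A (α s) x.1 x.2.1 x.2.2
  g s B x := gcsaShareB m hp hn f B (α s) x.1 x.2.1 x.2.2
  h _ X Y x := (∑ l : Fin ℓ,
    (Matrix.of fun i j => X (l, i, j)) * (Matrix.of fun i j => Y (l, i, j)) :
      Matrix (Fin (lam / m)) (Fin (mu / n)) F) x.1 x.2
  d := d

end GCSA

/-- `p m n ((ℓ + 1) Kc - 1) + p - 1`; no truncation occurs for positive parameters. -/
def gcsaThreshold (ℓ Kc p m n : ℕ) : ℕ := p * m * n * ((ℓ + 1) * Kc - 1) + p - 1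

/-! Write `r = p m n`. The answers are the values at the points `α s` of one rational function with
denominator `∏ (f l k - X) ^ r`. Its numerator has degree less than `R` (`degree_answerNum_lt`), so
`R` answers determine it by Lagrange interpolation. Modulo `(f l k - X) ^ r` the numerator is a
polynomial not vanishing at `f l k`, times the product of the entangled polynomials of `A_{l,k}` and
`B_{l,k}` in the variable `f l k - X` (`pow_dvd_answerNum_sub`), because every other term carries
that power as a factor. The blocks of `A_{l,k} B_{l,k}` are coefficients of this product at
exponents below `r` (`coeff_sum_sparsePoly_mul`). Hence they are Taylor coefficients of a quotient
that is known to this precision.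

The threshold is exactly `R` because of the chosen decoder: it returns `0` on fewer than `R`
answers, and not all products are zero. The upload, download and server costs only count matrix
entries and the operations of schoolbook matrix products.

For encoding and decoding, all the maps are linear in the data and the evaluation points are
constants, so the one fast primitive needed is multiplication by a fixed polynomial (`MulBound`). It
takes `O(n log n)` operations by the FFT if roots of unity exist. Otherwise it takes `O(n log n log
log n)` by a Schönhage–Strassen recursion, of radix 2, or of radix 3 in characteristic 2.

On this primitive rest product trees for the Hermite family `q_{b,e} = (a b - X) ^ e ∏_{b' ≠ b} (a
b' - X) ^ r`. A tree is run in two directions (`FamilyCost`): upwards it forms a linear combination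
of the `q_{b,e}`, and downwards, transposed, it computes the values `τ (q_{b,e})` of a linear
functional from the `τ (X ^ j)`. A transposed multiplication is again multiplication by a fixed
polynomial, applied to reversed data. So both directions cost one multiplication times a logarithm.

Encoding brings partial fractions to a common denominator by an upward run, and evaluates at all the
`α s` by a downward run (`Comp.fractionNum_eval`). Decoding interpolates by an upward run. Then it
extracts Taylor coefficients by a downward run with a residue-like functional `ρ`, for which `ρ (N
q_{b,e})` is the coefficient of index `r - 1 - e` of `N / W_b` at `a b` (`exists_taylor_functional`,
`Comp.lagrange_apply`). No division of data-dependent power series occurs. -/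

section Preliminaries

open Polynomial

/-! ### Operation counts in commutative algebras, and elementary polynomial arithmetic -/

section OperationCounts

variable {F 𝒜 : Type*} [Field F] [CommRing 𝒜] [Algebra F 𝒜]

/-- `OpSteps V t W`: starting with the elements of `V`, `t` ring operations produce `W`. -/
inductive OpSteps {𝒜 : Type*} [CommRing 𝒜] (V : Set 𝒜) : ℕ → Set 𝒜 → Prop
  | refl : OpSteps V 0 V
  | step {t : ℕ} {W : Set 𝒜} {u v w : 𝒜} : OpSteps V t W → u ∈ W → v ∈ W →
      (w = u + v ∨ w = u - v ∨ w = u * v) → OpSteps V (t + 1) (insert w W)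

theorem OpSteps.subset {V W : Set 𝒜} {t : ℕ} (h : OpSteps V t W) : V ⊆ W := by
  induction h with
  | refl => exact subset_rfl
  | step _ _ _ _ ih => exact ih.trans (Set.subset_insert _ _)

theorem OpSteps.trans {V W U : Set 𝒜} {t t' : ℕ} (h : OpSteps V t W) (h' : OpSteps W t' U) :
    OpSteps V (t + t') U := by
  induction h' with
  | refl => exact h
  | step _ hu hv hw ih => exact ih.step hu hv hw

theorem OpSteps.mono {V V' W : Set 𝒜} {t : ℕ} (h : OpSteps V t W) (hV : V ⊆ V') :
    ∃ W', OpSteps V' t W' ∧ W ⊆ W' := by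
  induction h with
  | refl => exact ⟨V', .refl, hV⟩
  | step _ hu hv hw ih =>
    obtain ⟨W', h', hs⟩ := ih
    exact ⟨_, h'.step (hs hu) (hs hv) hw, Set.insert_subset_insert hs⟩

variable (F) in
/-- From the elements of `V` and the constants of `F`, all the elements of `G` can be computed
together with at most `t` ring operations. -/
def Comp (V : Set 𝒜) (t : ℕ) (G : Set 𝒜) : Prop :=
  ∃ t' ≤ t, ∃ W, OpSteps (V ∪ Set.range (algebraMap F 𝒜)) t' W ∧ G ⊆ W

namespace Comp

variable {V V' G G' H : Set 𝒜} {t t' : ℕ}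

theorem of_subset_union (h : G ⊆ V ∪ Set.range (algebraMap F 𝒜)) : Comp F V 0 G :=
  ⟨0, le_rfl, _, .refl, h⟩

theorem of_subset (h : G ⊆ V) : Comp F V 0 G :=
  of_subset_union (h.trans Set.subset_union_left)

theorem mono_right (h : Comp F V t G) (hG : G' ⊆ G) : Comp F V t G' := by
  obtain ⟨t', ht, W, hW, hs⟩ := h
  exact ⟨t', ht, W, hW, hG.trans hs⟩

theorem mono_cost (h : Comp F V t G) (ht : t ≤ t') : Comp F V t' G := by
  obtain ⟨t'', ht', W, hW, hs⟩ := h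
  exact ⟨t'', ht'.trans ht, W, hW, hs⟩

theorem mono_left (h : Comp F V t G) (hV : V ⊆ V' ∪ Set.range (algebraMap F 𝒜)) :
    Comp F V' t G := by
  obtain ⟨t', ht, W, hW, hs⟩ := h
  obtain ⟨W', hW', hs'⟩ := hW.mono (Set.union_subset hV Set.subset_union_right)
  exact ⟨t', ht, W', hW', hs.trans hs'⟩

theorem mono_left' (h : Comp F V t G) (hV : V ⊆ V') : Comp F V' t G :=
  h.mono_left (hV.trans Set.subset_union_left)

/-- Sequential composition that keeps the intermediate results. -/
theorem append (h : Comp F V t G) (h' : Comp F (V ∪ G) t' H) : Comp F V (t + t') (G ∪ H) := by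
  obtain ⟨t₁, ht₁, W, hW, hs⟩ := h
  obtain ⟨t₂, ht₂, U, hU, hs'⟩ := h'
  have hsub : (V ∪ G) ∪ Set.range (algebraMap F 𝒜) ⊆ W :=
    Set.union_subset (Set.union_subset (Set.subset_union_left.trans hW.subset) hs)
      (Set.subset_union_right.trans hW.subset)
  obtain ⟨U', hU', hs''⟩ := hU.mono hsub
  exact ⟨t₁ + t₂, by omega, U', hW.trans hU',
    Set.union_subset (hs.trans hU'.subset) (hs'.trans hs'')⟩

theorem trans (h : Comp F V t G) (h' : Comp F G t' H) : Comp F V (t + t') H :=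
  (h.append (h'.mono_left' Set.subset_union_right)).mono_right Set.subset_union_right

theorem union (h : Comp F V t G) (h' : Comp F V t' H) : Comp F V (t + t') (G ∪ H) :=
  h.append (h'.mono_left' Set.subset_union_left)

theorem biUnion {ι : Type*} (s : Finset ι) {t : ι → ℕ} {G : ι → Set 𝒜}
    (h : ∀ i ∈ s, Comp F V (t i) (G i)) : Comp F V (∑ i ∈ s, t i) (⋃ i ∈ s, G i) := by
  classical
  induction s using Finset.induction_on with
  | empty => exact of_subset (by simp)
  | insert a s ha ih =>
    rw [Finset.sum_insert ha, Finset.set_biUnion_insert]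
    exact (h a (Finset.mem_insert_self _ _)).union
      (ih fun i hi => h i (Finset.mem_insert_of_mem hi))

theorem biUnion_const {ι : Type*} (s : Finset ι) {G : ι → Set 𝒜}
    (h : ∀ i ∈ s, Comp F V t (G i)) : Comp F V (s.card * t) (⋃ i ∈ s, G i) := by
  simpa using biUnion s h

theorem image {ι : Type*} (s : Finset ι) {v : ι → 𝒜} (h : ∀ i ∈ s, Comp F V t {v i}) :
    Comp F V (s.card * t) (v '' s) :=
  (biUnion_const s h).mono_right (by rintro _ ⟨i, hi, rfl⟩; simpa using ⟨i, hi, rfl⟩)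

theorem of_mem {u : 𝒜} (hu : u ∈ V) : Comp F V 0 {u} := of_subset (by simpa)

theorem const (c : F) : Comp F V 0 {algebraMap F 𝒜 c} := of_subset_union (by simp)

theorem zero_mem : Comp F V 0 {(0 : 𝒜)} := by simpa using const (V := V) (0 : F)

theorem op {u v w : 𝒜} (hu : Comp F V t {u}) (hv : Comp F V t' {v})
    (hw : w = u + v ∨ w = u - v ∨ w = u * v) : Comp F V (t + t' + 1) {w} := by
  obtain ⟨t₁, ht₁, W, hW, hs⟩ := hu.union hv
  exact ⟨t₁ + 1, by omega, _, hW.step (hs (Or.inl rfl)) (hs (Or.inr rfl)) hw, by simp⟩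

theorem add {u v : 𝒜} (hu : Comp F V t {u}) (hv : Comp F V t' {v}) :
    Comp F V (t + t' + 1) {u + v} := hu.op hv (.inl rfl)

theorem sub {u v : 𝒜} (hu : Comp F V t {u}) (hv : Comp F V t' {v}) :
    Comp F V (t + t' + 1) {u - v} := hu.op hv (.inr (.inl rfl))

theorem mul {u v : 𝒜} (hu : Comp F V t {u}) (hv : Comp F V t' {v}) :
    Comp F V (t + t' + 1) {u * v} := hu.op hv (.inr (.inr rfl))

theorem smul {u : 𝒜} (c : F) (hu : Comp F V t {u}) : Comp F V (t + 1) {c • u} := by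
  rw [Algebra.smul_def]
  simpa using (const (V := V) c).mul hu

theorem sum {ι : Type*} (s : Finset ι) {v : ι → 𝒜} (h : ∀ i ∈ s, Comp F V t {v i}) :
    Comp F V (s.card * (t + 1)) {∑ i ∈ s, v i} := by
  classical
  induction s using Finset.induction_on with
  | empty => simpa using zero_mem
  | insert a s ha ih =>
    rw [Finset.sum_insert ha, Finset.card_insert_of_notMem ha]
    refine ((h a (Finset.mem_insert_self _ _)).add
      (ih fun i hi => h i (Finset.mem_insert_of_mem hi))).mono_cost (le_of_eq (by ring))

end Comp

/-- The set of all the coefficients of a polynomial (it contains `0`). -/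
def coeffSet {𝒜 : Type*} [CommRing 𝒜] (P : 𝒜[X]) : Set 𝒜 := Set.range P.coeff

theorem coeff_mem_coeffSet (P : 𝒜[X]) (i : ℕ) : P.coeff i ∈ coeffSet P := ⟨i, rfl⟩

namespace Comp

variable {V V' G G' H : Set 𝒜} {t t' : ℕ}

/-- Only the coefficients indexed by `s` are charged; the others must be available already. This is
what makes sparse updates cheap. -/
theorem coeffSet_of_finset {P : 𝒜[X]} (s : Finset ℕ) (h : ∀ i ∈ s, Comp F V t {P.coeff i})
    (h' : ∀ i ∉ s, P.coeff i ∈ V ∪ Set.range (algebraMap F 𝒜)) :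
    Comp F V (s.card * t) (coeffSet P) := by
  refine ((image s h).union (of_subset_union (F := F) (V := V)
    (G := {u | ∃ i ∉ s, u = P.coeff i}) ?_)).mono_right ?_
  · rintro _ ⟨i, hi, rfl⟩
    exact h' i hi
  · rintro _ ⟨i, rfl⟩
    by_cases hi : i ∈ s
    · exact Or.inl ⟨i, hi, rfl⟩
    · exact Or.inr ⟨i, hi, rfl⟩

theorem coeffSet_of_degree_lt {P : 𝒜[X]} {n : ℕ} (hP : P.degree < n)
    (h : ∀ i < n, Comp F V t {P.coeff i}) : Comp F V (n * t) (coeffSet P) := by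
  simpa using coeffSet_of_finset (F := F) (V := V) (P := P) (Finset.range n) (t := t)
    (by simpa using h) (fun i hi => Or.inr ⟨0, by
      rw [map_zero, (degree_lt_iff_coeff_zero P n).1 hP i (by simpa using hi)]⟩)

/-- Adding a shifted polynomial. -/
theorem coeffSet_add_X_pow_mul {Q P : 𝒜[X]} {n : ℕ} (hP : P.degree < n) (e : ℕ) :
    Comp F (coeffSet Q ∪ coeffSet P) n (coeffSet (Q + X ^ e * P)) := by
  refine (coeffSet_of_finset (t := 1) (Finset.Ico e (e + n)) ?_ ?_).mono_cost (by simp)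
  · intro i hi
    rw [Finset.mem_Ico] at hi
    rw [coeff_add, coeff_X_pow_mul', if_pos hi.1]
    exact add (t := 0) (t' := 0) (of_mem (Set.mem_union_left _ (coeff_mem_coeffSet _ _)))
      (of_mem (Set.mem_union_right _ (coeff_mem_coeffSet _ _)))
  · intro i hi
    left; left
    rw [Finset.mem_Ico] at hi
    refine ⟨i, ?_⟩
    rw [coeff_add, coeff_X_pow_mul']
    split_ifs with h
    · rw [(degree_lt_iff_coeff_zero P n).1 hP (i - e) (by omega), add_zero]
    · rw [add_zero]

theorem coeffSet_add {Q P : 𝒜[X]} {n : ℕ} (hP : P.degree < n) :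
    Comp F (coeffSet Q ∪ coeffSet P) n (coeffSet (Q + P)) := by
  simpa using coeffSet_add_X_pow_mul (F := F) (Q := Q) hP 0

theorem coeffSet_zero : Comp F V 0 (coeffSet (0 : 𝒜[X])) :=
  of_subset_union (by rintro _ ⟨i, rfl⟩; exact Or.inr ⟨0, by simp⟩)

/-- Overlap-add: each shifted summand alters at most `n` coefficients of the running sum, whatever
the shifts are. -/
theorem coeffSet_sum {ι : Type*} (s : Finset ι) {P : ι → 𝒜[X]} {n : ℕ} (e : ι → ℕ)
    (hP : ∀ i ∈ s, (P i).degree < n) :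
    Comp F (⋃ i ∈ s, coeffSet (P i)) (s.card * n) (coeffSet (∑ i ∈ s, X ^ e i * P i)) := by
  classical
  induction s using Finset.induction_on with
  | empty => simpa using coeffSet_zero
  | insert a s ha ih =>
    rw [Finset.sum_insert ha, Finset.card_insert_of_notMem ha, Finset.set_biUnion_insert,
      add_comm (X ^ e a * P a), add_mul, one_mul]
    have h1 := (ih fun i hi => hP i (Finset.mem_insert_of_mem hi)).mono_left'
      (V' := coeffSet (P a) ∪ ⋃ i ∈ s, coeffSet (P i)) Set.subset_union_right
    refine (h1.append ((coeffSet_add_X_pow_mul (F := F)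
      (hP a (Finset.mem_insert_self _ _)) (e a)).mono_left' ?_)).mono_right
      Set.subset_union_right
    exact Set.union_subset Set.subset_union_right
      (Set.subset_union_left.trans Set.subset_union_left)

theorem coeffSet_C_mul {P : 𝒜[X]} {n : ℕ} (hP : P.degree < n) (c : F) :
    Comp F (coeffSet P) n (coeffSet (C (algebraMap F 𝒜 c) * P)) := by
  refine (coeffSet_of_degree_lt (n := n) (t := 1) ?_ fun i _ => ?_).mono_cost (by simp)
  · rw [degree_lt_iff_coeff_zero] at hP ⊢
    intro i hi
    rw [coeff_C_mul, hP i hi, mul_zero]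
  · rw [coeff_C_mul, ← Algebra.smul_def]
    exact smul c (of_mem (coeff_mem_coeffSet _ _))

/-- Subtracting a multiple of a sparse polynomial. -/
theorem coeffSet_sub_sparse {P : 𝒜[X]} (Φ : F[X]) {a : 𝒜} (ha : a ∈ coeffSet P) (e : ℕ) :
    Comp F (coeffSet P) (2 * Φ.support.card)
      (coeffSet (P - X ^ e * (C a * Φ.map (algebraMap F 𝒜)))) := by
  refine (coeffSet_of_finset (t := 2) (Φ.support.image (e + ·)) ?_ ?_).mono_cost ?_
  · intro i hi
    obtain ⟨j, hj, rfl⟩ := Finset.mem_image.1 hi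
    rw [coeff_sub, coeff_X_pow_mul', if_pos (by omega), coeff_C_mul, coeff_map, mul_comm a,
      ← Algebra.smul_def]
    exact (of_mem (coeff_mem_coeffSet _ _)).sub (smul _ (of_mem ha))
  · intro i hi
    left
    refine ⟨i, ?_⟩
    rw [coeff_sub, coeff_X_pow_mul']
    split_ifs with h
    · have : Φ.coeff (i - e) = 0 := by
        by_contra h0
        exact hi (Finset.mem_image.2 ⟨i - e, by simpa using h0, by omega⟩)
      rw [coeff_C_mul, coeff_map, this, map_zero, mul_zero, sub_zero]
    · rw [sub_zero]
  · rw [mul_comm]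
    exact Nat.mul_le_mul_left _ Finset.card_image_le

/-- Reduction modulo a sparse monic polynomial. -/
theorem coeffSet_modByMonic [Nontrivial 𝒜] {Φ : F[X]} (hΦ : Φ.Monic) {n : ℕ} :
    ∀ {P : 𝒜[X]}, P.degree < n → Comp F (coeffSet P) (n * (2 * Φ.support.card))
      (coeffSet (P %ₘ Φ.map (algebraMap F 𝒜))) := by
  have hΦ' : (Φ.map (algebraMap F 𝒜)).Monic := hΦ.map _
  induction n with
  | zero =>
    intro P hP
    have : P = 0 := by
      ext i
      exact (degree_lt_iff_coeff_zero P 0).1 hP i (Nat.zero_le _)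
    subst this
    rw [zero_modByMonic]
    exact coeffSet_zero.mono_cost (Nat.zero_le _)
  | succ n ih =>
    intro P hP
    by_cases hn : Φ.natDegree ≤ n
    -- One step of long division removes the top coefficient, at two operations for each term of
    -- `Φ`.
    · set Q := P - X ^ (n - Φ.natDegree) * (C (P.coeff n) * Φ.map (algebraMap F 𝒜)) with hQ
      have hQd : Q.degree < n := by
        rw [degree_lt_iff_coeff_zero] at hP ⊢
        intro i hi
        rw [hQ, coeff_sub, coeff_X_pow_mul', if_pos (by omega), coeff_C_mul, coeff_map]
        rcases hi.eq_or_lt with rfl | hi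
        · have : n - (n - Φ.natDegree) = Φ.natDegree := by omega
          rw [this, hΦ.coeff_natDegree, map_one, mul_one, sub_self]
        · rw [hP i (by omega),
            coeff_eq_zero_of_natDegree_lt (p := Φ) (by omega), map_zero, mul_zero, sub_zero]
      have hmod : P %ₘ Φ.map (algebraMap F 𝒜) = Q %ₘ Φ.map (algebraMap F 𝒜) := by
        rw [← sub_eq_zero, ← sub_modByMonic, modByMonic_eq_zero_iff_dvd hΦ', hQ, sub_sub_cancel]
        exact ⟨X ^ (n - Φ.natDegree) * C (P.coeff n), by ring⟩
      rw [hmod]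
      exact ((coeffSet_sub_sparse Φ (coeff_mem_coeffSet P n) _).trans (ih hQd)).mono_cost
        (le_of_eq (by ring))
    · rw [(modByMonic_eq_self_iff hΦ').2]
      · exact (of_subset subset_rfl).mono_cost (Nat.zero_le _)
      · refine hP.trans_le ?_
        rw [hΦ.degree_map, degree_eq_natDegree hΦ.ne_zero]
        exact_mod_cast (by omega : n + 1 ≤ Φ.natDegree)

/-- Schoolbook multiplication by a fixed polynomial. -/
theorem coeffSet_mul_naive (g : F[X]) {P : 𝒜[X]} {n k : ℕ} (hP : P.degree < n)
    (hg : g.degree < k) :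
    Comp F (coeffSet P) ((n + k) * ((n + k) * 2))
      (coeffSet (g.map (algebraMap F 𝒜) * P)) := by
  refine coeffSet_of_degree_lt ?_ fun i hi => ?_
  · rw [degree_lt_iff_coeff_zero] at hP hg ⊢
    intro i hi
    rw [coeff_mul]
    refine Finset.sum_eq_zero fun x hx => ?_
    rw [Finset.HasAntidiagonal.mem_antidiagonal] at hx
    rcases le_or_gt k x.1 with h | h
    · rw [coeff_map, hg _ h, map_zero, zero_mul]
    · rw [hP _ (by omega), mul_zero]
  · rw [coeff_mul]
    refine (sum (t := 1) _ fun x _ => ?_).mono_cost ?_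
    · rw [coeff_map, ← Algebra.smul_def]
      exact smul _ (of_mem (coeff_mem_coeffSet _ _))
    · rw [Finset.Nat.card_antidiagonal]
      exact Nat.mul_le_mul_right _ hi

end Comp

/-- Straight-line programs are the case `𝒜 = X → F`, in which `algebraMap` produces the constant
functions. -/
theorem StraightLine.of_opSteps {F X ι : Type*} [Field F] {inp : ι → X → F} {t : ℕ}
    {W : Set (X → F)}
    (h : OpSteps (Set.range inp ∪ Set.range (algebraMap F (X → F))) t W) :
    StraightLine inp t W := by
  have e : Set.range (algebraMap F (X → F)) = {u | ∃ c : F, u = fun _ => c} := by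
    ext u
    exact ⟨fun ⟨c, hc⟩ => ⟨c, hc.symm⟩, fun ⟨c, hc⟩ => ⟨c, hc.symm⟩⟩
  rw [e] at h
  induction h with
  | refl => exact .start
  | step _ hu hv hw ih =>
    rcases hw with rfl | rfl | rfl
    · exact ih.add hu hv
    · exact ih.sub hu hv
    · exact ih.mul hu hv

theorem Comp.computableWithOps {F X ι ο : Type*} [Field F] {inp : ι → X → F} {out : ο → X → F}
    {t : ℕ} (h : Comp F (Set.range inp) t (Set.range out)) :
    ∃ t' ≤ t, ComputableWithOps inp out t' := by
  obtain ⟨t', ht, W, hW, hs⟩ := h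
  exact ⟨t', ht, W, .of_opSteps hW, fun o => hs ⟨o, rfl⟩⟩

end OperationCounts

/-! ### The radix-`s` Fourier transform and character orthogonality -/

section FourierTransform

theorem Finset.sum_range_mul_eq {M : Type*} [AddCommMonoid M] (f : ℕ → M) (n s : ℕ) :
    ∑ q ∈ Finset.range (s * n), f q =
      ∑ t ∈ Finset.range n, ∑ r ∈ Finset.range s, f (s * t + r) := by
  induction n with
  | zero => simp
  | succ n ih => rw [Nat.mul_succ, Finset.sum_range_add, ih, Finset.sum_range_succ]

variable {F 𝒜 : Type*} [Field F] [CommRing 𝒜] [Algebra F 𝒜] {E : Type*} [CommRing E]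

/-- Schoolbook computation of one output of a transform of length `s`; `c` is the price of one
multiplication by a power of the root followed by an addition. -/
theorem Comp.range_sum {co : E → Set 𝒜} {c : ℕ} {ω : E} (h0 : Comp F ∅ 0 (co 0))
    (hco : ∀ u v i, Comp F (co u ∪ co v) c (co (u + ω ^ i * v))) (w : ℕ → E) (i s : ℕ) :
    Comp F (⋃ r ∈ Finset.range s, co (w r)) (s * c)
      (co (∑ r ∈ Finset.range s, ω ^ (i * r) * w r)) := by
  induction s with
  | zero => simpa using h0
  | succ s ih =>
    rw [Finset.sum_range_succ, Finset.range_add_one, Finset.set_biUnion_insert, add_mul, one_mul]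
    refine ((ih.mono_left' Set.subset_union_right).append
      ((hco _ (w s) (i * s)).mono_left' ?_)).mono_right Set.subset_union_right
    exact Set.union_subset Set.subset_union_right
      (Set.subset_union_left.trans Set.subset_union_left)

/-- The radix-`s` fast Fourier transform of length `s ^ j`, over a ring `E` whose elements `e` are
represented by the sets `co e`. -/
theorem Comp.dft {co : E → Set 𝒜} {c : ℕ} (s : ℕ) (hs : 0 < s) (h0 : Comp F ∅ 0 (co 0)) (j : ℕ) :
    ∀ {ω : E}, ω ^ s ^ j = 1 →
      (∀ u v i, Comp F (co u ∪ co v) c (co (u + ω ^ i * v))) → ∀ v : ℕ → E,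
      Comp F (⋃ r ∈ Finset.range (s ^ j), co (v r)) (c * s * s ^ j * j)
        (⋃ i ∈ Finset.range (s ^ j), co (∑ r ∈ Finset.range (s ^ j), ω ^ (i * r) * v r)) := by
  induction j with
  | zero =>
    intro ω _ _ v
    exact (Comp.of_subset (by simp)).mono_cost (Nat.zero_le _)
  | succ j ih =>
    intro ω hω hco v
    set n := s ^ j with hn
    have hn0 : 0 < n := pow_pos hs j
    have hsn : s ^ (j + 1) = s * n := by rw [hn, pow_succ, mul_comm]
    rw [hsn] at hω ⊢
    have hωs : (ω ^ s) ^ n = 1 := by rw [← pow_mul, hω]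
    -- Decimation: `u r` is the transform, with root `ω ^ s`, of the subsequence of the indices
    -- congruent to `r` modulo `s`. Each output then combines `s` of these values, and `u r` has
    -- period `n`.
    set u : ℕ → ℕ → E := fun r i => ∑ t ∈ Finset.range n, (ω ^ s) ^ (i * t) * v (s * t + r)
      with hu
    have h1 : Comp F (⋃ q ∈ Finset.range (s * n), co (v q)) (s * (c * s * n * j))
        (⋃ r ∈ Finset.range s, ⋃ i ∈ Finset.range n, co (u r i)) := by
      refine (Comp.biUnion_const (F := F) (t := c * s * n * j) (Finset.range s)
        fun r hr => ?_).mono_cost (by simp)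
      refine (ih hωs (fun a b i => ?_) fun t => v (s * t + r)).mono_left' ?_
      · rw [← pow_mul]; exact hco a b _
      · refine Set.iUnion₂_subset fun t ht => ?_
        rw [Finset.mem_range] at ht hr
        refine Set.subset_biUnion_of_mem (u := fun q => co (v q)) (Finset.mem_range.2 ?_)
        calc s * t + r < s * t + s := by omega
          _ = s * (t + 1) := by ring
          _ ≤ s * n := Nat.mul_le_mul_left _ ht
    have h2 : ∀ i, ∑ q ∈ Finset.range (s * n), ω ^ (i * q) * v q =
        ∑ r ∈ Finset.range s, ω ^ (i * r) * u r (i % n) := by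
      intro i
      rw [Finset.sum_range_mul_eq, Finset.sum_comm]
      refine Finset.sum_congr rfl fun r _ => ?_
      rw [hu, Finset.mul_sum]
      refine Finset.sum_congr rfl fun t _ => ?_
      have : (ω ^ s) ^ (i % n * t) = (ω ^ s) ^ (i * t) := by
        rw [pow_mul, pow_mul _ i, ← pow_eq_pow_mod i hωs]
      rw [this, ← mul_assoc, ← pow_mul, ← pow_add]
      congr 2
      ring
    have h3 : Comp F (⋃ r ∈ Finset.range s, ⋃ i ∈ Finset.range n, co (u r i))
        (s * n * (s * c))
        (⋃ i ∈ Finset.range (s * n),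
          co (∑ r ∈ Finset.range (s * n), ω ^ (i * r) * v r)) := by
      refine (Comp.biUnion_const (F := F) (t := s * c) (Finset.range (s * n))
        fun i _ => ?_).mono_cost (by simp)
      rw [h2 i]
      refine (Comp.range_sum h0 hco (fun r => u r (i % n)) i s).mono_left' ?_
      refine Set.iUnion₂_mono fun r _ => ?_
      exact Set.subset_biUnion_of_mem (u := fun i => co (u r i))
        (Finset.mem_range.2 (Nat.mod_lt _ hn0))
    exact (h1.trans h3).mono_cost (le_of_eq (by ring))

/-- When the prime `s` does not divide `d`, the exponents `r * d` run through all residues modulo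
`s`, so the sum is a rearrangement of the geometric sum of `ζ`. Only the radices 2 and 3 occur
later. -/
theorem sum_pow_mul_eq_zero {s : ℕ} (hs : s = 2 ∨ s = 3) {ζ : E}
    (hζ : ∑ r ∈ Finset.range s, ζ ^ r = 0) {d : ℕ} (hd : ¬ s ∣ d) :
    ∑ r ∈ Finset.range s, ζ ^ (r * d) = 0 := by
  have hζs : ζ ^ s = 1 := by
    have := geom_sum_mul ζ s
    rw [hζ, zero_mul] at this
    exact (sub_eq_zero.1 this.symm)
  have key : ∀ r, ζ ^ (r * d) = ζ ^ (r * (d % s)) := by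
    intro r
    conv_lhs => rw [← Nat.div_add_mod d s, mul_add, pow_add, mul_left_comm, pow_mul, hζs, one_pow,
      one_mul]
  simp_rw [key]
  rcases hs with rfl | rfl
  · have : d % 2 = 1 := by omega
    simpa [this] using hζ
  · have : d % 3 = 1 ∨ d % 3 = 2 := by omega
    rcases this with h | h
    · simpa [h] using hζ
    · rw [h]
      simp only [Finset.sum_range_succ, Finset.sum_range_zero, zero_mul, zero_add, pow_zero,
        one_mul, pow_one] at hζ ⊢
      have h4 : ζ ^ (2 * 2) = ζ := by rw [show 2 * 2 = 3 + 1 from rfl, pow_succ, hζs, one_mul]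
      rw [h4, ← hζ]
      ring

/-- Orthogonality of the characters of a cyclic group of order `s ^ (c + 1)`. -/
theorem sum_root_pow {s : ℕ} (hs : s = 2 ∨ s = 3) (c : ℕ) :
    ∀ {ω : E}, ∑ r ∈ Finset.range s, (ω ^ s ^ c) ^ r = 0 → ∀ d : ℕ,
      ∑ i ∈ Finset.range (s ^ (c + 1)), ω ^ (i * d) =
        if s ^ (c + 1) ∣ d then ((s ^ (c + 1) : ℕ) : E) else 0 := by
  have hs0 : 0 < s := by omega
  induction c with
  | zero =>
    intro ω hζ d
    simp only [pow_zero, pow_one, zero_add] at hζ ⊢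
    split_ifs with h
    · obtain ⟨d, rfl⟩ := h
      have hωs : ω ^ s = 1 := by
        have := geom_sum_mul ω s
        rw [hζ, zero_mul] at this
        exact (sub_eq_zero.1 this.symm)
      have : ∀ i, ω ^ (i * (s * d)) = 1 := fun i => by
        rw [mul_left_comm, pow_mul, hωs, one_pow]
      simp [this]
    · exact sum_pow_mul_eq_zero hs hζ h
  | succ c ih =>
    intro ω hζ d
    -- If `s ∣ d`, the sum repeats the one for `ω ^ s` exactly `s` times. Otherwise the indices in
    -- one class modulo `s ^ (c + 1)` already sum to zero.
    by_cases h : s ∣ d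
    · obtain ⟨d, rfl⟩ := h
      have hζ' : ∑ r ∈ Finset.range s, ((ω ^ s) ^ s ^ c) ^ r = 0 := by
        rw [← pow_mul, ← pow_succ']
        exact hζ
      have hper : ((ω ^ s) ^ s ^ (c + 1)) = 1 := by
        have := geom_sum_mul ((ω ^ s) ^ s ^ c) s
        rw [hζ', zero_mul] at this
        rw [pow_succ, pow_mul]
        exact (sub_eq_zero.1 this.symm)
      have h1 := ih hζ' d
      have e : s ^ (c + 1 + 1) = s ^ (c + 1) * s := by rw [pow_succ]
      have hdvd : s ^ (c + 1 + 1) ∣ s * d ↔ s ^ (c + 1) ∣ d := by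
        rw [pow_succ', Nat.mul_dvd_mul_iff_left hs0]
      rw [e, Finset.sum_range_mul_eq, Finset.sum_congr rfl
        (g := fun t => ∑ i ∈ Finset.range (s ^ (c + 1)), (ω ^ s) ^ (i * d))]
      · rw [h1, ← e, Finset.sum_const, Finset.card_range, smul_ite, smul_zero]
        simp only [hdvd, nsmul_eq_mul]
        congr 1
        push_cast
        ring
      · intro t _
        refine Finset.sum_congr rfl fun r _ => ?_
        have : (s ^ (c + 1) * t + r) * (s * d) =
          s * (s ^ (c + 1) * (t * d)) + s * (r * d) := by ring
        rw [this, pow_add, pow_mul, pow_mul (ω ^ s), hper, one_pow, one_mul, pow_mul]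
    · rw [if_neg fun h' => h ((dvd_pow_self s (Nat.succ_ne_zero _)).trans h'), pow_succ,
        Finset.sum_range_mul_eq, Finset.sum_comm]
      refine Finset.sum_eq_zero fun i _ => ?_
      have : ∀ t, ω ^ ((s ^ (c + 1) * t + i) * d) = ω ^ (i * d) * (ω ^ s ^ (c + 1)) ^ (t * d) := by
        intro t
        rw [← pow_mul, ← pow_add]
        congr 1
        ring
      simp_rw [this]
      rw [← Finset.mul_sum, sum_pow_mul_eq_zero hs hζ h, mul_zero]

/-- `ω ^ (K - 1)` stands in for the inverse of `ω`. The sum over `I` stays unevaluated, so that the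
identity serves both for all frequencies and for those not divisible by `s`. -/
theorem convolution_of_dft (ω : E) (I : Finset ℕ) (K j : ℕ) (g v : ℕ → E) :
    ∑ i ∈ I, (ω ^ (K - 1)) ^ (j * i) * ((∑ a ∈ Finset.range K, ω ^ (i * a) * g a) *
        ∑ b ∈ Finset.range K, ω ^ (i * b) * v b) =
      ∑ a ∈ Finset.range K, ∑ b ∈ Finset.range K,
        g a * v b * ∑ i ∈ I, ω ^ (i * (a + b + (K - 1) * j)) := by
  simp_rw [Finset.sum_mul_sum, Finset.mul_sum]
  rw [Finset.sum_comm]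
  refine Finset.sum_congr rfl fun a _ => ?_
  rw [Finset.sum_comm]
  refine Finset.sum_congr rfl fun b _ => Finset.sum_congr rfl fun i _ => ?_
  rw [show i * (a + b + (K - 1) * j) = (K - 1) * (j * i) + (i * a + i * b) by ring, pow_add,
    pow_add, pow_mul]
  ring

/-- `K - 1` is `-1` modulo every divisor `k` of `K`. -/
theorem dvd_add_pred_mul_iff {K : ℕ} (hK : 0 < K) {k : ℕ} (hk : k ∣ K) (t j : ℕ) :
    k ∣ t + (K - 1) * j ↔ j % k = t % k := by
  obtain ⟨K, rfl⟩ : ∃ K', K = K' + 1 := ⟨K - 1, by omega⟩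
  rw [Nat.add_sub_cancel]
  have h1 : t + K * j + j = t + (K + 1) * j := by ring
  constructor
  · intro h
    have h2 : (t + K * j + j) % k = j % k := by
      rw [Nat.add_mod, Nat.mod_eq_zero_of_dvd h, zero_add, Nat.mod_mod]
    rw [← h2, h1, Nat.add_mod, Nat.mod_eq_zero_of_dvd (hk.mul_right j), add_zero, Nat.mod_mod]
  · intro h
    have : (0 : ℕ) + j ≡ (t + K * j) + j [MOD k] := by
      rw [h1, zero_add, Nat.ModEq, h, Nat.add_mod t, Nat.mod_eq_zero_of_dvd (hk.mul_right j),
        add_zero, Nat.mod_mod]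
    exact (Nat.modEq_zero_iff_dvd).1 (Nat.ModEq.add_right_cancel' j this).symm

end FourierTransform

/-! ### Multiplication by a fixed polynomial with roots of unity; cyclotomic moduli and block
splitting -/

section FastMultiplication

variable {F 𝒜 : Type*} [Field F] [CommRing 𝒜] [Algebra F 𝒜]

theorem Polynomial.eq_sum_range_of_degree_lt {R : Type*} [CommRing R] {P : R[X]} {n : ℕ}
    (hP : P.degree < n) : P = ∑ i ∈ Finset.range n, C (P.coeff i) * X ^ i := by
  ext i
  simp_rw [finsetSum_coeff, coeff_C_mul_X_pow]
  rw [Finset.sum_ite_eq (Finset.range n) i fun j => P.coeff j]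
  split_ifs with h
  · rfl
  · exact (degree_lt_iff_coeff_zero _ _).1 hP i (by simpa using h)

/-- Multiplication by a fixed polynomial by means of the radix-2 fast Fourier transform. -/
theorem Comp.coeffSet_mul_fft {j : ℕ} {ω : F} (hω : IsPrimitiveRoot ω (2 ^ (j + 1))) (g : F[X])
    {P : 𝒜[X]} (hg : g.degree < (2 ^ j : ℕ)) (hP : P.degree < (2 ^ j : ℕ)) :
    Comp F (coeffSet P) (2 ^ (j + 1) * (8 * (j + 1) + 2))
      (coeffSet (g.map (algebraMap F 𝒜) * P)) := by
  set K := 2 ^ (j + 1) with hK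
  have hK0 : 0 < K := by positivity
  have hK2 : K = 2 ^ j + 2 ^ j := by rw [hK]; ring
  set W : 𝒜 := algebraMap F 𝒜 ω with hW
  have hWK : W ^ K = 1 := by rw [hW, ← map_pow, hω.pow_eq_one, map_one]
  have hhalf : ω ^ 2 ^ j = -1 := by
    have h1 : IsPrimitiveRoot (ω ^ 2 ^ j) 2 := hω.pow hK0 (by rw [hK, pow_succ])
    exact h1.eq_neg_one_of_two_right
  have hKF : (K : F) ≠ 0 := by
    have : NeZero ((2 ^ (j + 1) : ℕ) : F) := hω.neZero' (n := 2 ^ (j + 1))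
    exact this.out
  have hζ : ∑ r ∈ Finset.range 2, (W ^ 2 ^ j) ^ r = 0 := by
    rw [hW, ← map_pow, hhalf]
    simp [Finset.sum_range_succ]
  have hco : ∀ (w : F) (u v : 𝒜) (i : ℕ),
      Comp F ({u} ∪ {v}) 2 {u + (algebraMap F 𝒜 w) ^ i * v} := by
    intro w u v i
    rw [← map_pow, ← Algebra.smul_def]
    exact Comp.add (t := 0) (t' := 1) (.of_mem (Or.inl rfl))
      (.smul _ (.of_mem (Or.inr rfl)))
  set V : ℕ → 𝒜 := fun i => ∑ r ∈ Finset.range K, W ^ (i * r) * P.coeff r with hV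
  set G : ℕ → F := fun i => ∑ r ∈ Finset.range K, ω ^ (i * r) * g.coeff r with hG
  set U : ℕ → 𝒜 := fun i => ∑ r ∈ Finset.range K, (W ^ (K - 1)) ^ (i * r) * (G r • V r) with hU
  have h1 : Comp F (coeffSet P) (4 * K * (j + 1)) (⋃ i ∈ Finset.range K, {V i}) := by
    refine (Comp.dft (co := fun u : 𝒜 => {u}) (c := 2) 2 two_pos Comp.zero_mem (j + 1)
      hWK (hco ω) P.coeff).mono_left' ?_
    exact Set.iUnion₂_subset fun i _ => by simpa using coeff_mem_coeffSet P i
  have h2 : Comp F (⋃ i ∈ Finset.range K, {V i}) K (⋃ i ∈ Finset.range K, {G i • V i}) := by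
    refine (Comp.biUnion_const (F := F) (t := 1) _ fun i hi => ?_).mono_cost (by simp)
    exact Comp.smul _ (.of_mem (Set.mem_biUnion hi (by simp)))
  have h3 : Comp F (⋃ i ∈ Finset.range K, {G i • V i}) (4 * K * (j + 1))
      (⋃ i ∈ Finset.range K, {U i}) := by
    refine Comp.dft (co := fun u : 𝒜 => {u}) (c := 2) 2 two_pos Comp.zero_mem (j + 1)
      (ω := W ^ (K - 1)) ?_ ?_ fun i => G i • V i
    · rw [← hK, ← pow_mul, mul_comm, pow_mul, hWK, one_pow]
    · rw [hW, ← map_pow]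
      exact hco _
  -- Both factors have degree below `K / 2`, so the cyclic convolution of length `K` does not wrap
  -- around.
  have hUj : ∀ i < K, (K : F)⁻¹ • U i = (g.map (algebraMap F 𝒜) * P).coeff i := by
    intro i hi
    have e1 : U i = ∑ a ∈ Finset.range K, ∑ b ∈ Finset.range K,
        (g.map (algebraMap F 𝒜)).coeff a * P.coeff b *
          if (a + b) % K = i then (K : 𝒜) else 0 := by
      have := convolution_of_dft W (Finset.range K) K i (g.map (algebraMap F 𝒜)).coeff P.coeff
      rw [hU]
      simp only [Algebra.smul_def, hG, hV, map_sum, map_mul, map_pow]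
      simp only [coeff_map] at this ⊢
      rw [this]
      refine Finset.sum_congr rfl fun a _ => Finset.sum_congr rfl fun b _ => ?_
      rw [sum_root_pow (Or.inl rfl) j hζ]
      congr 1
      refine if_congr ?_ rfl rfl
      rw [dvd_add_pred_mul_iff hK0 dvd_rfl, Nat.mod_eq_of_lt hi, eq_comm]
    have hgc := (degree_lt_iff_coeff_zero _ _).1 hg
    have hPc := (degree_lt_iff_coeff_zero _ _).1 hP
    have e2 : (g.map (algebraMap F 𝒜) * P).coeff i = ∑ a ∈ Finset.range K,
        ∑ b ∈ Finset.range K, if (a + b) % K = i then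
          (g.map (algebraMap F 𝒜)).coeff a * P.coeff b else 0 := by
      have hgK : (g.map (algebraMap F 𝒜)).degree < K :=
        (degree_map_le).trans_lt (hg.trans_le (by exact_mod_cast (by omega)))
      have hPK : P.degree < K := hP.trans_le (by exact_mod_cast (by omega))
      conv_lhs => rw [eq_sum_range_of_degree_lt hgK, eq_sum_range_of_degree_lt hPK]
      rw [Finset.sum_mul_sum, finsetSum_coeff]
      refine Finset.sum_congr rfl fun a ha => ?_
      rw [finsetSum_coeff]
      refine Finset.sum_congr rfl fun b hb => ?_
      rw [Finset.mem_range] at ha hb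
      rw [mul_mul_mul_comm, ← C_mul, ← pow_add, coeff_C_mul_X_pow]
      by_cases h : a < 2 ^ j ∧ b < 2 ^ j
      · rw [Nat.mod_eq_of_lt (by omega)]
        exact if_congr eq_comm rfl rfl
      · have h0 : (g.map (algebraMap F 𝒜)).coeff a * P.coeff b = 0 := by
          rcases le_or_gt (2 ^ j) a with h' | h'
          · rw [coeff_map, hgc _ h', map_zero, zero_mul]
          · rw [hPc b (by omega), mul_zero]
        rw [h0]
        simp
    rw [e1, e2, Finset.smul_sum]
    refine Finset.sum_congr rfl fun a _ => ?_
    rw [Finset.smul_sum]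
    refine Finset.sum_congr rfl fun b _ => ?_
    split_ifs
    · rw [Algebra.smul_def, mul_left_comm, ← map_natCast (algebraMap F 𝒜), ← map_mul,
        inv_mul_cancel₀ hKF, map_one, mul_one]
    · simp
  have hdeg : (g.map (algebraMap F 𝒜) * P).degree < K := by
    rw [degree_lt_iff_coeff_zero] at hg hP ⊢
    intro i hi
    rw [coeff_mul]
    refine Finset.sum_eq_zero fun x hx => ?_
    rw [Finset.HasAntidiagonal.mem_antidiagonal] at hx
    rcases le_or_gt (2 ^ j) x.1 with h | h
    · rw [coeff_map, hg _ h, map_zero, zero_mul]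
    · rw [hP _ (by omega), mul_zero]
  have h4 : Comp F (⋃ i ∈ Finset.range K, {U i}) (K * 1)
      (coeffSet (g.map (algebraMap F 𝒜) * P)) := by
    refine Comp.coeffSet_of_degree_lt hdeg fun i hi => ?_
    rw [← hUj i hi]
    exact Comp.smul _ (.of_mem (Set.mem_biUnion (Finset.mem_coe.2 (Finset.mem_range.2 hi))
      (by simp)))
  exact (((h1.trans h2).trans h3).trans h4).mono_cost (le_of_eq (by ring))

/-- The polynomial `1 + X ^ N + ⋯ + X ^ ((s - 1) N)` with `N = s ^ a`; for a prime `s` it is the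
cyclotomic polynomial of order `s ^ (a + 1)`. -/
noncomputable def primePowCyclotomic (F : Type*) [Field F] (s a : ℕ) : F[X] :=
  ∑ r ∈ Finset.range s, X ^ (r * s ^ a)

theorem primePowCyclotomic_monic_degree {s : ℕ} (hs : 0 < s) (a : ℕ) :
    (primePowCyclotomic F s a).Monic ∧
      (primePowCyclotomic F s a).degree = ((s - 1) * s ^ a : ℕ) := by
  obtain ⟨t, rfl⟩ : ∃ t, s = t + 1 := ⟨s - 1, by omega⟩
  have h : (∑ r ∈ Finset.range t, (X : F[X]) ^ (r * (t + 1) ^ a)).degree <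
      (t * (t + 1) ^ a : ℕ) := by
    rw [degree_lt_iff_coeff_zero]
    intro m hm
    rw [finsetSum_coeff]
    refine Finset.sum_eq_zero fun r hr => ?_
    rw [coeff_X_pow, if_neg]
    have : r * (t + 1) ^ a < t * (t + 1) ^ a :=
      Nat.mul_lt_mul_of_pos_right (Finset.mem_range.1 hr) (by positivity)
    omega
  have e : primePowCyclotomic F (t + 1) a =
      X ^ (t * (t + 1) ^ a) + ∑ r ∈ Finset.range t, (X : F[X]) ^ (r * (t + 1) ^ a) := by
    rw [primePowCyclotomic, Finset.sum_range_succ, add_comm]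
  rw [e]
  refine ⟨monic_X_pow_add h, ?_⟩
  rw [degree_add_eq_left_of_degree_lt (by rwa [degree_X_pow]), degree_X_pow, Nat.add_sub_cancel]

theorem primePowCyclotomic_support_card (s a : ℕ) :
    (primePowCyclotomic F s a).support.card ≤ s := by
  refine (Finset.card_le_card (t := (Finset.range s).image (· * s ^ a)) ?_).trans
    (Finset.card_image_le.trans (by simp))
  intro i hi
  rw [mem_support_iff, primePowCyclotomic, finsetSum_coeff] at hi
  obtain ⟨r, hr, h⟩ := Finset.exists_ne_zero_of_sum_ne_zero hi
  rw [coeff_X_pow] at h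
  exact Finset.mem_image.2 ⟨r, hr, (by_contra fun h' => h (if_neg fun h'' => h' h''.symm))⟩

/-- Cutting into blocks of `m` coefficients is free: the block coefficients are coefficients of `P`,
including the padding zero, which is the coefficient of index `m * K`. -/
theorem eq_sum_X_pow_mul {P : 𝒜[X]} {m K : ℕ} (hP : P.degree < (m * K : ℕ)) :
    ∃ Q : ℕ → 𝒜[X], (∀ r, (Q r).degree < m ∧ coeffSet (Q r) ⊆ coeffSet P) ∧
      P = ∑ r ∈ Finset.range K, X ^ (m * r) * Q r := by
  refine ⟨fun r => ∑ j ∈ Finset.range m, C (P.coeff (m * r + j)) * X ^ j, fun r => ⟨?_, ?_⟩, ?_⟩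
  · rw [degree_lt_iff_coeff_zero]
    intro i hi
    rw [finsetSum_coeff]
    refine Finset.sum_eq_zero fun j hj => ?_
    rw [coeff_C_mul_X_pow, if_neg]
    rw [Finset.mem_range] at hj
    omega
  · rintro _ ⟨i, rfl⟩
    rw [finsetSum_coeff]
    simp_rw [coeff_C_mul_X_pow]
    rw [Finset.sum_ite_eq (Finset.range m) i fun j => P.coeff (m * r + j)]
    split_ifs
    · exact coeff_mem_coeffSet _ _
    · exact ⟨m * K, (degree_lt_iff_coeff_zero _ _).1 hP _ le_rfl⟩
  · conv_lhs => rw [eq_sum_range_of_degree_lt hP]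
    rw [Finset.sum_range_mul_eq]
    refine Finset.sum_congr rfl fun t _ => ?_
    rw [Finset.mul_sum]
    refine Finset.sum_congr rfl fun j _ => ?_
    rw [pow_add]
    ring

end FastMultiplication

/-! ### The Schönhage–Strassen recursion in radix 2 or 3 -/

section SchoenhageStrassen

variable {F 𝒜 : Type*} [Field F] [CommRing 𝒜] [Algebra F 𝒜]

theorem coeffSet_X_pow_mul_subset (e : ℕ) (P : 𝒜[X]) :
    coeffSet (X ^ e * P) ⊆ coeffSet P ∪ Set.range (algebraMap F 𝒜) := by
  rintro _ ⟨i, rfl⟩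
  rw [coeff_X_pow_mul']
  split_ifs
  · exact Or.inl (coeff_mem_coeffSet _ _)
  · exact Or.inr ⟨0, map_zero _⟩

theorem Comp.coeffSet_X_pow_mul (e : ℕ) (P : 𝒜[X]) :
    Comp F (coeffSet P) 0 (coeffSet (X ^ e * P)) :=
  .of_subset_union (coeffSet_X_pow_mul_subset e P)

/-- In `𝒜[X] / Φ_s(X ^ s ^ b)`, multiplication by a power of the root is cheap. -/
theorem Comp.adjoinRoot_add_root_pow_mul [Nontrivial 𝒜] {s : ℕ} (hs : 0 < s) (b : ℕ)
    {Ψ' : 𝒜[X]} (hΨ' : Ψ' = (primePowCyclotomic F s b).map (algebraMap F 𝒜)) (hΨ : Ψ'.Monic)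
    (hroot : AdjoinRoot.root Ψ' ^ s ^ (b + 1) = 1) (q : ℕ) (u v : AdjoinRoot Ψ') :
    Comp F (coeffSet (AdjoinRoot.modByMonicHom hΨ u) ∪ coeffSet (AdjoinRoot.modByMonicHom hΨ v))
      ((4 * s + 1) * s ^ (b + 1))
      (coeffSet (AdjoinRoot.modByMonicHom hΨ (u + AdjoinRoot.root _ ^ q * v))) := by
  obtain ⟨hmon, hdeg⟩ := primePowCyclotomic_monic_degree (F := F) hs b
  set rep := AdjoinRoot.modByMonicHom hΨ with hrep
  have hdegΨ : Ψ'.degree = ((s - 1) * s ^ b : ℕ) := by rw [hΨ', hmon.degree_map, hdeg]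
  have hle : (s - 1) * s ^ b ≤ s ^ (b + 1) := by
    rw [pow_succ', ]
    exact Nat.mul_le_mul_right _ (Nat.sub_le _ _)
  have hrepdeg : ∀ d, (rep d).degree < ((s - 1) * s ^ b : ℕ) := by
    intro d
    obtain ⟨f, rfl⟩ := AdjoinRoot.mk_surjective d
    rw [hrep, AdjoinRoot.modByMonicHom_mk, ← hdegΨ]
    exact degree_modByMonic_lt _ hΨ
  -- The root has order dividing `s ^ (b + 1)`, so a shift by less than that suffices. The reduction
  -- that follows is by a polynomial with at most `s` terms.
  rw [pow_eq_pow_mod q hroot]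
  set e := q % s ^ (b + 1) with he
  have he' : e < s ^ (b + 1) := Nat.mod_lt _ (by positivity)
  have hmul : rep (AdjoinRoot.root Ψ' ^ e * v) = (X ^ e * rep v) %ₘ Ψ' := by
    conv_lhs => rw [← AdjoinRoot.mk_leftInverse hΨ v, ← AdjoinRoot.mk_X, ← map_pow, ← map_mul]
    rw [hrep, AdjoinRoot.modByMonicHom_mk]
  rw [map_add, hmul]
  have hXdeg : (X ^ e * rep v).degree < ((2 * s ^ (b + 1) : ℕ) : WithBot ℕ) := by
    have := (degree_lt_iff_coeff_zero _ _).1 (hrepdeg v)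
    rw [degree_lt_iff_coeff_zero]
    intro i hi
    rw [coeff_X_pow_mul', if_pos (by omega), this _ (by omega)]
  have h1 : Comp F (coeffSet (rep v)) (4 * s * s ^ (b + 1))
      (coeffSet ((X ^ e * rep v) %ₘ Ψ')) := by
    have h := Comp.coeffSet_modByMonic hmon hXdeg
    rw [← hΨ'] at h
    refine ((Comp.coeffSet_X_pow_mul e (rep v)).trans h).mono_cost ?_
    rw [zero_add, show 4 * s * s ^ (b + 1) = 2 * s ^ (b + 1) * (2 * s) by ring]
    exact Nat.mul_le_mul_left _ (Nat.mul_le_mul_left _ (primePowCyclotomic_support_card s b))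
  have h2 : Comp F (coeffSet (rep u) ∪ coeffSet ((X ^ e * rep v) %ₘ Ψ')) (s ^ (b + 1))
      (coeffSet (rep u + (X ^ e * rep v) %ₘ Ψ')) := by
    refine (Comp.coeffSet_add (n := (s - 1) * s ^ b) ?_).mono_cost hle
    rw [← hdegΨ]
    exact degree_modByMonic_lt _ hΨ
  refine (((h1.mono_left' Set.subset_union_right).append (h2.mono_left' ?_)).mono_right
    Set.subset_union_right).mono_cost (le_of_eq (by ring))
  exact Set.union_subset (Set.subset_union_left.trans Set.subset_union_left)
    Set.subset_union_right

/-- Coefficient of `Y ^ j` in the representative of `Y ^ t` modulo `Φ_s(Y ^ k)` that is divisible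
by `Y ^ k - 1`, where `K = s k`. -/
noncomputable def wrapCoeff (F : Type*) [Field F] (K k t j : ℕ) : F :=
  (K : F)⁻¹ * ((if j % K = t % K then (K : F) else 0) - (if j % k = t % k then (k : F) else 0))

/-- The first part of `wrapCoeff` contributes `η ^ t`, since `η ^ (k * s) = 1`. The second part sums
over a full class modulo `k`, which yields the vanishing geometric sum of `η ^ k`. -/
theorem sum_wrapCoeff {E : Type*} [CommRing E] (φ : F →+* E) {s k : ℕ} (hs : 0 < s) (hk : 0 < k)
    (hF : ((k * s : ℕ) : F) ≠ 0) {η : E} (hη : ∑ r ∈ Finset.range s, (η ^ k) ^ r = 0) (t : ℕ) :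
    ∑ j ∈ Finset.range (k * s), φ (wrapCoeff F (k * s) k t j) * η ^ j = η ^ t := by
  have hηK : η ^ (k * s) = 1 := by
    have := geom_sum_mul (η ^ k) s
    rw [hη, zero_mul, ← pow_mul] at this
    exact (sub_eq_zero.1 this.symm)
  have hK : 0 < k * s := Nat.mul_pos hk hs
  have h1 : ∑ j ∈ Finset.range (k * s), (if j % (k * s) = t % (k * s) then ((k * s : ℕ) : E) else 0)
      * η ^ j = ((k * s : ℕ) : E) * η ^ t := by
    rw [Finset.sum_congr rfl (g := fun j => if t % (k * s) = j then
      ((k * s : ℕ) : E) * η ^ j else 0)]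
    · rw [Finset.sum_ite_eq, if_pos (Finset.mem_range.2 (Nat.mod_lt _ hK)),
        ← pow_eq_pow_mod t hηK]
    · intro j hj
      rw [Nat.mod_eq_of_lt (Finset.mem_range.1 hj), ite_mul, zero_mul]
      exact if_congr eq_comm rfl rfl
  have h2 : ∑ j ∈ Finset.range (k * s), (if j % k = t % k then (k : E) else 0) * η ^ j = 0 := by
    rw [Finset.sum_range_mul_eq, Finset.sum_comm]
    refine Finset.sum_eq_zero fun i hi => ?_
    rw [Finset.mem_range] at hi
    simp_rw [Nat.mul_add_mod, pow_add, pow_mul]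
    rw [← Finset.mul_sum, ← Finset.sum_mul, hη, zero_mul, mul_zero]
  simp_rw [wrapCoeff, map_mul, mul_assoc]
  rw [← Finset.mul_sum]
  simp_rw [map_sub, sub_mul, apply_ite φ, map_zero, map_natCast]
  rw [Finset.sum_sub_distrib, h1, h2, sub_zero, ← mul_assoc, ← map_natCast φ, ← map_mul,
    inv_mul_cancel₀ hF, map_one, one_mul]

theorem card_filter_not_dvd {s : ℕ} (hs : s = 2 ∨ s = 3) (k T : ℕ) :
    ∑ i ∈ Finset.range (s * k), (if s ∣ i then 0 else T) = (s - 1) * k * T := by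
  rw [Finset.sum_range_mul_eq]
  simp_rw [Nat.dvd_add_right (Dvd.intro _ rfl : s ∣ s * _)]
  rcases hs with rfl | rfl
  · simp [Finset.sum_range_succ]
  · simp [Finset.sum_range_succ]
    ring

/-- The sum over all indices minus the sum over the multiples of `s`; the latter is the
orthogonality relation for `ω ^ s`. -/
theorem sum_filter_not_dvd_root_pow {E : Type*} [CommRing E] {s : ℕ} (hs : s = 2 ∨ s = 3) (c : ℕ)
    {ω : E} (hω : ∑ r ∈ Finset.range s, (ω ^ s ^ (c + 1)) ^ r = 0) (d : ℕ) :
    ∑ i ∈ Finset.range (s ^ (c + 2)) with ¬ s ∣ i, ω ^ (i * d) =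
      (if s ^ (c + 2) ∣ d then ((s ^ (c + 2) : ℕ) : E) else 0) -
        (if s ^ (c + 1) ∣ d then ((s ^ (c + 1) : ℕ) : E) else 0) := by
  have hs0 : 0 < s := by omega
  have h1 := sum_root_pow hs (c + 1) hω d
  have hω' : ∑ r ∈ Finset.range s, ((ω ^ s) ^ s ^ c) ^ r = 0 := by
    rw [← pow_mul, ← pow_succ']
    exact hω
  have h2 := sum_root_pow hs c hω' d
  rw [← h1, ← h2, eq_sub_iff_add_eq]
  rw [← Finset.sum_filter_add_sum_filter_not (Finset.range (s ^ (c + 1 + 1))) (s ∣ ·), add_comm]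
  congr 1
  rw [Finset.sum_filter, pow_succ' s (c + 1), Finset.sum_range_mul_eq]
  refine Finset.sum_congr rfl fun t _ => ?_
  rw [Finset.sum_eq_single 0]
  · simp [← pow_mul, mul_assoc]
  · intro r hr hr0
    rw [if_neg]
    rw [Nat.dvd_add_right (Dvd.intro _ rfl)]
    exact Nat.not_dvd_of_pos_of_lt (Nat.pos_of_ne_zero hr0) (Finset.mem_range.1 hr)
  · simp [hs0]

variable (F 𝒜) in
/-- `T` operations suffice for multiplication by a fixed polynomial modulo `Φ_s(X ^ s ^ a)`. -/
def MulModCost (s a T : ℕ) : Prop :=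
  ∀ (g : F[X]) (P : 𝒜[X]), P.degree < ((s - 1) * s ^ a : ℕ) → Comp F (coeffSet P) T
    (coeffSet ((g.map (algebraMap F 𝒜) * P) %ₘ (primePowCyclotomic F s a).map (algebraMap F 𝒜)))

theorem root_geom_sum {s a : ℕ} {Ψ : 𝒜[X]}
    (hΨ : Ψ = (primePowCyclotomic F s a).map (algebraMap F 𝒜)) :
    ∑ r ∈ Finset.range s, (AdjoinRoot.root Ψ ^ s ^ a) ^ r = 0 := by
  have : AdjoinRoot.mk Ψ Ψ = 0 := AdjoinRoot.mk_self
  have h : AdjoinRoot.mk Ψ (((primePowCyclotomic F s a)).map (algebraMap F 𝒜)) = 0 := by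
    rw [← hΨ, this]
  rw [primePowCyclotomic] at h
  simpa [Polynomial.map_sum, ← pow_mul, mul_comm] using h

/-- The fixed factor `g` is first reduced modulo the cyclotomic polynomial, which is free because it
involves constants only. This keeps the bound independent of the degree of `g`. -/
theorem MulModCost.naive [Nontrivial 𝒜] {s : ℕ} (hs : 0 < s) (a : ℕ) :
    MulModCost F 𝒜 s a ((2 * s ^ (a + 1)) * (2 * s ^ (a + 1) * 2) +
      2 * s ^ (a + 1) * (2 * s)) := by
  intro g P hP
  obtain ⟨hmon, hdeg⟩ := primePowCyclotomic_monic_degree (F := F) hs a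
  set Θ := primePowCyclotomic F s a with hΘ
  have hmon' : (Θ.map (algebraMap F 𝒜)).Monic := hmon.map _
  have hle : (s - 1) * s ^ a ≤ s ^ (a + 1) := by
    rw [pow_succ']
    exact Nat.mul_le_mul_right _ (Nat.sub_le _ _)
  have hP' : P.degree < (s ^ (a + 1) : ℕ) := hP.trans_le (by exact_mod_cast hle)
  have hg' : (g %ₘ Θ).degree < (s ^ (a + 1) : ℕ) := by
    refine (degree_modByMonic_lt _ hmon).trans_le ?_
    rw [hdeg]
    exact_mod_cast hle
  have hmod : (g.map (algebraMap F 𝒜) * P) %ₘ Θ.map (algebraMap F 𝒜) =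
      ((g %ₘ Θ).map (algebraMap F 𝒜) * P) %ₘ Θ.map (algebraMap F 𝒜) := by
    rw [← sub_eq_zero, ← sub_modByMonic, modByMonic_eq_zero_iff_dvd hmon', ← sub_mul,
      ← Polynomial.map_sub, modByMonic_eq_sub_mul_div g, sub_sub_cancel, Polynomial.map_mul,
      mul_assoc]
    exact Dvd.intro _ rfl
  rw [hmod]
  have h1 := Comp.coeffSet_mul_naive (F := F) (g %ₘ Θ) hP' hg'
  rw [← two_mul] at h1
  refine h1.trans ((Comp.coeffSet_modByMonic hmon (n := 2 * s ^ (a + 1)) ?_).mono_cost ?_)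
  · rw [degree_lt_iff_coeff_zero] at hP' hg' ⊢
    intro i hi
    rw [coeff_mul]
    refine Finset.sum_eq_zero fun x hx => ?_
    rw [Finset.HasAntidiagonal.mem_antidiagonal] at hx
    rcases le_or_gt (s ^ (a + 1)) x.1 with h | h
    · rw [coeff_map, hg' _ h, map_zero, zero_mul]
    · rw [hP' _ (by omega), mul_zero]
  · exact Nat.mul_le_mul_left _ (Nat.mul_le_mul_left _ (primePowCyclotomic_support_card s a))

theorem degree_mul_lt_of_degree_lt {g P : 𝒜[X]} {m n : ℕ} (hg : g.degree < m) (hP : P.degree < n) :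
    (g * P).degree < (m + n - 1 : ℕ) := by
  rw [degree_lt_iff_coeff_zero] at hP hg ⊢
  intro i hi
  rw [coeff_mul]
  refine Finset.sum_eq_zero fun x hx => ?_
  rw [Finset.HasAntidiagonal.mem_antidiagonal] at hx
  rcases le_or_gt m x.1 with h | h
  · rw [hg _ h, zero_mul]
  · rw [hP _ (by omega), mul_zero]

/-- One recursion step of the Schönhage–Strassen algorithm. -/
theorem MulModCost.step [Nontrivial 𝒜] {s : ℕ} (hs : s = 2 ∨ s = 3) (hsF : (s : F) ≠ 0)
    {i δ c T : ℕ} (hδ : (s - 1) * s ^ δ = 2) (hc : c + 1 ≤ i + δ)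
    (hT : MulModCost F 𝒜 s (i + δ) T) :
    MulModCost F 𝒜 s (i + (c + 1))
      ((s - 1) * s ^ (c + 1) * T + 1000 * s ^ (i + (c + 1)) * (c + 2)) := by
  intro g P hP
  have hs0 : 0 < s := by omega
  set a := i + (c + 1) with ha
  set b := i + δ with hb
  set m := s ^ i with hm
  set k := s ^ (c + 1) with hk
  set K := k * s with hK
  set κ := algebraMap F 𝒜 with hκ
  have hm0 : 0 < m := by positivity
  have hk0 : 0 < k := by positivity
  have hK0 : 0 < K := by positivity
  have hKs : s ^ (c + 2) = K := by rw [hK, hk, ← pow_succ]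
  have hKs' : s * k = K := by rw [hK, mul_comm]
  have hKF : ((k * s : ℕ) : F) ≠ 0 := by
    rw [hk]; push_cast; positivity
  -- The choice of `δ` makes the degree of `Ψ` exactly `2 * m`, so a product of two blocks of degree
  -- `< m` is unchanged by reduction modulo `Ψ`.
  have hnD : (s - 1) * s ^ b = 2 * m := by
    rw [hb, add_comm, pow_add, ← mul_assoc, hδ]
  obtain ⟨hmonΘ, hdegΘ⟩ := primePowCyclotomic_monic_degree (F := F) hs0 a
  obtain ⟨hmonΨ, hdegΨ⟩ := primePowCyclotomic_monic_degree (F := F) hs0 b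
  obtain ⟨Ψ, hΨ⟩ : ∃ Ψ, Ψ = (primePowCyclotomic F s b).map κ := ⟨_, rfl⟩
  obtain ⟨Θ, hΘ⟩ : ∃ Θ, Θ = (primePowCyclotomic F s a).map κ := ⟨_, rfl⟩
  have hΨm : Ψ.Monic := hΨ ▸ hmonΨ.map _
  have hΘm : Θ.Monic := hΘ ▸ hmonΘ.map _
  have hΨdeg : Ψ.degree = (2 * m : ℕ) := by rw [hΨ, hmonΨ.degree_map, hdegΨ, hnD]
  rw [← hΘ]
  set rep := AdjoinRoot.modByMonicHom hΨm with hrep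
  have hrepdeg : ∀ d, (rep d).degree < (2 * m : ℕ) := by
    intro d
    obtain ⟨f, rfl⟩ := AdjoinRoot.mk_surjective d
    rw [hrep, AdjoinRoot.modByMonicHom_mk, ← hΨdeg]
    exact degree_modByMonic_lt _ hΨm
  have hrep_mk : ∀ f : 𝒜[X], f.degree < (2 * m : ℕ) → rep (AdjoinRoot.mk Ψ f) = f := by
    intro f hf
    rw [hrep, AdjoinRoot.modByMonicHom_mk, modByMonic_eq_self_iff hΨm, hΨdeg]
    exact hf
  have hmk_rep : ∀ d, AdjoinRoot.mk Ψ (rep d) = d := AdjoinRoot.mk_leftInverse hΨm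
  have hζ := root_geom_sum hΨ
  have hroot : AdjoinRoot.root Ψ ^ s ^ (b + 1) = 1 := by
    have := geom_sum_mul (AdjoinRoot.root Ψ ^ s ^ b) s
    rw [hζ, zero_mul, ← pow_mul, ← pow_succ] at this
    exact (sub_eq_zero.1 this.symm)
  -- As `c + 1 ≤ b`, a power of the adjoined root serves as a `K`-th root of unity, and
  -- multiplication by its powers is a shift followed by a sparse reduction.
  set q := s ^ (b - (c + 1)) with hq
  set ω := AdjoinRoot.root Ψ ^ q with hω
  have hqk : q * k = s ^ b := by rw [hq, hk, ← pow_add]; congr 1; omega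
  have hωk : ω ^ k = AdjoinRoot.root Ψ ^ s ^ b := by rw [hω, ← pow_mul, hqk]
  have hωK : ω ^ s ^ (c + 2) = 1 := by
    rw [hKs, hK, pow_mul, hωk, ← pow_mul, ← pow_succ, hroot]
  have hωζ : ∑ r ∈ Finset.range s, (ω ^ s ^ (c + 1)) ^ r = 0 := by rw [← hk, hωk, hζ]
  -- reduction of `g`, and splitting into blocks
  obtain ⟨g', hg'deg, hg'⟩ : ∃ g' : F[X], g'.degree < (m * K : ℕ) ∧
      (g.map κ * P) %ₘ Θ = (g'.map κ * P) %ₘ Θ := by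
    refine ⟨g %ₘ primePowCyclotomic F s a, (degree_modByMonic_lt _ hmonΘ).trans_le ?_, ?_⟩
    · rw [hdegΘ]
      have : (s - 1) * s ^ a ≤ m * K := by
        rw [ha, pow_add, ← hm, ← hk, hK, mul_comm]
        rw [mul_assoc]
        exact Nat.mul_le_mul_left _ (Nat.mul_le_mul_left _ (Nat.sub_le _ _))
      exact_mod_cast this
    · rw [← sub_eq_zero, ← sub_modByMonic, modByMonic_eq_zero_iff_dvd hΘm, ← sub_mul,
        ← Polynomial.map_sub, modByMonic_eq_sub_mul_div g, sub_sub_cancel, Polynomial.map_mul,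
        mul_assoc, hΘ]
      exact Dvd.intro _ rfl
  rw [hg']
  have hPdeg : P.degree < (m * K : ℕ) := by
    refine hP.trans_le ?_
    have : (s - 1) * s ^ a ≤ m * K := by
      rw [ha, pow_add, ← hm, ← hk, hK, mul_comm]
      rw [mul_assoc]
      exact Nat.mul_le_mul_left _ (Nat.mul_le_mul_left _ (Nat.sub_le _ _))
    exact_mod_cast this
  obtain ⟨p, hp, hPp⟩ := eq_sum_X_pow_mul hPdeg
  obtain ⟨γ, hγ, hgγ⟩ := eq_sum_X_pow_mul hg'deg
  have hm2 : m ≤ 2 * m := by omega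
  set v : ℕ → AdjoinRoot Ψ := fun r => AdjoinRoot.mk Ψ (p r) with hv
  set y : ℕ → AdjoinRoot Ψ := fun r => AdjoinRoot.mk Ψ ((γ r).map κ) with hy
  set V : ℕ → AdjoinRoot Ψ := fun i => ∑ r ∈ Finset.range K, ω ^ (i * r) * v r with hV
  set Y : ℕ → AdjoinRoot Ψ := fun i => ∑ r ∈ Finset.range K, ω ^ (i * r) * y r with hY
  -- With `Y = X ^ m`, the modulus `Θ` is `Φ_s (Y ^ k)`, whose roots are the `ω ^ i` with `s ∤ i`.
  -- Only these frequencies need recursive products; zeros at the others select the representative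
  -- divisible by `Y ^ k - 1`.
  set Z : ℕ → AdjoinRoot Ψ := fun i => if s ∣ i then 0 else Y i * V i with hZ
  set U : ℕ → AdjoinRoot Ψ := fun j => ∑ i ∈ Finset.range K, (ω ^ (K - 1)) ^ (j * i) * Z i with hU
  set co : AdjoinRoot Ψ → Set 𝒜 := fun d => coeffSet (rep d) with hco
  set cost := (4 * s + 1) * s ^ (b + 1) with hcost
  have hco0 : Comp F ∅ 0 (co 0) := by
    simp only [hco, map_zero]
    exact Comp.coeffSet_zero
  have h1 : Comp F (coeffSet P) (cost * s * K * (c + 2)) (⋃ i ∈ Finset.range K, co (V i)) := by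
    have := Comp.dft (co := co) (c := cost) s hs0 hco0 (c + 2) hωK (fun u v i => by
      rw [hω, ← pow_mul]
      exact Comp.adjoinRoot_add_root_pow_mul hs0 b hΨ hΨm hroot _ u v) v
    rw [hKs] at this
    refine this.mono_left' (Set.iUnion₂_subset fun r _ => ?_)
    simp only [hco, hv]
    rw [hrep_mk _ ((hp r).1.trans_le (by exact_mod_cast hm2))]
    exact (hp r).2
  have h2 : Comp F (⋃ i ∈ Finset.range K, co (V i)) ((s - 1) * k * T)
      (⋃ i ∈ Finset.range K, co (Z i)) := by
    rw [← card_filter_not_dvd hs k T, hKs']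
    refine Comp.biUnion _ fun j hj => ?_
    simp only [hZ]
    split_ifs with hd
    · exact hco0.mono_left' (Set.empty_subset _)
    -- The transform of `g` has coefficients in `F`. Hence it is free, and the recursion again
    -- multiplies by a fixed polynomial.
    · have hYm : Y j = AdjoinRoot.mk Ψ
          ((∑ r ∈ Finset.range K, X ^ (q * (j * r)) * γ r).map κ) := by
        simp only [hY, hy, hω, Polynomial.map_sum, Polynomial.map_mul, Polynomial.map_pow, map_X,
          map_sum, map_mul, map_pow, AdjoinRoot.mk_X, ← pow_mul]
      have hrepZ : rep (Y j * V j) =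
          ((∑ r ∈ Finset.range K, X ^ (q * (j * r)) * γ r).map κ * rep (V j)) %ₘ Ψ := by
        conv_lhs => rw [hYm, ← hmk_rep (V j), ← map_mul]
        rw [hrep, AdjoinRoot.modByMonicHom_mk]
      simp only [hco, hrepZ, hΨ]
      refine (hT _ (rep (V j)) ?_).mono_left' ?_
      · rw [hnD]; exact hrepdeg _
      · exact Set.subset_biUnion_of_mem (u := fun i => co (V i)) hj
  have h3 : Comp F (⋃ i ∈ Finset.range K, co (Z i)) (cost * s * K * (c + 2))
      (⋃ i ∈ Finset.range K, co (U i)) := by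
    have := Comp.dft (co := co) (c := cost) s hs0 hco0 (c + 2) (ω := ω ^ (K - 1))
      (by rw [← pow_mul, mul_comm, pow_mul, hωK, one_pow]) (fun u v i => by
        rw [hω, ← pow_mul, ← pow_mul]
        exact Comp.adjoinRoot_add_root_pow_mul hs0 b hΨ hΨm hroot _ u v) Z
    rw [hKs] at this
    exact this
  -- the blocks of the product
  set H : ℕ → 𝒜[X] := fun j => ∑ a ∈ Finset.range K, ∑ b ∈ Finset.range K,
    C (κ (wrapCoeff F K k (a + b) j)) * ((γ a).map κ * p b) with hH
  have hHdeg : ∀ j, (H j).degree < (2 * m : ℕ) := by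
    intro j
    have hterm : ∀ a b, (C (κ (wrapCoeff F K k (a + b) j)) * ((γ a).map κ * p b)) ∈
        degreeLT 𝒜 (2 * m) := by
      intro a b
      rw [← smul_eq_C_mul]
      refine Submodule.smul_mem _ _ (mem_degreeLT.2 ?_)
      refine (degree_mul_lt_of_degree_lt ((degree_map_le).trans_lt (hγ a).1) (hp b).1).trans_le ?_
      exact_mod_cast (by omega)
    exact mem_degreeLT.1 (Submodule.sum_mem _ fun a _ => Submodule.sum_mem _ fun b _ => hterm a b)
  -- Since `H j` has degree below that of `Ψ`, the equality may be checked in the quotient by `Ψ`.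
  -- There the orthogonality over the frequencies `s ∤ i` produces exactly `wrapCoeff`.
  have hUH : ∀ j, C (κ (K : F)⁻¹) * rep (U j) = H j := by
    intro j
    rw [← smul_eq_C_mul, ← map_smul, ← hrep_mk (H j) (hHdeg j)]
    congr 1
    have e1 : U j = ∑ a ∈ Finset.range K, ∑ b ∈ Finset.range K, y a * v b *
        ((if j % K = (a + b) % K then (K : AdjoinRoot Ψ) else 0) -
          (if j % k = (a + b) % k then (k : AdjoinRoot Ψ) else 0)) := by
      have := convolution_of_dft ω ((Finset.range K).filter fun i => ¬ s ∣ i) K j y v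
      rw [Finset.sum_filter] at this
      simp only [hU, hZ]
      rw [Finset.sum_congr rfl (g := fun a => if ¬ s ∣ a then (ω ^ (K - 1)) ^ (j * a) *
        ((∑ r ∈ Finset.range K, ω ^ (a * r) * y r) * ∑ r ∈ Finset.range K, ω ^ (a * r) * v r)
        else 0), this]
      · refine Finset.sum_congr rfl fun a _ => Finset.sum_congr rfl fun b _ => ?_
        have := sum_filter_not_dvd_root_pow hs c hωζ (a + b + (K - 1) * j)
        rw [hKs, ← hk] at this
        rw [this]
        simp only [dvd_add_pred_mul_iff hK0 dvd_rfl,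
          dvd_add_pred_mul_iff hK0 (Dvd.intro _ rfl : k ∣ K)]
      · intro a _
        split_ifs <;> simp [hY, hV]
    have hφ : ∀ x : F, AdjoinRoot.mk Ψ (C (κ x)) =
        ((AdjoinRoot.mk Ψ).comp (C.comp κ)) x := fun x => rfl
    rw [e1, Algebra.smul_def, Finset.mul_sum, hH, map_sum]
    refine Finset.sum_congr rfl fun a _ => ?_
    rw [Finset.mul_sum, map_sum]
    refine Finset.sum_congr rfl fun b _ => ?_
    rw [map_mul, map_mul, hφ, wrapCoeff, map_mul, map_sub, apply_ite (RingHom.comp _ _),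
      apply_ite (RingHom.comp _ _), map_zero, map_natCast, map_natCast]
    have : algebraMap 𝒜 (AdjoinRoot Ψ) (κ (K : F)⁻¹) =
      ((AdjoinRoot.mk Ψ).comp (C.comp κ)) (K : F)⁻¹ := rfl
    rw [this]
    ring
  have h4 : Comp F (⋃ i ∈ Finset.range K, co (U i)) (K * (2 * m))
      (⋃ i ∈ Finset.range K, coeffSet (H i)) := by
    refine (Comp.biUnion_const (F := F) (t := 2 * m) _ fun j hj => ?_).mono_cost (by simp)
    rw [← hUH j]
    exact (Comp.coeffSet_C_mul (hrepdeg _) _).mono_left'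
      (Set.subset_biUnion_of_mem (u := fun i => co (U i)) hj)
  have h5 : Comp F (⋃ i ∈ Finset.range K, coeffSet (H i)) (K * (2 * m))
      (coeffSet (∑ j ∈ Finset.range K, X ^ (m * j) * H j)) :=
    (Comp.coeffSet_sum _ _ fun j _ => hHdeg j).mono_cost (by simp)
  have hmod : (g'.map κ * P) %ₘ Θ = (∑ j ∈ Finset.range K, X ^ (m * j) * H j) %ₘ Θ := by
    rw [← AdjoinRoot.modByMonicHom_mk hΘm, ← AdjoinRoot.modByMonicHom_mk hΘm]
    congr 1
    -- As `m * k = s ^ a`, the class of `X ^ m` is a root of `Φ_s (Y ^ k)`, so that summing the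
    -- `wrapCoeff` against the powers of `η` restores `η ^ (a + b)`.
    set η := AdjoinRoot.mk Θ (X ^ m) with hη
    have hηk : ∑ r ∈ Finset.range s, (η ^ k) ^ r = 0 := by
      have := root_geom_sum hΘ
      rw [hη, map_pow, AdjoinRoot.mk_X, ← pow_mul, hm, hk, ← pow_add]
      exact this
    have hsum := fun t => sum_wrapCoeff ((AdjoinRoot.mk Θ).comp (C.comp κ)) hs0 hk0 hKF hηk t
    have hφ : ∀ x : F, AdjoinRoot.mk Θ (C (κ x)) =
        ((AdjoinRoot.mk Θ).comp (C.comp κ)) x := fun x => rfl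
    have hr : AdjoinRoot.mk Θ (∑ j ∈ Finset.range K, X ^ (m * j) * H j) =
        ∑ a ∈ Finset.range K, ∑ b ∈ Finset.range K,
          AdjoinRoot.mk Θ ((γ a).map κ) * AdjoinRoot.mk Θ (p b) * η ^ (a + b) := by
      simp only [hH, map_sum, map_mul, Finset.mul_sum, hφ]
      rw [Finset.sum_comm]
      refine Finset.sum_congr rfl fun a _ => ?_
      rw [Finset.sum_comm]
      refine Finset.sum_congr rfl fun b _ => ?_
      rw [← hsum (a + b), Finset.mul_sum]
      refine Finset.sum_congr rfl fun j _ => ?_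
      rw [hη, ← map_pow, ← pow_mul]
      ring
    rw [hr]
    conv_lhs => rw [hgγ, hPp]
    rw [Polynomial.map_sum, Finset.sum_mul_sum, map_sum]
    refine Finset.sum_congr rfl fun a _ => ?_
    rw [map_sum]
    refine Finset.sum_congr rfl fun b _ => ?_
    rw [Polynomial.map_mul, Polynomial.map_pow, map_X, hη, ← map_pow, ← pow_mul, ← map_mul,
      ← map_mul]
    congr 1
    ring
  have hQdeg : (∑ j ∈ Finset.range K, X ^ (m * j) * H j).degree < ((2 * (m * K) : ℕ) : WithBot ℕ) := by
    refine mem_degreeLT.1 (Submodule.sum_mem _ fun j hj => mem_degreeLT.2 ?_)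
    rw [degree_lt_iff_coeff_zero]
    intro e he
    rw [coeff_X_pow_mul']
    have hj' : j + 1 ≤ K := Finset.mem_range.1 hj
    have : m * (j + 1) ≤ m * K := Nat.mul_le_mul_left _ hj'
    have hmK : m * 1 ≤ m * K := Nat.mul_le_mul_left _ hK0
    split_ifs
    · rw [(degree_lt_iff_coeff_zero _ _).1 (hHdeg j) _]
      rw [mul_add] at this
      omega
    · rfl
  rw [hmod]
  have h6 : Comp F (coeffSet (∑ j ∈ Finset.range K, X ^ (m * j) * H j))
      (2 * (m * K) * (2 * s))
      (coeffSet ((∑ j ∈ Finset.range K, X ^ (m * j) * H j) %ₘ Θ)) := by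
    rw [hΘ]
    refine (Comp.coeffSet_modByMonic hmonΘ hQdeg).mono_cost ?_
    exact Nat.mul_le_mul_left _ (Nat.mul_le_mul_left _ (primePowCyclotomic_support_card s a))
  refine (((((h1.trans h2).trans h3).trans h4).trans h5).trans h6).mono_cost ?_
  have hcost' : cost = (4 * s + 1) * (s ^ δ * m * s) := by
    rw [hcost, hb, hm, pow_succ, pow_add]
    ring
  have hsa : s ^ a = m * k := by rw [ha, pow_add]
  rw [hcost', hsa, hK]
  have hmk : m * k ≤ m * k * (c + 2) := Nat.le_mul_of_pos_right _ (by omega)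
  rcases hs with hs2 | hs3
  · have : s ^ δ = 2 := by rw [hs2] at hδ ⊢; omega
    rw [this]
    clear_value m k
    clear * - hmk hs2
    subst hs2
    nlinarith
  · have : s ^ δ = 1 := by rw [hs3] at hδ ⊢; omega
    rw [this]
    clear_value m k
    clear * - hmk hs3
    subst hs3
    nlinarith

end SchoenhageStrassen

/-! ### Quasi-linear bounds for multiplication by a fixed polynomial -/

section MulBound

variable {F 𝒜 : Type*} [Field F] [CommRing 𝒜] [Algebra F 𝒜]

/-- Each step about halves the exponent `e`. Because `(s - 1) * s ^ δ = 2`, the normalized recursive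
cost doubles while the rest of the step is linear in `e`. There are about `log e` levels, whence the
factor `e log e`, that is, `log n log log n`. -/
theorem MulModCost.schoenhage_strassen [Nontrivial 𝒜] {s : ℕ} (hs : s = 2 ∨ s = 3)
    (hsF : (s : F) ≠ 0) {δ : ℕ} (hδ : (s - 1) * s ^ δ = 2) (e : ℕ) :
    MulModCost F 𝒜 s (e + 1 + δ) (6000 * s ^ (e + 1 + δ) * (e * (Nat.log 2 e + 2) + 1)) := by
  induction e using Nat.strong_induction_on with
  | _ e ih =>
  rcases Nat.eq_zero_or_pos e with rfl | he
  · have h : 2 * s ^ (0 + 1 + δ + 1) * (2 * s ^ (0 + 1 + δ + 1) * 2) +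
        2 * s ^ (0 + 1 + δ + 1) * (2 * s) ≤
        6000 * s ^ (0 + 1 + δ) * (0 * (Nat.log 2 0 + 2) + 1) := by
      rcases hs with rfl | rfl
      · have : δ = 1 := by
          have h2 : 2 ^ δ = 2 ^ 1 := by omega
          exact Nat.pow_right_injective le_rfl h2
        subst this
        norm_num
      · have : δ = 0 := by
          have h2 : 3 ^ δ = 3 ^ 0 := by rw [pow_zero]; omega
          exact Nat.pow_right_injective (by norm_num) h2
        subst this
        norm_num
    exact fun g P hP => (MulModCost.naive (by omega) _ g P hP).mono_cost h
  · set f := e / 2 with hf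
    have hc : e + δ - f - 1 + 1 = e + δ - f := by omega
    have hδ1 : δ ≤ 1 := by
      by_contra h
      have h2 : 2 ^ 2 ≤ s ^ δ := (Nat.pow_le_pow_left (by omega) 2).trans
        (Nat.pow_le_pow_right (by omega) (by omega))
      have h3 : 1 * s ^ δ ≤ (s - 1) * s ^ δ := Nat.mul_le_mul_right _ (by omega)
      omega
    have h := MulModCost.step (i := f + 1) (c := e + δ - f - 1) hs hsF hδ (by omega)
      (ih f (by omega))
    rw [hc, show f + 1 + (e + δ - f) = e + 1 + δ by omega,
      show e + δ - f - 1 + 2 = e + δ - f + 1 by omega] at h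
    intro g P hP
    refine (h g P hP).mono_cost ?_
    have h1 : (s - 1) * s ^ (e + δ - f) * (6000 * s ^ (f + 1 + δ) * (f * (Nat.log 2 f + 2) + 1)) =
        s ^ (e + 1 + δ) * (12000 * (f * (Nat.log 2 f + 2) + 1)) := by
      have h2 : s ^ (e + δ - f) * s ^ (f + 1 + δ) = s ^ (e + 1 + δ) * s ^ δ := by
        rw [← pow_add, ← pow_add]
        congr 1
        omega
      calc _ = (s - 1) * (s ^ (e + δ - f) * s ^ (f + 1 + δ)) *
            (6000 * (f * (Nat.log 2 f + 2) + 1)) := by ring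
        _ = ((s - 1) * s ^ δ) * s ^ (e + 1 + δ) * (6000 * (f * (Nat.log 2 f + 2) + 1)) := by
            rw [h2]; ring
        _ = _ := by rw [hδ]; ring
    rw [h1]
    have h3 : 12000 * (f * (Nat.log 2 f + 2) + 1) + 1000 * (e + δ - f + 1) ≤
        6000 * (e * (Nat.log 2 e + 2) + 1) := by
      have h4 : e + δ - f + 1 ≤ 3 * e := by omega
      rcases Nat.lt_or_ge e 2 with h5 | h5
      · have : e = 1 := by omega
        subst this
        have : f = 0 := by omega
        rw [this] at h4 ⊢
        norm_num
        omega
      -- Halving `e` lowers its logarithm by one; the resulting surplus `6000 * e` pays for the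
      -- linear cost of the step.
      · have h6 : Nat.log 2 e = Nat.log 2 f + 1 := Nat.log_of_one_lt_of_le (by norm_num) h5
        rw [h6]
        have h7 : 2 * f * (Nat.log 2 f + 2) ≤ e * (Nat.log 2 f + 2) :=
          Nat.mul_le_mul_right _ (by omega)
        nlinarith
    calc _ = s ^ (e + 1 + δ) *
          (12000 * (f * (Nat.log 2 f + 2) + 1) + 1000 * (e + δ - f + 1)) := by ring
      _ ≤ s ^ (e + 1 + δ) * (6000 * (e * (Nat.log 2 e + 2) + 1)) := Nat.mul_le_mul_left _ h3
      _ = _ := by ring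

variable (F 𝒜) in
/-- Fixed polynomials of degree `< 2 n` multiply polynomials of degree `< n` with at most `K n`
operations, for all `n ≤ N`. -/
def MulBound (N K : ℕ) : Prop :=
  ∀ n ≤ N, ∀ (g : F[X]) (P : 𝒜[X]), g.degree < (2 * n : ℕ) → P.degree < n →
    Comp F (coeffSet P) (K * n) (coeffSet (g.map (algebraMap F 𝒜) * P))

theorem eq_zero_of_degree_lt_zero {P : 𝒜[X]} (h : P.degree < (0 : ℕ)) : P = 0 := by
  ext i
  exact (degree_lt_iff_coeff_zero P 0).1 h i (Nat.zero_le _)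

theorem mulBound_general [Nontrivial 𝒜] (N : ℕ) :
    MulBound F 𝒜 N (162000 * ((Nat.log 2 N + 1) * (Nat.log 2 (Nat.log 2 N + 1) + 1))) := by
  -- The transform length has to be invertible in `F`: radix 2 works unless `2 = 0`, and then `3 =
  -- 1`.
  obtain ⟨s, δ, hs, hsF, hδ, hs9⟩ : ∃ s δ : ℕ, (s = 2 ∨ s = 3) ∧ (s : F) ≠ 0 ∧
      (s - 1) * s ^ δ = 2 ∧ s ^ (2 + δ) ≤ 9 := by
    by_cases h : (2 : F) = 0
    · refine ⟨3, 0, Or.inr rfl, ?_, by norm_num, by norm_num⟩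
      have : ((3 : ℕ) : F) = 1 := by
        push_cast
        linear_combination h
      rw [this]
      exact one_ne_zero
    · exact ⟨2, 1, Or.inl rfl, by exact_mod_cast h, by norm_num, by norm_num⟩
  intro n hn g P hg hP
  rcases Nat.eq_zero_or_pos n with rfl | hn0
  · rw [eq_zero_of_degree_lt_zero hP, mul_zero, mul_zero]
    exact Comp.coeffSet_zero
  have hs1 : 1 < s := by omega
  set e := Nat.log s n + 1 with he
  have hlt : n < s ^ e := Nat.lt_pow_succ_log_self hs1 n
  have hle : s ^ Nat.log s n ≤ n := Nat.pow_log_le_self s hn0.ne'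
  obtain ⟨hmon, hdeg⟩ := primePowCyclotomic_monic_degree (F := F) (by omega : 0 < s) (e + 1 + δ)
  have hdim : (s - 1) * s ^ (e + 1 + δ) = 2 * s ^ (e + 1) := by
    rw [pow_add s (e + 1) δ, mul_left_comm, hδ, mul_comm]
  have h2n : 2 * n ≤ s ^ (e + 1) := by
    rw [pow_succ']
    exact Nat.mul_le_mul (by omega) hlt.le
  have hPd : P.degree < ((s - 1) * s ^ (e + 1 + δ) : ℕ) := by
    refine hP.trans_le ?_
    rw [hdim]
    exact_mod_cast (by omega)
  -- The modulus has degree `2 * s ^ (e + 1) ≥ 4 * n`, while the product has degree below `3 * n`;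
  -- so the modular product is the true one.
  have hmul : (g.map (algebraMap F 𝒜) * P) %ₘ
      (primePowCyclotomic F s (e + 1 + δ)).map (algebraMap F 𝒜) = g.map (algebraMap F 𝒜) * P := by
    rw [modByMonic_eq_self_iff (hmon.map _), hmon.degree_map, hdeg, hdim]
    refine (degree_mul_lt_of_degree_lt ((degree_map_le).trans_lt hg) hP).trans_le ?_
    exact_mod_cast (by omega)
  have h := MulModCost.schoenhage_strassen (𝒜 := 𝒜) hs hsF hδ e g P hPd
  rw [hmul] at h
  refine h.mono_cost ?_
  set lam := Nat.log 2 N + 1 with hlam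
  have helam : e ≤ lam := by
    have h1 : Nat.log s n ≤ Nat.log 2 n := Nat.log_anti_left (by norm_num) (by omega)
    have h2 : Nat.log 2 n ≤ Nat.log 2 N := Nat.log_mono_right hn
    omega
  have h1 : s ^ (e + 1 + δ) ≤ 9 * n := by
    rw [show e + 1 + δ = (2 + δ) + Nat.log s n by omega, pow_add]
    exact Nat.mul_le_mul hs9 hle
  have h2 : e * (Nat.log 2 e + 2) + 1 ≤ 3 * (lam * (Nat.log 2 lam + 1)) := by
    have h3 : e * (Nat.log 2 e + 2) ≤ lam * (Nat.log 2 lam + 2) :=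
      Nat.mul_le_mul helam (Nat.add_le_add_right (Nat.log_mono_right helam) _)
    have h4 : 1 ≤ lam := by omega
    nlinarith [Nat.zero_le (lam * Nat.log 2 lam)]
  calc _ ≤ 6000 * (9 * n) * (3 * (lam * (Nat.log 2 lam + 1))) :=
        Nat.mul_le_mul (Nat.mul_le_mul_left _ h1) h2
    _ = _ := by ring

/-- Roots of order beyond `N` may be missing, so the transforms have length `2 ^ (j + 1) ≤ n`. The
factors are cut into `8` and `4` blocks of length `2 ^ j`, and the `32` block products are added
with their shifts. -/
theorem mulBound_of_supportsFFT {N : ℕ} (hF : SupportsFFT F N) :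
    MulBound F 𝒜 N (400 * (Nat.log 2 N + 1)) := by
  obtain ⟨t, hNt, ω, hω⟩ := hF
  intro n hn g P hg hP
  rcases Nat.eq_zero_or_pos n with rfl | hn0
  · rw [eq_zero_of_degree_lt_zero hP, mul_zero, mul_zero]
    exact Comp.coeffSet_zero
  rcases Nat.lt_or_ge n 2 with h2 | h2
  · obtain rfl : n = 1 := by omega
    exact (Comp.coeffSet_mul_naive (F := F) g hP hg).mono_cost (by omega)
  obtain ⟨j, hj⟩ : ∃ j, Nat.log 2 n = j + 1 :=
    ⟨Nat.log 2 n - 1, by have := Nat.log_pos (by norm_num : 1 < 2) h2; omega⟩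
  have hlog : j + 1 ≤ Nat.log 2 N := hj ▸ Nat.log_mono_right hn
  have hle : 2 ^ (j + 1) ≤ n := hj ▸ Nat.pow_log_le_self 2 hn0.ne'
  have hlt : n < 2 ^ (j + 2) := by
    have := Nat.lt_pow_succ_log_self (by norm_num : 1 < 2) n
    rwa [hj] at this
  have hjt : j + 1 ≤ t := (Nat.pow_le_pow_iff_right (by norm_num : 1 < 2)).1
    (hle.trans (hn.trans hNt))
  have hω' : IsPrimitiveRoot (ω ^ 2 ^ (t - (j + 1))) (2 ^ (j + 1)) := by
    refine hω.pow (by positivity) ?_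
    rw [← pow_add]
    congr 1
    omega
  set h := 2 ^ j with hh
  have hpow : 2 ^ (j + 1) = 2 * h := by rw [pow_succ']
  have hpow' : 2 ^ (j + 2) = 4 * h := by rw [pow_succ', hpow]; ring
  obtain ⟨p, hp, hPp⟩ := eq_sum_X_pow_mul (P := P) (m := h) (K := 4)
    (hP.trans_le (by exact_mod_cast (by omega)))
  obtain ⟨γ, hγ, hgγ⟩ := eq_sum_X_pow_mul (P := g) (m := h) (K := 8)
    (hg.trans_le (by exact_mod_cast (by omega)))
  have hprod : g.map (algebraMap F 𝒜) * P = ∑ x ∈ Finset.range 8 ×ˢ Finset.range 4,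
      X ^ (h * (x.1 + x.2)) * ((γ x.1).map (algebraMap F 𝒜) * p x.2) := by
    conv_lhs => rw [hgγ, hPp]
    rw [Polynomial.map_sum, Finset.sum_mul_sum, Finset.sum_product]
    refine Finset.sum_congr rfl fun a _ => Finset.sum_congr rfl fun b _ => ?_
    rw [Polynomial.map_mul, Polynomial.map_pow, map_X]
    ring
  have h1 : Comp F (coeffSet P) (32 * (2 ^ (j + 1) * (8 * (j + 1) + 2)))
      (⋃ x ∈ Finset.range 8 ×ˢ Finset.range 4,
        coeffSet ((γ x.1).map (algebraMap F 𝒜) * p x.2)) := by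
    refine (Comp.biUnion_const (F := F) (t := 2 ^ (j + 1) * (8 * (j + 1) + 2)) _
      fun x _ => ?_).mono_cost (by simp)
    exact (Comp.coeffSet_mul_fft hω' (γ x.1) (hγ _).1 (hp _).1).mono_left' (hp _).2
  have h2 : Comp F (⋃ x ∈ Finset.range 8 ×ˢ Finset.range 4,
      coeffSet ((γ x.1).map (algebraMap F 𝒜) * p x.2)) (32 * (2 * h))
      (coeffSet (g.map (algebraMap F 𝒜) * P)) := by
    rw [hprod]
    have hdeg : ∀ x ∈ Finset.range 8 ×ˢ Finset.range 4,
        ((γ x.1).map (algebraMap F 𝒜) * p x.2).degree < ((2 * h : ℕ) : WithBot ℕ) := fun x _ =>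
      (degree_mul_lt_of_degree_lt ((degree_map_le).trans_lt (hγ x.1).1) (hp x.2).1).trans_le
        (Nat.cast_le.2 (by omega))
    have hcard : (Finset.range 8 ×ˢ Finset.range 4).card = 32 := by simp
    have := Comp.coeffSet_sum (F := F) (Finset.range 8 ×ˢ Finset.range 4)
      (P := fun x => (γ x.1).map (algebraMap F 𝒜) * p x.2) (fun x => h * (x.1 + x.2)) hdeg
    rwa [hcard] at this
  refine (h1.trans h2).mono_cost ?_
  calc 32 * (2 ^ (j + 1) * (8 * (j + 1) + 2)) + 32 * (2 * h)
      = 2 ^ (j + 1) * (32 * (8 * (j + 1) + 3)) := by rw [hpow]; ring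
    _ ≤ n * (400 * (Nat.log 2 N + 1)) := Nat.mul_le_mul hle (by omega)
    _ = _ := by ring

end MulBound

/-! ### Comparison of binary and natural logarithms -/

section Logarithms

theorem one_le_lg (x : ℝ) : 1 ≤ lg x := le_max_left _ _

theorem natLog_le_lg {N : ℕ} (hN : 0 < N) : ((Nat.log 2 N + 1 : ℕ) : ℝ) ≤ 3 * lg N := by
  have h1 : (Nat.log 2 N : ℝ) * Real.log 2 ≤ Real.log N := by
    rw [← Real.log_pow]
    refine Real.log_le_log (by positivity) ?_
    exact_mod_cast Nat.pow_log_le_self 2 hN.ne'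
  have h2 : Real.log N ≤ lg N := le_max_right _ _
  have h3 := one_le_lg (N : ℝ)
  have h4 := Real.log_two_gt_d9
  have h5 : (0 : ℝ) ≤ Nat.log 2 N := Nat.cast_nonneg _
  push_cast
  nlinarith

theorem natLog_natLog_le_lg {N : ℕ} (hN : 0 < N) :
    ((Nat.log 2 (Nat.log 2 N + 1) + 1 : ℕ) : ℝ) ≤ 7 * lg (lg N) := by
  set M := Nat.log 2 N + 1 with hM
  have hM0 : 0 < M := Nat.succ_pos _
  have h1 : (Nat.log 2 M : ℝ) * Real.log 2 ≤ Real.log M := by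
    rw [← Real.log_pow]
    refine Real.log_le_log (by positivity) ?_
    exact_mod_cast Nat.pow_log_le_self 2 hM0.ne'
  have hlg := one_le_lg (N : ℝ)
  -- From `M ≤ 3 * lg N ≤ 2 ^ 2 * lg N`; rounding up to a power of 2 leaves `log 2` as the only
  -- constant to estimate.
  have h2 : Real.log M ≤ 2 * Real.log 2 + Real.log (lg N) := by
    rw [← Nat.cast_ofNat, ← Real.log_pow, ← Real.log_mul (by positivity) (by positivity)]
    refine Real.log_le_log (by exact_mod_cast hM0) ((natLog_le_lg hN).trans ?_)
    norm_num
    linarith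
  have h3 : Real.log (lg N) ≤ lg (lg N) := le_max_right _ _
  have h4 := one_le_lg (lg N)
  have h5 := Real.log_two_gt_d9
  have h6 : (0 : ℝ) ≤ Nat.log 2 M := Nat.cast_nonneg _
  have h7 := Real.log_two_lt_d9
  push_cast
  nlinarith

end Logarithms

/-! ### Transposed multiplication and product trees -/

section ProductTrees

variable {F 𝒜 : Type*} [Field F] [CommRing 𝒜] [Algebra F 𝒜]

/-- The polynomial with coefficients `u (n - 1), …, u 0`. -/
noncomputable def reversed {𝒜 : Type*} [CommRing 𝒜] (n : ℕ) (u : ℕ → 𝒜) : 𝒜[X] :=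
  ∑ i ∈ Finset.range n, C (u i) * X ^ (n - 1 - i)

theorem reversed_degree_lt (n : ℕ) (u : ℕ → 𝒜) : (reversed n u).degree < n := by
  refine mem_degreeLT.1 (Submodule.sum_mem _ fun i hi => mem_degreeLT.2 ?_)
  rw [Finset.mem_range] at hi
  exact (degree_C_mul_X_pow_le _ _).trans_lt (Nat.cast_lt.2 (by omega))

theorem coeffSet_reversed_subset (n : ℕ) (u : ℕ → 𝒜) :
    coeffSet (reversed n u) ⊆ u '' {i | i < n} ∪ Set.range (algebraMap F 𝒜) := by
  rintro _ ⟨e, rfl⟩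
  rcases Nat.lt_or_ge e n with he | he
  · left
    refine ⟨n - 1 - e, by simp only [Set.mem_ofPred_eq]; omega, ?_⟩
    rw [reversed, finsetSum_coeff, Finset.sum_eq_single (n - 1 - e)]
    · rw [coeff_C_mul_X_pow, if_pos (by omega)]
    · intro i hi hie
      rw [Finset.mem_range] at hi
      rw [coeff_C_mul_X_pow, if_neg (by omega)]
    · intro h
      exact absurd (Finset.mem_range.2 (by omega)) h
  · right
    exact ⟨0, by rw [map_zero, (degree_lt_iff_coeff_zero _ _).1 (reversed_degree_lt n u) e he]⟩

/-- Reversing the data turns convolution into correlation, which is the shape of transposed products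
and of Hankel products. -/
theorem coeff_mul_reversed (h : F[X]) (n : ℕ) (u : ℕ → 𝒜) (e : ℕ) :
    (h.map (algebraMap F 𝒜) * reversed n u).coeff e = ∑ i ∈ Finset.range n,
      (if n - 1 - i ≤ e then h.coeff (e - (n - 1 - i)) else 0) • u i := by
  rw [reversed, Finset.mul_sum, finsetSum_coeff]
  refine Finset.sum_congr rfl fun i _ => ?_
  rw [← mul_assoc, coeff_mul_X_pow', coeff_mul_C, coeff_map, ite_smul, zero_smul, Algebra.smul_def]

theorem MulBound.reversed {N K n : ℕ} (hK : MulBound F 𝒜 N K) (hn : n ≤ N) (h : F[X])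
    (hh : h.degree < (2 * n : ℕ)) (u : ℕ → 𝒜) :
    Comp F (u '' {i | i < n}) (K * n) (coeffSet (h.map (algebraMap F 𝒜) * reversed n u)) :=
  (hK n hn h _ hh (reversed_degree_lt n u)).mono_left (coeffSet_reversed_subset n u)

/-- The transpose of multiplication by a fixed polynomial. -/
theorem MulBound.transpose {N K n k : ℕ} (hK : MulBound F 𝒜 N K) (hn : n ≤ N) (h : F[X])
    (hh : h.degree < (n + 1 - k : ℕ)) (τ : F[X] →ₗ[F] 𝒜) :
    Comp F ((fun j => τ (X ^ j)) '' {j | j < n}) (K * n)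
      ((fun j => τ (h * X ^ j)) '' {j | j < k}) := by
  have hhc := (degree_lt_iff_coeff_zero _ _).1 hh
  rcases Nat.eq_zero_or_pos n with rfl | hn0
  · refine (Comp.of_subset_union ?_).mono_cost (Nat.zero_le _)
    rintro _ ⟨j, hj, rfl⟩
    have : h = 0 := by
      ext i
      refine hhc i ?_
      have : j < k := hj
      omega
    exact Or.inr ⟨0, by simp [this]⟩
  rcases Nat.eq_zero_or_pos k with rfl | hk0
  · exact (Comp.of_subset (by simp)).mono_cost (Nat.zero_le _)
  refine (hK.reversed hn h (hh.trans_le (Nat.cast_le.2 (by omega)))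
    fun j => τ (X ^ j)).mono_right ?_
  rintro _ ⟨j, hj, rfl⟩
  have hj : j < k := hj
  by_cases hkn : k ≤ n
  -- At this index `τ (X ^ i)` is paired with `h.coeff (i - j)`, the coefficient of `X ^ i` in `h *
  -- X ^ j`.
  · refine ⟨n - 1 - j, ?_⟩
    rw [coeff_mul_reversed]
    have hdeg : (h * X ^ j).degree < (n : WithBot ℕ) := by
      rw [degree_lt_iff_coeff_zero]
      intro i hi
      rw [coeff_mul_X_pow', if_pos (by omega), hhc _ (by omega)]
    change _ = τ (h * X ^ j)
    conv_rhs => rw [eq_sum_range_of_degree_lt hdeg]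
    rw [map_sum]
    refine Finset.sum_congr rfl fun i hi => ?_
    rw [Finset.mem_range] at hi
    rw [← smul_eq_C_mul, map_smul, coeff_mul_X_pow']
    congr 1
    refine if_congr (by omega) ?_ rfl
    congr 1
    omega
  · have h0 : h = 0 := by
      ext i
      exact hhc i (by omega)
    refine ⟨n, ?_⟩
    simp [h0]

/-- Multiplication by a fixed Hankel matrix. -/
theorem MulBound.hankel {N K n : ℕ} (hK : MulBound F 𝒜 N K) (hn : n ≤ N) (ρ : F[X] →ₗ[F] F)
    (u : ℕ → 𝒜) :
    Comp F (u '' {i | i < n}) (K * n)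
      ((fun j => ∑ i ∈ Finset.range n, ρ (X ^ (i + j)) • u i) '' {j | j < n}) := by
  set h : F[X] := ∑ e ∈ Finset.range (2 * n), C (ρ (X ^ e)) * X ^ e with hh
  have hdeg : h.degree < ((2 * n : ℕ) : WithBot ℕ) := by
    refine mem_degreeLT.1 (Submodule.sum_mem _ fun i hi => mem_degreeLT.2 ?_)
    rw [Finset.mem_range] at hi
    exact (degree_C_mul_X_pow_le _ _).trans_lt (Nat.cast_lt.2 hi)
  have hcoeff : ∀ e < 2 * n, h.coeff e = ρ (X ^ e) := by
    intro e he
    rw [hh, finsetSum_coeff]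
    simp_rw [coeff_C_mul_X_pow]
    rw [Finset.sum_ite_eq (Finset.range (2 * n)) e fun j => ρ (X ^ j),
      if_pos (Finset.mem_range.2 he)]
  refine (hK.reversed hn h hdeg u).mono_right ?_
  rintro _ ⟨j, hj, rfl⟩
  have hj : j < n := hj
  -- At this index `u i` is paired with `h.coeff (i + j)`; as `i + j < 2 * n`, this is why
  -- `MulBound` allows fixed factors of degree up to `2 * n`.
  refine ⟨n - 1 + j, ?_⟩
  rw [coeff_mul_reversed]
  refine Finset.sum_congr rfl fun i hi => ?_
  rw [Finset.mem_range] at hi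
  rw [if_pos (by omega), hcoeff _ (by omega)]
  congr 3
  omega

variable (F 𝒜) in
/-- For the family of polynomials `q i`, `i ∈ J`, of degree less than `#J`, `T` operations suffice
for the computation of a linear combination of the `q i`, and for the computation of the values of
a linear functional at the `q i` from its values at the powers of `X`. -/
structure FamilyCost {κ : Type*} (J : Finset κ) (q : κ → F[X]) (T : ℕ) : Prop where
  degree_lt : ∀ i ∈ J, (q i).degree < J.card
  combine : ∀ c : κ → 𝒜,
    Comp F (c '' J) T (coeffSet (∑ i ∈ J, C (c i) * (q i).map (algebraMap F 𝒜)))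
  apply : ∀ τ : F[X] →ₗ[F] 𝒜,
    Comp F ((fun j => τ (X ^ j)) '' {j | j < J.card}) T ((fun i => τ (q i)) '' J)

namespace FamilyCost

variable {κ : Type*} {J : Finset κ} {q q' : κ → F[X]} {T T' : ℕ}

theorem mono (h : FamilyCost F 𝒜 J q T) (hT : T ≤ T') : FamilyCost F 𝒜 J q T' :=
  ⟨h.degree_lt, fun c => (h.combine c).mono_cost hT, fun τ => (h.apply τ).mono_cost hT⟩

theorem congr (h : FamilyCost F 𝒜 J q T) (hq : ∀ i ∈ J, q' i = q i) : FamilyCost F 𝒜 J q' T where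
  degree_lt i hi := by rw [hq i hi]; exact h.degree_lt i hi
  combine c := by
    rw [Finset.sum_congr rfl fun i hi => by rw [hq i hi]]
    exact h.combine c
  apply τ := by
    rw [Set.image_congr (g := fun i => τ (q i)) fun i hi => by rw [hq i (Finset.mem_coe.1 hi)]]
    exact h.apply τ

theorem of_card_le_one (hJ : J.card ≤ 1) (hq : ∀ i ∈ J, q i = 1) : FamilyCost F 𝒜 J q 0 := by
  have key : ∀ i ∈ J, J = {i} := fun i hi =>
    Finset.eq_singleton_iff_unique_mem.2 ⟨hi, fun j hj => Finset.card_le_one.1 hJ j hj i hi⟩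
  refine ⟨fun i hi => ?_, fun c => ?_, fun τ => ?_⟩
  · rw [hq i hi, Finset.card_pos.2 ⟨i, hi⟩ |> (fun h => (by omega : J.card = 1)), degree_one]
    exact_mod_cast one_pos
  · rcases J.eq_empty_or_nonempty with rfl | ⟨i, hi⟩
    · simpa using Comp.coeffSet_zero
    · rw [key i hi, Finset.sum_singleton, hq i hi]
      refine Comp.of_subset_union ?_
      rintro _ ⟨e, rfl⟩
      rw [Polynomial.map_one, mul_one, coeff_C]
      split_ifs
      · exact Or.inl ⟨i, by simp, rfl⟩
      · exact Or.inr ⟨0, map_zero _⟩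
  · refine Comp.of_subset ?_
    rintro _ ⟨i, hi, rfl⟩
    refine ⟨0, Finset.card_pos.2 ⟨i, hi⟩, ?_⟩
    simp [hq i (Finset.mem_coe.1 hi)]

/-- A node of a product tree. -/
theorem node [DecidableEq κ] {N K : ℕ} (hK : MulBound F 𝒜 N K) (hK1 : 1 ≤ K) {J₁ J₂ : Finset κ}
    {q₁ q₂ : κ → F[X]} {T₁ T₂ : ℕ} (h₁ : FamilyCost F 𝒜 J₁ q₁ T₁) (h₂ : FamilyCost F 𝒜 J₂ q₂ T₂)
    (hdisj : Disjoint J₁ J₂) (hJ : J₁.card + J₂.card ≤ N) {g₁ g₂ : F[X]}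
    (hg₁ : g₁.degree < (J₂.card + 1 : ℕ)) (hg₂ : g₂.degree < (J₁.card + 1 : ℕ))
    (hq₁ : ∀ i ∈ J₁, q i = g₁ * q₁ i) (hq₂ : ∀ i ∈ J₂, q i = g₂ * q₂ i) :
    FamilyCost F 𝒜 (J₁ ∪ J₂) q (T₁ + T₂ + 3 * K * (J₁ ∪ J₂).card) := by
  have hcard : (J₁ ∪ J₂).card = J₁.card + J₂.card := Finset.card_union_of_disjoint hdisj
  rw [hcard]
  set n := J₁.card + J₂.card with hn
  have hd₁ : ∀ i ∈ J₁, (g₁ * q₁ i).degree < n := fun i hi =>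
    (degree_mul_lt_of_degree_lt hg₁ (h₁.degree_lt i hi)).trans_le (Nat.cast_le.2 (by omega))
  have hd₂ : ∀ i ∈ J₂, (g₂ * q₂ i).degree < n := fun i hi =>
    (degree_mul_lt_of_degree_lt hg₂ (h₂.degree_lt i hi)).trans_le (Nat.cast_le.2 (by omega))
  refine ⟨fun i hi => ?_, fun c => ?_, fun τ => ?_⟩
  · rw [hcard]
    rcases Finset.mem_union.1 hi with hi | hi
    · rw [hq₁ i hi]; exact hd₁ i hi
    · rw [hq₂ i hi]; exact hd₂ i hi
  · rw [Finset.sum_union hdisj]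
    rcases Nat.eq_zero_or_pos n with h0 | hn0
    · have e1 : J₁ = ∅ := Finset.card_eq_zero.1 (by omega)
      have e2 : J₂ = ∅ := Finset.card_eq_zero.1 (by omega)
      simp only [e1, e2, Finset.sum_empty, add_zero]
      exact Comp.coeffSet_zero.mono_cost (Nat.zero_le _)
    have aux : ∀ (J' : Finset κ) (q' : κ → F[X]) (T' : ℕ) (g' : F[X]),
        FamilyCost F 𝒜 J' q' T' → J' ⊆ J₁ ∪ J₂ → g'.degree < (n + 1 : ℕ) →
        (∀ i ∈ J', q i = g' * q' i) →
        Comp F (c '' (J₁ ∪ J₂ : Finset κ)) (T' + K * n)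
          (coeffSet (∑ i ∈ J', C (c i) * (q i).map (algebraMap F 𝒜))) := by
      intro J' q' T' g' h' hJ' hg' hq'
      have e : ∑ i ∈ J', C (c i) * (q i).map (algebraMap F 𝒜) =
          g'.map (algebraMap F 𝒜) * ∑ i ∈ J', C (c i) * (q' i).map (algebraMap F 𝒜) := by
        rw [Finset.mul_sum]
        refine Finset.sum_congr rfl fun i hi => ?_
        rw [hq' i hi, Polynomial.map_mul]
        ring
      rw [e]
      refine ((h'.combine c).mono_left' (Set.image_mono (Finset.coe_subset.2 hJ'))).trans
        (hK n hJ _ _ (hg'.trans_le (Nat.cast_le.2 (by omega))) ?_)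
      refine mem_degreeLT.1 (Submodule.sum_mem _ fun i hi => ?_)
      rw [← smul_eq_C_mul]
      refine Submodule.smul_mem _ _ (mem_degreeLT.2 ?_)
      refine ((degree_map_le).trans_lt (h'.degree_lt i hi)).trans_le (Nat.cast_le.2 ?_)
      rw [← hcard]
      exact Finset.card_le_card hJ'
    have c₁ := aux J₁ q₁ T₁ g₁ h₁ Finset.subset_union_left
      (hg₁.trans_le (Nat.cast_le.2 (by omega))) hq₁
    have c₂ := aux J₂ q₂ T₂ g₂ h₂ Finset.subset_union_right
      (hg₂.trans_le (Nat.cast_le.2 (by omega))) hq₂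
    -- Two multiplications at `K * n` each and an addition at `n ≤ K * n` account for `3 * K`.
    refine ((c₁.union c₂).trans (Comp.coeffSet_add (n := n) ?_)).mono_cost (by nlinarith)
    refine mem_degreeLT.1 (Submodule.sum_mem _ fun i hi => ?_)
    rw [← smul_eq_C_mul]
    refine Submodule.smul_mem _ _ (mem_degreeLT.2 ?_)
    rw [hq₂ i hi]
    exact (degree_map_le).trans_lt (hd₂ i hi)
  · rw [hcard]
    have aux : ∀ (J' : Finset κ) (q' : κ → F[X]) (T' : ℕ) (g' : F[X]),
        FamilyCost F 𝒜 J' q' T' → g'.degree < (n + 1 - J'.card : ℕ) →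
        (∀ i ∈ J', q i = g' * q' i) →
        Comp F ((fun j => τ (X ^ j)) '' {j | j < n}) (K * n + T')
          ((fun i => τ (q i)) '' J') := by
      intro J' q' T' g' h' hg' hq'
      -- Transposed order: the functional `τ (g' * ·)` is first obtained on the powers of `X` by
      -- `MulBound.transpose`, and is then handed to the subtree.
      have h := h'.apply (τ.comp (LinearMap.mulLeft F g'))
      simp only [LinearMap.comp_apply, LinearMap.mulLeft_apply] at h
      rw [Set.image_congr (g := fun i => τ (g' * q' i))
        fun i hi => by rw [hq' i (Finset.mem_coe.1 hi)]]
      exact (hK.transpose hJ g' hg' τ).trans h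
    have c₁ := aux J₁ q₁ T₁ g₁ h₁ (hg₁.trans_le (Nat.cast_le.2 (by omega))) hq₁
    have c₂ := aux J₂ q₂ T₂ g₂ h₂ (hg₂.trans_le (Nat.cast_le.2 (by omega))) hq₂
    rw [Finset.coe_union, Set.image_union]
    exact (c₁.union c₂).mono_cost (by nlinarith)

/-- Evaluation of a linear functional at the products of a polynomial by the `q i`. -/
theorem apply_mul {N K n : ℕ} (hK : MulBound F 𝒜 N K) (h : FamilyCost F 𝒜 J q T)
    (hJ : J.card ≤ n) (hn : n ≤ N) (ρ : F[X] →ₗ[F] F) (u : ℕ → 𝒜) :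
    Comp F (u '' {i | i < n}) (K * n + T)
      ((fun x => ∑ i ∈ Finset.range n, ρ (X ^ i * q x) • u i) '' J) := by
  -- `τ` is multiplication by the polynomial with coefficients `u i`, followed by `ρ` extended to
  -- `𝒜`. Its values at the powers of `X` form a Hankel product, from which the tree starts.
  let τ : F[X] →ₗ[F] 𝒜 := ∑ i ∈ Finset.range n,
    (LinearMap.toSpanSingleton F 𝒜 (u i)).comp (ρ.comp (LinearMap.mulLeft F (X ^ i)))
  have hτ : ∀ f, τ f = ∑ i ∈ Finset.range n, ρ (X ^ i * f) • u i := fun f => by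
    simp [τ, LinearMap.sum_apply]
  have h1 := (hK.hankel hn ρ u).trans ((h.apply τ).mono_left' ?_)
  · simpa only [hτ] using h1
  · rintro _ ⟨j, hj, rfl⟩
    refine ⟨j, lt_of_lt_of_le hj hJ, ?_⟩
    simp only [hτ, pow_add]

end FamilyCost

variable {β : Type*} [DecidableEq β]

theorem degree_C_sub_X_pow_lt (a : F) (r : ℕ) : ((C a - X) ^ r : F[X]).degree < (r + 1 : ℕ) := by
  have h : (C a - X : F[X]).degree ≤ 1 := by
    refine (degree_sub_le _ _).trans (max_le (degree_C_le.trans zero_le_one) degree_X_le)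
  refine (degree_pow_le_of_le r h).trans_lt ?_
  rw [mul_one]
  exact_mod_cast Nat.lt_succ_self r

/-- Expansion in powers of `a - X`. -/
theorem FamilyCost.taylor {N K : ℕ} (hK : MulBound F 𝒜 N K) (hK1 : 1 ≤ K) (b : β) (a : F) (d : ℕ) :
    ∀ lo hi : ℕ, hi - lo ≤ 2 ^ d → hi - lo ≤ N →
      FamilyCost F 𝒜 ({b} ×ˢ Finset.Ico lo hi) (fun x => (C a - X) ^ (x.2 - lo))
        (3 * K * (hi - lo) * d) := by
  induction d with
  | zero =>
    intro lo hi h _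
    refine (FamilyCost.of_card_le_one (by simpa using h) fun x hx => ?_).mono (Nat.zero_le _)
    simp only [Finset.mem_product, Finset.mem_Ico] at hx
    rw [pow_zero] at h
    rw [show x.2 - lo = 0 by omega, pow_zero]
  | succ d ih =>
    intro lo hi h hN
    rw [pow_succ] at h
    rcases Nat.lt_or_ge hi lo with hlt | hle
    · refine (FamilyCost.of_card_le_one ?_ fun x hx => ?_).mono (Nat.zero_le _)
      · simp; omega
      · simp only [Finset.mem_product, Finset.mem_Ico] at hx
        omega
    set mid := lo + (hi - lo) / 2 with hmid
    have h1 := ih lo mid (by omega) (by omega)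
    have h2 := ih mid hi (by omega) (by omega)
    have hunion : ({b} ×ˢ Finset.Ico lo mid) ∪ ({b} ×ˢ Finset.Ico mid hi) =
        ({b} ×ˢ Finset.Ico lo hi : Finset (β × ℕ)) := by
      rw [← Finset.product_union, Finset.Ico_union_Ico_eq_Ico (by omega) (by omega)]
    have hc1 : (({b} ×ˢ Finset.Ico lo mid : Finset (β × ℕ))).card = mid - lo := by simp
    have hc2 : (({b} ×ˢ Finset.Ico mid hi : Finset (β × ℕ))).card = hi - mid := by simp
    have hc : (({b} ×ˢ Finset.Ico lo hi : Finset (β × ℕ))).card = hi - lo := by simp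
    -- The exponents from `mid` on share the factor `(C a - X) ^ (mid - lo)`; the lower half needs
    -- no factor.
    have := FamilyCost.node (q := fun x => (C a - X) ^ (x.2 - lo)) hK hK1 h1 h2 ?_ ?_
      (g₁ := 1) (g₂ := (C a - X) ^ (mid - lo)) ?_ ?_ ?_ ?_
    · rw [hunion, hc] at this
      refine this.mono (le_of_eq ?_)
      have : hi - lo = (mid - lo) + (hi - mid) := by omega
      rw [this]
      ring
    · rw [Finset.disjoint_left]
      intro x hx hx'
      simp only [Finset.mem_product, Finset.mem_Ico] at hx hx'
      omega
    · rw [hc1, hc2]; omega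
    · rw [degree_one]
      exact_mod_cast Nat.succ_pos _
    · rw [hc1]
      exact degree_C_sub_X_pow_lt _ _
    · intro x _
      rw [one_mul]
    · intro x hx
      simp only [Finset.mem_product, Finset.mem_Ico] at hx
      rw [← pow_add]
      congr 1
      omega

/-- The polynomials `(a b - X) ^ i ∏_{b' ≠ b} (a b' - X) ^ r`. -/
noncomputable def hermiteFamily (s : Finset β) (a : β → F) (r : ℕ) (x : β × ℕ) : F[X] :=
  (∏ b ∈ s.erase x.1, (C (a b) - X) ^ r) * (C (a x.1) - X) ^ x.2

theorem degree_prod_C_sub_X_pow_lt (s : Finset β) (a : β → F) (r : ℕ) :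
    (∏ b ∈ s, (C (a b) - X) ^ r : F[X]).degree < (s.card * r + 1 : ℕ) := by
  induction s using Finset.induction_on with
  | empty => simp
  | insert b s hb ih =>
    rw [Finset.prod_insert hb, Finset.card_insert_of_notMem hb]
    refine (degree_mul_lt_of_degree_lt (degree_C_sub_X_pow_lt _ _) ih).trans_le
      (Nat.cast_le.2 (by ring_nf; omega))

/-- Two nested trees: one of depth `d` over the points, with a tree of depth `d'` over the exponents
at each leaf. At a node each half of the family lacks exactly the product of all the powers
belonging to the other half. -/
theorem FamilyCost.hermite_aux {N K : ℕ} (hK : MulBound F 𝒜 N K) (hK1 : 1 ≤ K) (a : β → F)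
    {r d' : ℕ} (hd' : r ≤ 2 ^ d') (d : ℕ) :
    ∀ s : Finset β, s.card ≤ 2 ^ d → s.card * r ≤ N →
      FamilyCost F 𝒜 (s ×ˢ Finset.range r) (hermiteFamily s a r)
        (3 * K * (s.card * r) * (d + d')) := by
  have base : ∀ (d : ℕ) (s : Finset β), s.card ≤ 1 → s.card * r ≤ N →
      FamilyCost F 𝒜 (s ×ˢ Finset.range r) (hermiteFamily s a r)
        (3 * K * (s.card * r) * (d + d')) := by
    intro d s hs hN
    rcases s.eq_empty_or_nonempty with rfl | ⟨b, hb⟩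
    · exact (FamilyCost.of_card_le_one (by simp) (by simp)).mono (Nat.zero_le _)
    · obtain rfl : s = {b} := Finset.eq_singleton_iff_unique_mem.2
        ⟨hb, fun j hj => Finset.card_le_one.1 hs j hj b hb⟩
      rw [Finset.card_singleton, one_mul] at hN ⊢
      have := FamilyCost.taylor hK hK1 b (a b) d' 0 r (by omega) (by omega)
      rw [← Finset.range_eq_Ico] at this
      refine (this.mono ?_).congr fun x hx => ?_
      · rw [Nat.sub_zero]
        exact Nat.mul_le_mul_left _ (Nat.le_add_left _ _)
      · have hxb : x.1 = b := by simpa using (Finset.mem_product.1 hx).1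
        rw [hermiteFamily, hxb]
        simp
  induction d with
  | zero =>
    intro s hs hN
    exact base 0 s (by simpa using hs) hN
  | succ d ih =>
    intro s hs hN
    rcases Nat.lt_or_ge 1 s.card with h1 | h1
    swap
    · exact base _ s h1 hN
    obtain ⟨s₁, hs₁, hc₁⟩ := Finset.exists_subset_card_eq (Nat.div_le_self s.card 2)
    set s₂ := s \ s₁ with hs₂
    have hc₂ : s₂.card = s.card - s.card / 2 := by rw [hs₂, Finset.card_sdiff_of_subset hs₁, hc₁]
    have hdisj : Disjoint s₁ s₂ := Finset.disjoint_sdiff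
    have hunion : s₁ ∪ s₂ = s := Finset.union_sdiff_of_subset hs₁
    have hsum : s₁.card * r + s₂.card * r = s.card * r := by
      rw [← add_mul]
      congr 1
      omega
    rw [pow_succ] at hs
    have f₁ := ih s₁ (by omega) (by omega)
    have f₂ := ih s₂ (by omega) (by omega)
    have := FamilyCost.node (q := hermiteFamily s a r) hK hK1 f₁ f₂ ?_ ?_
      (g₁ := ∏ b ∈ s₂, (C (a b) - X) ^ r) (g₂ := ∏ b ∈ s₁, (C (a b) - X) ^ r) ?_ ?_ ?_ ?_
    · rw [← Finset.union_product, hunion, Finset.card_product, Finset.card_range] at this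
      refine this.mono (le_of_eq ?_)
      rw [← hsum]
      ring
    · exact Finset.disjoint_product.2 (Or.inl hdisj)
    · simp only [Finset.card_product, Finset.card_range]
      omega
    · simpa using degree_prod_C_sub_X_pow_lt s₂ a r
    · simpa using degree_prod_C_sub_X_pow_lt s₁ a r
    · intro x hx
      have hx1 := (Finset.mem_product.1 hx).1
      have hx2 : x.1 ∉ s₂ := Finset.disjoint_left.1 hdisj hx1
      rw [hermiteFamily, hermiteFamily, ← hunion, Finset.erase_union_distrib,
        Finset.erase_eq_of_notMem hx2, Finset.prod_union
          (Finset.disjoint_of_subset_left (Finset.erase_subset _ _) hdisj)]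
      ring
    · intro x hx
      have hx1 := (Finset.mem_product.1 hx).1
      have hx2 : x.1 ∉ s₁ := Finset.disjoint_right.1 hdisj hx1
      rw [hermiteFamily, hermiteFamily, ← hunion, Finset.erase_union_distrib,
        Finset.erase_eq_of_notMem hx2, Finset.prod_union
          (Finset.disjoint_of_subset_right (Finset.erase_subset _ _) hdisj)]
      ring

theorem FamilyCost.hermite {N K : ℕ} (hK : MulBound F 𝒜 N K) (hK1 : 1 ≤ K) (a : β → F)
    {r : ℕ} (hr : 0 < r) (s : Finset β) (hN : s.card * r ≤ N) :
    FamilyCost F 𝒜 (s ×ˢ Finset.range r) (hermiteFamily s a r)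
      (6 * K * (Nat.log 2 N + 1) * N) := by
  rcases Nat.eq_zero_or_pos s.card with h0 | h0
  · rw [Finset.card_eq_zero] at h0
    subst h0
    exact (FamilyCost.of_card_le_one (by simp) (by simp)).mono (Nat.zero_le _)
  refine (FamilyCost.hermite_aux hK hK1 a (Nat.lt_pow_succ_log_self (by norm_num) r).le
    (Nat.log 2 s.card + 1) s (Nat.lt_pow_succ_log_self (by norm_num) _).le hN).mono ?_
  -- The depths add up to the logarithm of the total size, apart from rounding; so the total depth
  -- is at most `2 * (log N + 1)`, which turns `3` into `6`.
  have h1 : Nat.log 2 s.card + Nat.log 2 r ≤ Nat.log 2 N := by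
    refine Nat.le_log_of_pow_le (by norm_num) (le_trans ?_ hN)
    rw [pow_add]
    exact Nat.mul_le_mul (Nat.pow_log_le_self 2 h0.ne') (Nat.pow_log_le_self 2 hr.ne')
  calc 3 * K * (s.card * r) * (Nat.log 2 s.card + 1 + (Nat.log 2 r + 1))
      ≤ 3 * K * N * (2 * (Nat.log 2 N + 1)) := by
        refine Nat.mul_le_mul (Nat.mul_le_mul_left _ hN) (by omega)
    _ = _ := by ring

end ProductTrees

/-! ### Lagrange interpolation and Taylor coefficients by duality -/

section Interpolation

variable {F : Type*} [Field F] {β : Type*} [DecidableEq β]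

theorem eval_hermiteFamily (s : Finset β) (a : β → F) (r : ℕ) (x : β × ℕ) (z : F) :
    (hermiteFamily s a r x).eval z = (∏ b ∈ s.erase x.1, (a b - z) ^ r) * (a x.1 - z) ^ x.2 := by
  simp [hermiteFamily, eval_prod]

theorem eval_hermiteFamily_self_ne_zero {s : Finset β} {a : β → F} (ha : Set.InjOn a s) {b : β}
    (hb : b ∈ s) (r : ℕ) : (hermiteFamily s a r (b, 0)).eval (a b) ≠ 0 := by
  rw [eval_hermiteFamily, pow_zero, mul_one]
  refine Finset.prod_ne_zero_iff.2 fun c hc => pow_ne_zero _ (sub_ne_zero.2 fun h => ?_)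
  exact (Finset.ne_of_mem_erase hc) (ha (Finset.mem_of_mem_erase hc) hb h)

theorem eval_hermiteFamily_of_ne {s : Finset β} {a : β → F} {b c : β} (hc : c ∈ s) (hbc : c ≠ b)
    {r : ℕ} (hr : 0 < r) (e : ℕ) : (hermiteFamily s a r (b, e)).eval (a c) = 0 := by
  rw [eval_hermiteFamily, Finset.prod_eq_zero (Finset.mem_erase.2 ⟨hbc, hc⟩), zero_mul]
  rw [sub_self, zero_pow hr.ne']

theorem pow_dvd_hermiteFamily {s : Finset β} {a : β → F} {b c : β} (hc : c ∈ s) (hbc : c ≠ b)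
    (r e : ℕ) : (C (a c) - X) ^ r ∣ hermiteFamily s a r (b, e) :=
  (Finset.dvd_prod_of_mem (fun b => (C (a b) - X) ^ r)
    (Finset.mem_erase.2 ⟨hbc, hc⟩)).mul_right _

theorem degree_hermiteFamily_lt {s : Finset β} (a : β → F) {b : β} (hb : b ∈ s) (r e : ℕ) :
    (hermiteFamily s a r (b, e)).degree < ((s.card - 1) * r + e + 1 : ℕ) := by
  have h := degree_mul_lt_of_degree_lt (degree_prod_C_sub_X_pow_lt (s.erase b) a r)
    (degree_C_sub_X_pow_lt (a b) e)
  rw [Finset.card_erase_of_mem hb] at h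
  exact h.trans_le (Nat.cast_le.2 (by omega))

/-- The interpolation polynomial with the values `y b` at the points `a b`, `b ∈ s`. -/
noncomputable def lagrangeSum (s : Finset β) (a : β → F) (y : β → F) : F[X] :=
  ∑ b ∈ s, C (y b * ((hermiteFamily s a 1 (b, 0)).eval (a b))⁻¹) * hermiteFamily s a 1 (b, 0)

theorem degree_lagrangeSum_lt (s : Finset β) (a : β → F) (y : β → F) :
    (lagrangeSum s a y).degree < s.card := by
  refine mem_degreeLT.1 (Submodule.sum_mem _ fun b hb => ?_)
  rw [← smul_eq_C_mul]
  refine Submodule.smul_mem _ _ (mem_degreeLT.2 ((degree_hermiteFamily_lt a hb 1 0).trans_le ?_))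
  have := Finset.card_pos.2 ⟨b, hb⟩
  exact Nat.cast_le.2 (by omega)

theorem lagrangeSum_eq {s : Finset β} {a : β → F} (ha : Set.InjOn a s) {N : F[X]}
    (hN : N.degree < s.card) : lagrangeSum s a (fun b => N.eval (a b)) = N := by
  refine eq_of_degrees_lt_of_eval_index_eq s ha (degree_lagrangeSum_lt _ _ _) hN fun b hb => ?_
  rw [lagrangeSum, eval_finsetSum, Finset.sum_eq_single b]
  · rw [eval_mul, eval_C, inv_mul_cancel_right₀ (eval_hermiteFamily_self_ne_zero ha hb 1)]
  · intro c _ hcb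
    rw [eval_mul, eval_hermiteFamily_of_ne hb hcb.symm one_pos, mul_zero]
  · exact fun h => absurd hb h

/-- A linear functional whose values at `q N`, with `q` in a Hermite family, are Taylor coefficients
of `N / W` at the points of the family. -/
theorem exists_taylor_functional [Fintype β] {a : β → F} (ha : Function.Injective a) (r : ℕ)
    (W : β → F[X]) (hW : ∀ b, (W b).eval (a b) ≠ 0) :
    ∃ ρ : F[X] →ₗ[F] F, ∀ (b : β) (N G : F[X]),
      (C (a b) - X) ^ r ∣ N - W b * G.comp (C (a b) - X) → ∀ e < r,
      ρ (N * hermiteFamily Finset.univ a r (b, e)) = G.coeff (r - 1 - e) := by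
  -- Centred at `a b`, both `W b` and the product over the other points have nonzero constant term,
  -- so they are invertible modulo `X ^ r`.
  have hv : ∀ b, ∃ v : F[X], X ^ r ∣
      (W b * hermiteFamily Finset.univ a r (b, 0)).comp (C (a b) - X) * v - 1 := by
    intro b
    have hcop : IsCoprime (X : F[X])
        ((W b * hermiteFamily Finset.univ a r (b, 0)).comp (C (a b) - X)) := by
      rw [irreducible_X.coprime_iff_not_dvd, X_dvd_iff, coeff_zero_eq_eval_zero, eval_comp,
        eval_sub, eval_C, eval_X, sub_zero, eval_mul]
      exact mul_ne_zero (hW b)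
        (eval_hermiteFamily_self_ne_zero ha.injOn (Finset.mem_univ _) r)
    obtain ⟨x, y, hxy⟩ := (hcop.pow_left (m := r))
    refine ⟨y, -x, ?_⟩
    rw [← hxy]
    ring
  choose v hv using hv
  -- A sum of local residues: expand at each `a b`, multiply by the inverse `v b` and read the
  -- coefficient of index `r - 1`. On multiples of `q_{b,e}` the terms at the other points vanish.
  refine ⟨∑ b, (lcoeff F (r - 1)).comp ((LinearMap.mulRight F (v b)).comp
    (aeval (C (a b) - X : F[X])).toLinearMap), fun b N G hN e he => ?_⟩
  have happ : ∀ c, ((lcoeff F (r - 1)).comp ((LinearMap.mulRight F (v c)).comp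
      (aeval (C (a c) - X : F[X])).toLinearMap)) (N * hermiteFamily Finset.univ a r (b, e)) =
      ((N * hermiteFamily Finset.univ a r (b, e)).comp (C (a c) - X) * v c).coeff (r - 1) :=
    fun c => rfl
  have hX : ∀ c, (C (a c) - X : F[X]).comp (C (a c) - X) = X := fun c => by simp
  rw [LinearMap.sum_apply, Finset.sum_eq_single b]
  · rw [happ]
    obtain ⟨M, hM⟩ := hN
    obtain ⟨M', hM'⟩ := hv b
    have hN' : N.comp (C (a b) - X) = (W b).comp (C (a b) - X) * G + X ^ r * M.comp (C (a b) - X) := by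
      have h := congrArg (fun f => f.comp (C (a b) - X)) hM
      simp only [sub_comp, mul_comp, pow_comp, comp_assoc, C_comp, X_comp, sub_sub_cancel,
        comp_X] at h
      linear_combination h
    have hq : (hermiteFamily Finset.univ a r (b, e)).comp (C (a b) - X) =
        (hermiteFamily Finset.univ a r (b, 0)).comp (C (a b) - X) * X ^ e := by
      simp only [hermiteFamily, mul_comp, pow_comp, hX, pow_zero, mul_one]
    rw [mul_comp] at hM'
    -- Modulo `X ^ r` the local expansion is `X ^ e * G`, so the coefficient of index `r - 1` is
    -- that of `G` at `r - 1 - e`.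
    have hdvd : X ^ r ∣ (N * hermiteFamily Finset.univ a r (b, e)).comp (C (a b) - X) * v b -
        X ^ e * G := by
      refine ⟨X ^ e * G * M' + M.comp (C (a b) - X) *
        (hermiteFamily Finset.univ a r (b, 0)).comp (C (a b) - X) * X ^ e * v b, ?_⟩
      rw [mul_comp, hN', hq]
      linear_combination (X ^ e * G) * hM'
    have := X_pow_dvd_iff.1 hdvd (r - 1) (by omega)
    rw [coeff_sub, coeff_X_pow_mul', if_pos (by omega), sub_eq_zero] at this
    exact this
  · intro c _ hcb
    rw [happ]
    have hdvd : X ^ r ∣ (N * hermiteFamily Finset.univ a r (b, e)).comp (C (a c) - X) * v c := by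
      obtain ⟨M, hM⟩ := pow_dvd_hermiteFamily (a := a) (Finset.mem_univ c) hcb r e
      rw [hM, mul_comp, mul_comp, pow_comp, hX]
      exact ⟨N.comp (C (a c) - X) * M.comp (C (a c) - X) * v c, by ring⟩
    exact X_pow_dvd_iff.1 hdvd (r - 1) (by omega)
  · exact fun h => absurd (Finset.mem_univ b) h

end Interpolation

/-! ### Numerators of sums of partial fractions -/

section Blocks

variable {F : Type*} [Field F] {β ι : Type*} [DecidableEq β] [Fintype β] [Fintype ι]

/-- The polynomial with coefficients `w x` at the exponents `ε x`. -/
noncomputable def sparsePoly (ε : ι → ℕ) (w : ι → F) : F[X] := ∑ x, C (w x) * X ^ ε x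

/-- The numerator of `∑ b, P_b(a b - X) / (a b - X) ^ r` for the sparse polynomials `P_b`. -/
noncomputable def fractionNum (a : β → F) (r : ℕ) (ε : ι → ℕ) (w : β → ι → F) : F[X] :=
  ∑ b, ∑ x, C (w b x) * hermiteFamily Finset.univ a r (b, ε x)

theorem eval_fractionNum {a : β → F} {z : F} (ha : ∀ b, a b ≠ z) (r : ℕ) (ε : ι → ℕ)
    (w : β → ι → F) : (fractionNum a r ε w).eval z = (∏ b, (a b - z) ^ r) *
      ∑ b, (1 / (a b - z) ^ r) * ∑ x, (a b - z) ^ ε x * w b x := by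
  rw [fractionNum, eval_finsetSum, Finset.mul_sum]
  refine Finset.sum_congr rfl fun b _ => ?_
  rw [eval_finsetSum, Finset.mul_sum, Finset.mul_sum]
  refine Finset.sum_congr rfl fun x _ => ?_
  rw [eval_mul, eval_C, eval_hermiteFamily, ← Finset.mul_prod_erase _ _ (Finset.mem_univ b)]
  have : (a b - z) ^ r ≠ 0 := pow_ne_zero _ (sub_ne_zero.2 (ha b))
  field_simp

theorem degree_fractionNum_lt (a : β → F) (r : ℕ) (ε : ι → ℕ) (w : β → ι → F) {E : ℕ}
    (hE : ∀ x, ε x < E) :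
    (fractionNum a r ε w).degree < (E + (Fintype.card β - 1) * r : ℕ) := by
  refine mem_degreeLT.1 (Submodule.sum_mem _ fun b _ => Submodule.sum_mem _ fun x _ => ?_)
  rw [← smul_eq_C_mul]
  refine Submodule.smul_mem _ _ (mem_degreeLT.2
    ((degree_hermiteFamily_lt a (Finset.mem_univ b) r (ε x)).trans_le (Nat.cast_le.2 ?_)))
  have := hE x
  rw [Finset.card_univ]
  omega

/-- After clearing denominators, every fraction at a point other than `a b` contains the factor `(C
(a b) - X) ^ r`. -/
theorem pow_dvd_fractionNum_sub (a : β → F) (r : ℕ) (ε : ι → ℕ) (w : β → ι → F) (b : β) :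
    (C (a b) - X) ^ r ∣ fractionNum a r ε w -
      (∏ c ∈ Finset.univ.erase b, (C (a c) - X) ^ r) *
        (sparsePoly ε (w b)).comp (C (a b) - X) := by
  have h1 : (∏ c ∈ Finset.univ.erase b, (C (a c) - X) ^ r) *
      (sparsePoly ε (w b)).comp (C (a b) - X) =
      ∑ x, C (w b x) * hermiteFamily Finset.univ a r (b, ε x) := by
    rw [sparsePoly, ← coe_compRingHom_apply, map_sum, Finset.mul_sum]
    refine Finset.sum_congr rfl fun x _ => ?_
    rw [coe_compRingHom_apply, mul_comp, C_comp, pow_comp, X_comp, hermiteFamily]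
    ring
  rw [h1, fractionNum, ← Finset.add_sum_erase _ _ (Finset.mem_univ b), add_sub_cancel_left]
  refine Finset.dvd_sum fun c hc => Finset.dvd_sum fun x _ => ?_
  exact (pow_dvd_hermiteFamily (Finset.mem_univ b) (Finset.ne_of_mem_erase hc).symm r _).mul_left _

end Blocks

/-! ### Costs of multipoint evaluation and of Taylor extraction -/

section InterpolationCosts

theorem Polynomial.eval_eq_sum_range_of_degree_lt {R : Type*} [CommRing R] {P : R[X]} {n : ℕ}
    (hP : P.degree < n) (z : R) : P.eval z = ∑ i ∈ Finset.range n, P.coeff i * z ^ i := by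
  conv_lhs => rw [eq_sum_range_of_degree_lt hP]
  simp [eval_finsetSum]

variable {F 𝒜 : Type*} [Field F] [CommRing 𝒜] [Algebra F 𝒜]

/-- Cost of the evaluation of the numerator of a sum of partial fractions at given points. -/
theorem Comp.fractionNum_eval {β ι σ : Type*} [Fintype β] [DecidableEq β] [Fintype ι] [Fintype σ]
    [DecidableEq σ] {K : ℕ} (hK : MulBound F 𝒜 (Fintype.card σ) K) (hK1 : 1 ≤ K) (a : β → F)
    {r : ℕ} (hr : 0 < r) (hβ : Fintype.card β * r ≤ Fintype.card σ) {ε : ι → ℕ}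
    (hε : Function.Injective ε) (hεr : ∀ x, ε x < r) {α : σ → F} (hα : Function.Injective α)
    (ω : σ → F) (w : β → ι → 𝒜) :
    Comp F (Set.range fun y : β × ι => w y.1 y.2)
      (13 * K * (Nat.log 2 (Fintype.card σ) + 1) * Fintype.card σ)
      (Set.range fun s => ∑ b, ∑ x,
        (ω s * (hermiteFamily Finset.univ a r (b, ε x)).eval (α s)) • w b x) := by
  set S := Fintype.card σ with hS
  -- The exponents missed by `ε` receive coefficient `0`, so the full Hermite family can be used.
  set c : β × ℕ → 𝒜 := fun y => Function.extend ε (w y.1) 0 y.2 with hc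
  set P : 𝒜[X] := ∑ y ∈ Finset.univ ×ˢ Finset.range r,
    C (c y) * (hermiteFamily Finset.univ a r y).map (algebraMap F 𝒜) with hP
  have hPsum : P = ∑ b, ∑ x, C (w b x) *
      (hermiteFamily Finset.univ a r (b, ε x)).map (algebraMap F 𝒜) := by
    rw [hP, Finset.sum_product]
    refine Finset.sum_congr rfl fun b _ => ?_
    symm
    rw [← Finset.sum_image (s := Finset.univ) (g := ε) (f := fun e => C (c (b, e)) *
      (hermiteFamily Finset.univ a r (b, e)).map (algebraMap F 𝒜)) hε.injOn |> fun h =>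
        h.trans (Finset.sum_congr rfl fun x _ => by simp only [hc, hε.extend_apply])]
    refine Finset.sum_subset ?_ fun e _ he => ?_
    · intro e he
      obtain ⟨x, -, rfl⟩ := Finset.mem_image.1 he
      exact Finset.mem_range.2 (hεr x)
    · have : ¬ ∃ x, ε x = e := fun ⟨x, hx⟩ => he (Finset.mem_image.2 ⟨x, Finset.mem_univ _, hx⟩)
      simp only [hc, Function.extend_apply' _ _ _ this, Pi.zero_apply, map_zero, zero_mul]
  have h1 := (FamilyCost.hermite (𝒜 := 𝒜) hK hK1 a hr Finset.univ
    (by rwa [Finset.card_univ])).combine c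
  have h1' := h1.mono_left (V' := Set.range fun y : β × ι => w y.1 y.2) (by
    rintro _ ⟨y, -, rfl⟩
    by_cases h : ∃ x, ε x = y.2
    · obtain ⟨x, hx⟩ := h
      refine Or.inl ⟨(y.1, x), ?_⟩
      simp only [hc, ← hx, hε.extend_apply]
    · refine Or.inr ⟨0, ?_⟩
      simp only [hc, Function.extend_apply' _ _ _ h, Pi.zero_apply, map_zero])
  -- Since `q_s` vanishes at `α t` for `t ≠ s`, this gives `ρ (P q_s) = ω s * P (α s)`: multipoint
  -- evaluation becomes an instance of `FamilyCost.apply_mul`.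
  set ρ : F[X] →ₗ[F] F := ∑ t, (ω t * ((hermiteFamily Finset.univ α 1 (t, 0)).eval (α t))⁻¹) •
    leval (α t) with hρ
  have hρX : ∀ i s, ρ (X ^ i * hermiteFamily Finset.univ α 1 (s, 0)) = ω s * α s ^ i := by
    intro i s
    rw [hρ, LinearMap.sum_apply, Finset.sum_eq_single s]
    · rw [LinearMap.smul_apply, leval_apply, eval_mul, eval_pow, eval_X, smul_eq_mul]
      have := eval_hermiteFamily_self_ne_zero (s := Finset.univ) hα.injOn (Finset.mem_univ s) 1
      field_simp
    · intro t _ hts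
      rw [LinearMap.smul_apply, leval_apply, eval_mul,
        eval_hermiteFamily_of_ne (Finset.mem_univ t) hts one_pos, mul_zero, smul_zero]
    · exact fun h => absurd (Finset.mem_univ s) h
  have hJ : ((Finset.univ : Finset σ) ×ˢ Finset.range 1).card = S := by simp [hS]
  have h2 := (FamilyCost.hermite (𝒜 := 𝒜) hK hK1 α one_pos Finset.univ
    (by rw [Finset.card_univ, mul_one])).apply_mul hK hJ.le le_rfl ρ P.coeff
  have h2' := h2.mono_left' (V' := coeffSet P) (Set.image_subset_range _ _)
  refine ((h1'.trans h2').mono_right ?_).mono_cost ?_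
  · rintro _ ⟨s, rfl⟩
    refine ⟨(s, 0), by simp, ?_⟩
    simp only [hρX, hPsum, finsetSum_coeff, coeff_C_mul, coeff_map, Finset.smul_sum]
    rw [Finset.sum_comm]
    refine Finset.sum_congr rfl fun b _ => ?_
    rw [Finset.sum_comm]
    refine Finset.sum_congr rfl fun x _ => ?_
    have hdeg : (hermiteFamily Finset.univ a r (b, ε x)).degree < (S : WithBot ℕ) := by
      have hb : 0 < Fintype.card β := Fintype.card_pos_iff.2 ⟨b⟩
      have h := degree_hermiteFamily_lt a (Finset.mem_univ b) r (ε x)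
      rw [Finset.card_univ] at h
      have h3 : (Fintype.card β - 1) * r + r = Fintype.card β * r := by
        rw [← Nat.succ_mul]; congr 1; omega
      have h4 := hεr x
      exact h.trans_le (Nat.cast_le.2 (by omega))
    rw [eval_eq_sum_range_of_degree_lt hdeg, Finset.mul_sum, Finset.sum_smul]
    refine Finset.sum_congr rfl fun i _ => ?_
    rw [mul_comm (w b x), ← Algebra.smul_def, smul_smul]
    congr 1
    ring
  -- `13 = 6 + 1 + 6`: tree upwards, Hankel product, tree downwards.
  · have : K * S ≤ K * (Nat.log 2 S + 1) * S :=
      Nat.mul_le_mul_right _ (Nat.le_mul_of_pos_right _ (Nat.succ_pos _))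
    linarith

/-- Cost of the computation of the values of a functional at the products of an interpolation
polynomial by the polynomials of a Hermite family. -/
theorem Comp.lagrange_apply {β σ : Type*} [Fintype β] [DecidableEq β] [DecidableEq σ]
    (s : Finset σ) {K : ℕ} (hK : MulBound F 𝒜 s.card K) (hK1 : 1 ≤ K) (a : β → F)
    {r : ℕ} (hr : 0 < r) (hβ : Fintype.card β * r ≤ s.card) (α : σ → F)
    (ω : σ → F) (ρ : F[X] →ₗ[F] F) (y : σ → 𝒜) :
    Comp F (y '' s) (14 * K * (Nat.log 2 s.card + 1) * s.card)
      ((fun x => ∑ t ∈ s, (ω t * ρ (hermiteFamily s α 1 (t, 0) *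
        hermiteFamily Finset.univ a r x)) • y t) '' (Finset.univ ×ˢ Finset.range r : Finset (β × ℕ))) := by
  set c : σ × ℕ → 𝒜 := fun x => ω x.1 • y x.1 with hc
  have h0 : Comp F (y '' s) s.card (c '' (s ×ˢ Finset.range 1 : Finset _)) := by
    refine ((Comp.image (F := F) (t := 1) s (v := fun t => ω t • y t) fun t ht =>
      Comp.smul _ (.of_mem (Set.mem_image_of_mem _ ht))).mono_cost (by simp)).mono_right ?_
    rintro _ ⟨x, hx, rfl⟩
    exact ⟨x.1, (Finset.mem_product.1 hx).1, rfl⟩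
  have h1 := (FamilyCost.hermite (𝒜 := 𝒜) hK hK1 α one_pos s (by rw [mul_one])).combine c
  set P : 𝒜[X] := ∑ i ∈ s ×ˢ Finset.range 1,
    C (c i) * (hermiteFamily s α 1 i).map (algebraMap F 𝒜) with hP
  have h2 := (FamilyCost.hermite (𝒜 := 𝒜) hK hK1 a hr Finset.univ
    (by rwa [Finset.card_univ])).apply_mul hK
    (by rwa [Finset.card_product, Finset.card_range, Finset.card_univ]) le_rfl ρ P.coeff
  have h2' := h2.mono_left' (V' := coeffSet P) (Set.image_subset_range _ _)
  refine (((h0.trans h1).trans h2').mono_right ?_).mono_cost ?_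
  · rintro _ ⟨x, hx, rfl⟩
    refine ⟨x, hx, ?_⟩
    simp only [hP, Finset.sum_product, Finset.sum_range_one, finsetSum_coeff, coeff_C_mul,
      coeff_map, Finset.smul_sum]
    rw [Finset.sum_comm]
    refine Finset.sum_congr rfl fun t ht => ?_
    have hdeg : (hermiteFamily s α 1 (t, 0)).degree < (s.card : WithBot ℕ) := by
      have := Finset.card_pos.2 ⟨t, ht⟩
      exact (degree_hermiteFamily_lt α ht 1 0).trans_le (Nat.cast_le.2 (by omega))
    conv_rhs => rw [eq_sum_range_of_degree_lt hdeg]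
    rw [Finset.sum_mul, map_sum, Finset.mul_sum, Finset.sum_smul]
    refine Finset.sum_congr rfl fun i _ => ?_
    rw [mul_assoc (C _), ← smul_eq_C_mul, map_smul, smul_eq_mul]
    simp only [hc]
    rw [mul_comm (ω t • y t), ← Algebra.smul_def, smul_smul, smul_smul]
    congr 1
    ring
  -- `14 = 1 + 6 + 1 + 6`: scaling by `ω`, tree upwards, Hankel product, tree downwards.
  · have : s.card * 1 ≤ K * (Nat.log 2 s.card + 1) * s.card := by
      rw [mul_comm]
      exact Nat.mul_le_mul_right _ (Nat.mul_pos hK1 (Nat.succ_pos _))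
    have : K * s.card ≤ K * (Nat.log 2 s.card + 1) * s.card :=
      Nat.mul_le_mul_right _ (Nat.le_mul_of_pos_right _ (Nat.succ_pos _))
    linarith

end InterpolationCosts

/-! ### Entangled exponents and the numerator of the answers -/

section Answers

variable {F : Type*} [Field F] {S ℓ Kc p m n lam kap mu : ℕ}

/-- Exponent of block `(m', p')` in the entangled polynomial of `A`. -/
def expA (m p : ℕ) (x : Fin m × Fin p) : ℕ := x.2 + p * x.1

/-- Exponent of block `(p', n')` in the entangled polynomial of `B`. -/
def expB (m p n : ℕ) (x : Fin p × Fin n) : ℕ := (p - 1 - (x.1 : ℕ)) + p * m * x.2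

theorem expA_injective : Function.Injective (expA m p) := by
  rintro ⟨x, y⟩ ⟨x', y'⟩ h
  simp only [expA] at h
  have h1 := congrArg (· % p) h
  simp only [Nat.add_mul_mod_self_left, Nat.mod_eq_of_lt y.2, Nat.mod_eq_of_lt y'.2] at h1
  have hp : 0 < p := y.pos
  have h2 : (x : ℕ) = x' := Nat.eq_of_mul_eq_mul_left hp (by omega)
  exact Prod.ext (Fin.ext h2) (Fin.ext h1)

theorem expA_lt (x : Fin m × Fin p) : expA m p x < p * m := by
  have h1 : p * ((x.1 : ℕ) + 1) ≤ p * m := Nat.mul_le_mul_left _ x.1.2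
  have := x.2.2
  rw [expA]
  linarith

theorem expB_injective (hm : 0 < m) : Function.Injective (expB m p n) := by
  rintro ⟨x, y⟩ ⟨x', y'⟩ h
  simp only [expB] at h
  have hp : 0 < p := x.pos
  have hpm : p ≤ p * m := Nat.le_mul_of_pos_right _ hm
  have hx : p - 1 - (x : ℕ) < p * m := by omega
  have hx' : p - 1 - (x' : ℕ) < p * m := by omega
  have h1 := congrArg (· % (p * m)) h
  simp only [Nat.add_mul_mod_self_left, Nat.mod_eq_of_lt hx, Nat.mod_eq_of_lt hx'] at h1
  have h2 : (y : ℕ) = y' := Nat.eq_of_mul_eq_mul_left (Nat.mul_pos hp hm) (by omega)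
  have h3 : (x : ℕ) = x' := by
    have := x.2
    have := x'.2
    omega
  exact Prod.ext (Fin.ext h3) (Fin.ext h2)

theorem expB_lt (x : Fin p × Fin n) : expB m p n x < p + p * m * (n - 1) := by
  have h1 : p * m * (x.2 : ℕ) ≤ p * m * (n - 1) :=
    Nat.mul_le_mul_left _ (by have := x.2.2; omega)
  have := x.1.2
  rw [expB]
  omega

theorem expA_lt_mul (hn : 0 < n) (x : Fin m × Fin p) : expA m p x < p * m * n :=
  (expA_lt x).trans_le (Nat.le_mul_of_pos_right _ hn)

theorem expB_lt_mul (hm : 0 < m) (x : Fin p × Fin n) : expB m p n x < p * m * n := by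
  refine (expB_lt x).trans_le ?_
  obtain ⟨n, rfl⟩ : ∃ n', n = n' + 1 := ⟨n - 1, by have := x.2.pos; omega⟩
  rw [Nat.add_sub_cancel, mul_add, mul_one, add_comm]
  exact Nat.add_le_add_left (Nat.le_mul_of_pos_right _ hm) _

/-- Exponent of block `(m', n')` of the product in the product of the entangled polynomials. -/
def expAB (m p : ℕ) (m' n' : ℕ) : ℕ := p - 1 + p * m' + p * m * n'

/-- The wanted exponents lie below `p * m * n`, the precision to which the numerator determines the
product of the entangled polynomials. -/
theorem expAB_lt (hp : 0 < p) (m' : Fin m) (n' : Fin n) : expAB m p m' n' < p * m * n := by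
  have h1 : p * ((m' : ℕ) + 1) ≤ p * m := Nat.mul_le_mul_left _ m'.2
  have h2 : p * m * ((n' : ℕ) + 1) ≤ p * m * n := Nat.mul_le_mul_left _ n'.2
  rw [expAB]
  rw [mul_add] at h1 h2
  omega

/-- Compare mixed-radix digits: once `p - 1 - y.1` is moved to the other side, reduction modulo `p`
gives `x.2 = y.1`, and reduction modulo `m` separates the row from the column. So no unwanted block
product lands on a wanted exponent. -/
theorem expA_add_expB_eq_iff (x : Fin m × Fin p) (y : Fin p × Fin n) (m' : Fin m) (n' : Fin n) :
    expA m p x + expB m p n y = expAB m p m' n' ↔ x.1 = m' ∧ y.2 = n' ∧ x.2 = y.1 := by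
  obtain ⟨x1, x2⟩ := x
  obtain ⟨y1, y2⟩ := y
  simp only [expA, expB, expAB]
  have hp : 0 < p := x2.pos
  have hx2 := x2.2
  have hy1 := y1.2
  constructor
  · intro h
    have h1 : (x2 : ℕ) + p * (x1 + m * y2) = y1 + p * (m' + m * n') := by
      have e1 : p * ((x1 : ℕ) + m * y2) = p * x1 + p * m * y2 := by ring
      have e2 : p * ((m' : ℕ) + m * n') = p * m' + p * m * n' := by ring
      omega
    have h2 := congrArg (· % p) h1
    simp only [Nat.add_mul_mod_self_left, Nat.mod_eq_of_lt hx2, Nat.mod_eq_of_lt hy1] at h2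
    have h3 : (x1 : ℕ) + m * y2 = m' + m * n' := Nat.eq_of_mul_eq_mul_left hp (by omega)
    have h4 := congrArg (· % m) h3
    simp only [Nat.add_mul_mod_self_left, Nat.mod_eq_of_lt x1.2, Nat.mod_eq_of_lt m'.2] at h4
    have h5 : (y2 : ℕ) = n' := Nat.eq_of_mul_eq_mul_left x1.pos (by omega)
    exact ⟨Fin.ext h4, Fin.ext h5, Fin.ext h2⟩
  · rintro ⟨rfl, rfl, rfl⟩
    omega

/-- Positions in `Fin N`, cut into `q` blocks. -/
def blockEquiv {q N : ℕ} (h : q ∣ N) : Fin q × Fin (N / q) ≃ Fin N :=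
  finProdFinEquiv.trans (finCongr (Nat.mul_div_cancel' h))

/-- Numerator of entry `(i, j)` of the `A`-share. -/
noncomputable def shareNumA (n : ℕ) (hm : m ∣ lam) (hp : p ∣ kap) (f : Fin ℓ → Fin Kc → F)
    (A : Fin (ℓ * Kc) → Matrix (Fin lam) (Fin kap) F) (l : Fin ℓ) (i : Fin (lam / m))
    (j : Fin (kap / p)) : F[X] :=
  fractionNum (f l) (p * m * n) (expA m p)
    fun k x => matrixBlock hm hp (A (finProdFinEquiv (l, k))) x.1 x.2 i j

/-- Numerator of entry `(i, j)` of the `B`-share. -/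
noncomputable def shareNumB (m : ℕ) (hp : p ∣ kap) (hn : n ∣ mu) (f : Fin ℓ → Fin Kc → F)
    (B : Fin (ℓ * Kc) → Matrix (Fin kap) (Fin mu) F) (l : Fin ℓ) (i : Fin (kap / p))
    (j : Fin (mu / n)) : F[X] :=
  fractionNum (f l) (p * m * n) (expB m p n)
    fun k x => matrixBlock hp hn (B (finProdFinEquiv (l, k))) x.1 x.2 i j

theorem gcsaShareA_apply (n : ℕ) (hm : m ∣ lam) (hp : p ∣ kap) (f : Fin ℓ → Fin Kc → F)
    (A : Fin (ℓ * Kc) → Matrix (Fin lam) (Fin kap) F) {a : F} (l : Fin ℓ) (ha : ∀ k, f l k ≠ a)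
    (i : Fin (lam / m)) (j : Fin (kap / p)) :
    gcsaShareA n hm hp f A a l i j = (shareNumA n hm hp f A l i j).eval a := by
  rw [shareNumA, eval_fractionNum ha]
  simp [gcsaShareA, epA, Matrix.sum_apply, Fintype.sum_prod_type, expA]

theorem gcsaShareB_apply (m : ℕ) (hp : p ∣ kap) (hn : n ∣ mu) (f : Fin ℓ → Fin Kc → F)
    (B : Fin (ℓ * Kc) → Matrix (Fin kap) (Fin mu) F) {a : F} (l : Fin ℓ) (ha : ∀ k, f l k ≠ a)
    (i : Fin (kap / p)) (j : Fin (mu / n)) :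
    gcsaShareB m hp hn f B a l i j =
      (∏ k, (f l k - a) ^ (p * m * n))⁻¹ * (shareNumB m hp hn f B l i j).eval a := by
  rw [shareNumB, eval_fractionNum ha, inv_mul_cancel_left₀ (Finset.prod_ne_zero_iff.2
    fun k _ => pow_ne_zero _ (sub_ne_zero.2 (ha k)))]
  simp [gcsaShareB, epB, Matrix.sum_apply, Fintype.sum_prod_type, expB]

/-- Numerator of entry `(i, j)` of the answer, over the common denominator
`∏ l, ∏ k, (f l k - X) ^ (p m n)`. -/
noncomputable def answerNum (hm : m ∣ lam) (hn : n ∣ mu) (hp : p ∣ kap) (f : Fin ℓ → Fin Kc → F)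
    (A : Fin (ℓ * Kc) → Matrix (Fin lam) (Fin kap) F)
    (B : Fin (ℓ * Kc) → Matrix (Fin kap) (Fin mu) F) (i : Fin (lam / m)) (j : Fin (mu / n)) :
    F[X] :=
  ∑ l, (∏ l' ∈ Finset.univ.erase l, ∏ k, (C (f l' k) - X) ^ (p * m * n)) *
    ∑ e, shareNumA n hm hp f A l i e * shareNumB m hp hn f B l e j

/-- The factor by which the numerator of the answer differs, near `f l k`, from the product of the
entangled polynomials of `A_{l,k}` and `B_{l,k}`. -/
noncomputable def cofactor (r : ℕ) (f : Fin ℓ → Fin Kc → F) (b : Fin ℓ × Fin Kc) : F[X] :=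
  (∏ l' ∈ Finset.univ.erase b.1, ∏ k, (C (f l' k) - X) ^ r) *
    (∏ k ∈ Finset.univ.erase b.2, (C (f b.1 k) - X) ^ r) ^ 2

/-- The denominators of an `A`-share are already cleared by its definition, so those of group `l`
have to be cleared only once, for the `B`-share. -/
theorem eval_answerNum (hm : m ∣ lam) (hn : n ∣ mu) (hp : p ∣ kap) (f : Fin ℓ → Fin Kc → F)
    (A : Fin (ℓ * Kc) → Matrix (Fin lam) (Fin kap) F)
    (B : Fin (ℓ * Kc) → Matrix (Fin kap) (Fin mu) F) (i : Fin (lam / m)) (j : Fin (mu / n))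
    {a : F} (ha : ∀ l k, f l k ≠ a) :
    (answerNum hm hn hp f A B i j).eval a = (∏ l, ∏ k, (f l k - a) ^ (p * m * n)) *
      ∑ l, ∑ e, gcsaShareA n hm hp f A a l i e * gcsaShareB m hp hn f B a l e j := by
  rw [answerNum, eval_finsetSum, Finset.mul_sum]
  refine Finset.sum_congr rfl fun l _ => ?_
  rw [eval_mul, eval_finsetSum, eval_prod, ← Finset.prod_erase_mul _ _ (Finset.mem_univ l),
    mul_assoc (Finset.prod _ _), Finset.mul_sum _ _ (∏ k, (f l k - a) ^ (p * m * n))]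
  congr 1
  · refine Finset.prod_congr rfl fun l' _ => ?_
    simp [eval_prod]
  · refine Finset.sum_congr rfl fun e _ => ?_
    rw [eval_mul, gcsaShareA_apply _ _ _ _ _ _ (ha l), gcsaShareB_apply _ _ _ _ _ _ (ha l)]
    have : ∏ k, (f l k - a) ^ (p * m * n) ≠ 0 :=
      Finset.prod_ne_zero_iff.2 fun k _ => pow_ne_zero _ (sub_ne_zero.2 (ha l k))
    field_simp

/-- With `r = p m n`, the other groups contribute at most `(ℓ - 1) Kc r` and the two share
numerators at most `p m - 1 + (Kc - 1) r` and `p - 1 + p m (n - 1) + (Kc - 1) r`. The total is `R -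
1`. -/
theorem degree_answerNum_lt (hℓ : 0 < ℓ) (hKc : 0 < Kc) (hp0 : 0 < p) (hn0 : 0 < n)
    (hm : m ∣ lam) (hn : n ∣ mu) (hp : p ∣ kap)
    (f : Fin ℓ → Fin Kc → F) (A : Fin (ℓ * Kc) → Matrix (Fin lam) (Fin kap) F)
    (B : Fin (ℓ * Kc) → Matrix (Fin kap) (Fin mu) F) (i : Fin (lam / m)) (j : Fin (mu / n)) :
    (answerNum hm hn hp f A B i j).degree < gcsaThreshold ℓ Kc p m n := by
  refine mem_degreeLT.1 (Submodule.sum_mem _ fun l _ => ?_)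
  rw [Finset.mul_sum]
  refine Submodule.sum_mem _ fun e _ => mem_degreeLT.2 ?_
  have h1 : (∏ l' ∈ Finset.univ.erase l, ∏ k, (C (f l' k) - X) ^ (p * m * n)).degree <
      (((ℓ - 1) * Kc * (p * m * n) + 1 : ℕ) : WithBot ℕ) := by
    rw [← Finset.prod_product' (Finset.univ.erase l) Finset.univ
      (fun l' k => (C (f l' k) - X : F[X]) ^ (p * m * n))]
    have := degree_prod_C_sub_X_pow_lt (Finset.univ.erase l ×ˢ (Finset.univ : Finset (Fin Kc)))
      (fun b => f b.1 b.2) (p * m * n)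
    rwa [Finset.card_product, Finset.card_erase_of_mem (Finset.mem_univ l), Finset.card_univ,
      Finset.card_univ, Fintype.card_fin, Fintype.card_fin] at this
  have h2 := degree_fractionNum_lt (f l) (p * m * n) (expA m p) (fun k x =>
    matrixBlock hm hp (A (finProdFinEquiv (l, k))) x.1 x.2 i e) expA_lt
  have h3 := degree_fractionNum_lt (f l) (p * m * n) (expB m p n) (fun k x =>
    matrixBlock hp hn (B (finProdFinEquiv (l, k))) x.1 x.2 e j) expB_lt
  refine (degree_mul_lt_of_degree_lt h1 (degree_mul_lt_of_degree_lt h2 h3)).trans_le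
    (Nat.cast_le.2 ?_)
  rw [gcsaThreshold, Fintype.card_fin]
  obtain ⟨ℓ, rfl⟩ : ∃ x, ℓ = x + 1 := ⟨ℓ - 1, by omega⟩
  obtain ⟨Kc, rfl⟩ : ∃ x, Kc = x + 1 := ⟨Kc - 1, by omega⟩
  obtain ⟨n, rfl⟩ : ∃ x, n = x + 1 := ⟨n - 1, by omega⟩
  have e1 : (ℓ + 1 + 1) * (Kc + 1) - 1 = ℓ * (Kc + 1) + 2 * Kc + 1 := by
    have : (ℓ + 1 + 1) * (Kc + 1) = ℓ * (Kc + 1) + 2 * Kc + 1 + 1 := by ring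
    omega
  rw [e1]
  simp only [Nat.add_sub_cancel]
  have e2 : p * m * (n + 1) * (ℓ * (Kc + 1) + 2 * Kc + 1) =
      ℓ * (Kc + 1) * (p * m * (n + 1)) + (Kc * (p * m * (n + 1)) + Kc * (p * m * (n + 1))) +
        (p * m * n + p * m) := by ring
  rw [e2]
  omega

/-- The terms of the groups `l' ≠ l` contain all the denominators of group `l`. In group `l` itself
each share numerator reduces to its `k`-th fraction, whence the square in `cofactor`. -/
theorem pow_dvd_answerNum_sub (hm : m ∣ lam) (hn : n ∣ mu) (hp : p ∣ kap)
    (f : Fin ℓ → Fin Kc → F) (A : Fin (ℓ * Kc) → Matrix (Fin lam) (Fin kap) F)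
    (B : Fin (ℓ * Kc) → Matrix (Fin kap) (Fin mu) F) (i : Fin (lam / m)) (j : Fin (mu / n))
    (b : Fin ℓ × Fin Kc) :
    (C (f b.1 b.2) - X) ^ (p * m * n) ∣ answerNum hm hn hp f A B i j -
      cofactor (p * m * n) f b * (∑ e,
        sparsePoly (expA m p)
          (fun x => matrixBlock hm hp (A (finProdFinEquiv b)) x.1 x.2 i e) *
        sparsePoly (expB m p n)
          (fun x => matrixBlock hp hn (B (finProdFinEquiv b)) x.1 x.2 e j)).comp
        (C (f b.1 b.2) - X) := by
  obtain ⟨l, k⟩ := b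
  set M : F[X] := (C (f l k) - X) ^ (p * m * n) with hM
  set D : F[X] := ∏ l' ∈ Finset.univ.erase l, ∏ k, (C (f l' k) - X) ^ (p * m * n) with hD
  set E : F[X] := ∏ k' ∈ Finset.univ.erase k, (C (f l k') - X) ^ (p * m * n) with hE
  rw [← coe_compRingHom_apply, map_sum, cofactor, answerNum,
    ← Finset.add_sum_erase _ _ (Finset.mem_univ l), add_sub_right_comm]
  refine dvd_add ?_ (Finset.dvd_sum fun l' hl' => Dvd.dvd.mul_right ?_ _)
  · rw [mul_assoc D, ← mul_sub, Finset.mul_sum, ← Finset.sum_sub_distrib]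
    refine Dvd.dvd.mul_left (Finset.dvd_sum fun e _ => ?_) _
    rw [map_mul, coe_compRingHom_apply, coe_compRingHom_apply]
    obtain ⟨u, hu⟩ := pow_dvd_fractionNum_sub (f l) (p * m * n) (expA m p) (fun k x =>
      matrixBlock hm hp (A (finProdFinEquiv (l, k))) x.1 x.2 i e) k
    obtain ⟨v, hv⟩ := pow_dvd_fractionNum_sub (f l) (p * m * n) (expB m p n) (fun k x =>
      matrixBlock hp hn (B (finProdFinEquiv (l, k))) x.1 x.2 e j) k
    rw [sub_eq_iff_eq_add] at hu hv
    rw [shareNumA, shareNumB, hu, hv]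
    simp only [← hM, ← hE]
    exact ⟨u * (M * v + E * (sparsePoly (expB m p n) fun x =>
        matrixBlock hp hn (B (finProdFinEquiv (l, k))) x.1 x.2 e j).comp (C (f l k) - X)) +
      (E * (sparsePoly (expA m p) fun x =>
        matrixBlock hm hp (A (finProdFinEquiv (l, k))) x.1 x.2 i e).comp (C (f l k) - X)) * v,
      by ring⟩
  · refine (Finset.dvd_prod_of_mem (fun k => (C (f l k) - X) ^ (p * m * n))
      (Finset.mem_univ k)).trans ?_
    exact Finset.dvd_prod_of_mem (fun l => ∏ k, (C (f l k) - X) ^ (p * m * n))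
      (Finset.mem_erase.2 ⟨(Finset.ne_of_mem_erase hl').symm, Finset.mem_univ l⟩)

theorem coeff_sparsePoly_mul (u : Fin m × Fin p → F) (v : Fin p × Fin n → F)
    (m' : Fin m) (n' : Fin n) :
    (sparsePoly (expA m p) u * sparsePoly (expB m p n) v).coeff (expAB m p m' n') =
      ∑ q, u (m', q) * v (q, n') := by
  rw [sparsePoly, sparsePoly, Finset.sum_mul_sum, finsetSum_coeff]
  have h : ∀ x y, C (u x) * X ^ expA m p x * (C (v y) * X ^ expB m p n y) =
      C (u x * v y) * X ^ (expA m p x + expB m p n y) := fun x y => by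
    rw [C_mul, pow_add]
    ring
  simp_rw [finsetSum_coeff, h, coeff_C_mul_X_pow,
    eq_comm (a := expAB m p m' n'), expA_add_expB_eq_iff, Fintype.sum_prod_type]
  rw [Finset.sum_eq_single m' (fun x _ hx => by simp [hx]) (by simp)]
  refine Finset.sum_congr rfl fun q _ => ?_
  rw [Finset.sum_eq_single q (fun x _ hx => by simp [hx.symm]) (by simp),
    Finset.sum_eq_single n' (fun x _ hx => by simp [hx]) (by simp)]
  simp

theorem coeff_sum_sparsePoly_mul (hm : m ∣ lam) (hn : n ∣ mu) (hp : p ∣ kap)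
    (A : Matrix (Fin lam) (Fin kap) F) (B : Matrix (Fin kap) (Fin mu) F)
    (m' : Fin m) (n' : Fin n) (i : Fin (lam / m)) (j : Fin (mu / n)) :
    (∑ e, sparsePoly (expA m p) (fun x => matrixBlock hm hp A x.1 x.2 i e) *
        sparsePoly (expB m p n) (fun x => matrixBlock hp hn B x.1 x.2 e j)).coeff
      (expAB m p m' n') = (A * B) (blockIndex hm m' i) (blockIndex hn n' j) := by
  rw [finsetSum_coeff, Matrix.mul_apply, ← (blockEquiv hp).sum_comp, Fintype.sum_prod_type,
    Finset.sum_comm]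
  exact Finset.sum_congr rfl fun e _ => coeff_sparsePoly_mul _ _ _ _

end Answers

/-! ### Correctness of the decoder -/

section Decoder

variable {F : Type*} [Field F] {S ℓ Kc p m n lam kap mu : ℕ}

/-- One logarithm comes from the multiplication and one from the tree depth. The constant is `162000
* 9 * 7`, with `9` and `7` from the comparison of logarithms. -/
theorem exists_mulBound (F 𝒜 : Type*) [Field F] [CommRing 𝒜] [Algebra F 𝒜] [Nontrivial 𝒜] {N : ℕ}
    (hN : 0 < N) : ∃ K : ℕ, 1 ≤ K ∧ MulBound F 𝒜 N K ∧ ∀ a : ℝ, 0 ≤ a →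
      a * (K * (Nat.log 2 N + 1 : ℕ)) ≤ 10206000 * softLogSq F a N := by
  have h1 := natLog_le_lg hN
  have h2 := natLog_natLog_le_lg hN
  have h3 := one_le_lg (N : ℝ)
  have h4 := one_le_lg (lg N)
  set lam := Nat.log 2 N + 1 with hlam
  have hlam0 : 1 ≤ lam := Nat.succ_pos _
  have h5 : ((lam : ℕ) : ℝ) ^ 2 ≤ 9 * lg N ^ 2 := by
    calc ((lam : ℕ) : ℝ) ^ 2 ≤ (3 * lg N) ^ 2 := by gcongr
      _ = _ := by ring
  by_cases hF : SupportsFFT F N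
  · refine ⟨400 * lam, by omega, mulBound_of_supportsFFT hF, fun a ha => ?_⟩
    rw [softLogSq, if_pos hF]
    push_cast
    calc a * (400 * lam * lam) = 400 * a * (lam : ℝ) ^ 2 := by ring
      _ ≤ 400 * a * (9 * lg N ^ 2) := by gcongr
      _ ≤ 10206000 * (a * lg N ^ 2 * 1) := by
        have : 0 ≤ a * lg N ^ 2 := by positivity
        nlinarith
  · refine ⟨162000 * (lam * (Nat.log 2 lam + 1)), ?_, mulBound_general N, fun a ha => ?_⟩
    · have : 0 < lam * (Nat.log 2 lam + 1) := Nat.mul_pos hlam0 (Nat.succ_pos _)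
      omega
    rw [softLogSq, if_neg hF]
    rw [Nat.cast_mul, Nat.cast_mul]
    calc a * ((162000 : ℕ) * (lam * (Nat.log 2 lam + 1 : ℕ)) * lam)
        = 162000 * a * ((lam : ℝ) ^ 2 * (Nat.log 2 lam + 1 : ℕ)) := by push_cast; ring
      _ ≤ 162000 * a * (9 * lg N ^ 2 * (7 * lg (lg N))) := by gcongr
      _ = _ := by ring

theorem DistinctPoints.injective_left {F : Type*} {f : Fin ℓ → Fin Kc → F} {α : Fin S → F}
    (h : DistinctPoints f α) : Function.Injective fun b : Fin ℓ × Fin Kc => f b.1 b.2 :=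
  h.comp Sum.inl_injective

theorem DistinctPoints.injective_right {F : Type*} {f : Fin ℓ → Fin Kc → F} {α : Fin S → F}
    (h : DistinctPoints f α) : Function.Injective α :=
  h.comp Sum.inr_injective

theorem DistinctPoints.ne {F : Type*} {f : Fin ℓ → Fin Kc → F} {α : Fin S → F} (h : DistinctPoints f α)
    (l : Fin ℓ) (k : Fin Kc) (s : Fin S) : f l k ≠ α s := fun e =>
  Sum.inl_ne_inr (h (a₁ := Sum.inl (l, k)) (a₂ := Sum.inr s) e)

theorem eval_cofactor_ne_zero (r : ℕ) {f : Fin ℓ → Fin Kc → F}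
    (hf : Function.Injective fun b : Fin ℓ × Fin Kc => f b.1 b.2) (b : Fin ℓ × Fin Kc) :
    (cofactor r f b).eval (f b.1 b.2) ≠ 0 := by
  have key : ∀ c : Fin ℓ × Fin Kc, c ≠ b → (f c.1 c.2 - f b.1 b.2) ^ r ≠ 0 := fun c hc =>
    pow_ne_zero _ (sub_ne_zero.2 fun h => hc (hf h))
  simp only [cofactor, eval_mul, eval_pow, eval_prod, eval_sub, eval_C, eval_X]
  refine mul_ne_zero (Finset.prod_ne_zero_iff.2 fun l hl => Finset.prod_ne_zero_iff.2
    fun k _ => key (l, k) fun h => Finset.ne_of_mem_erase hl (congrArg Prod.fst h))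
    (pow_ne_zero _ (Finset.prod_ne_zero_iff.2 fun k hk => key (b.1, k) fun h =>
      Finset.ne_of_mem_erase hk (congrArg Prod.snd h)))

/-- The decoder of the GCSA code: it interpolates the numerator of the answers, and applies the
functional `ρ` that extracts Taylor coefficients.  With fewer responsive servers than the degree of
the numerator requires, it gives up and returns `0`. -/
noncomputable def gcsaDecode (hm : m ∣ lam) (hn : n ∣ mu) (p : ℕ) (f : Fin ℓ → Fin Kc → F)
    (α : Fin S → F) (ρ : F[X] →ₗ[F] F) (𝓡 : Finset (Fin S))
    (y : ∀ _ : 𝓡, Fin (lam / m) × Fin (mu / n) → F) (t : Fin (ℓ * Kc)) :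
    Matrix (Fin lam) (Fin mu) F :=
  Matrix.of fun row col => if gcsaThreshold ℓ Kc p m n ≤ 𝓡.card then
    ρ (lagrangeSum 𝓡 α (fun s => (∏ l, ∏ k, (f l k - α s) ^ (p * m * n)) *
        if h : s ∈ 𝓡 then
          y ⟨s, h⟩ (((blockEquiv hm).symm row).2, ((blockEquiv hn).symm col).2) else 0) *
      hermiteFamily Finset.univ (fun b : Fin ℓ × Fin Kc => f b.1 b.2) (p * m * n)
        (finProdFinEquiv.symm t, p * m * n - 1 -
          expAB m p ((blockEquiv hm).symm row).1 ((blockEquiv hn).symm col).1))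
    else 0

theorem lagrangeSum_congr {β : Type*} [DecidableEq β] {s : Finset β} {a y y' : β → F}
    (h : ∀ b ∈ s, y b = y' b) : lagrangeSum s a y = lagrangeSum s a y' :=
  Finset.sum_congr rfl fun b hb => by rw [h b hb]

/-- Interpolation returns `answerNum` itself. As `ρ` reads Taylor coefficients in reverse order, the
decoder's index `p m n - 1 - expAB` yields the coefficient at `expAB`. -/
theorem gcsaDecode_answer (hℓ : 0 < ℓ) (hKc : 0 < Kc) (hp0 : 0 < p) (hn0 : 0 < n)
    (hm : m ∣ lam) (hn : n ∣ mu) (hp : p ∣ kap) {f : Fin ℓ → Fin Kc → F} {α : Fin S → F}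
    (hfα : DistinctPoints f α) {ρ : F[X] →ₗ[F] F}
    (hρ : ∀ (b : Fin ℓ × Fin Kc) (N G : F[X]), (C (f b.1 b.2) - X) ^ (p * m * n) ∣
      N - cofactor (p * m * n) f b * G.comp (C (f b.1 b.2) - X) → ∀ e < p * m * n,
      ρ (N * hermiteFamily Finset.univ (fun b : Fin ℓ × Fin Kc => f b.1 b.2) (p * m * n) (b, e)) =
        G.coeff (p * m * n - 1 - e))
    {𝓡 : Finset (Fin S)} (h𝓡 : gcsaThreshold ℓ Kc p m n ≤ 𝓡.card)
    (A : Fin (ℓ * Kc) → Matrix (Fin lam) (Fin kap) F)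
    (B : Fin (ℓ * Kc) → Matrix (Fin kap) (Fin mu) F) (t : Fin (ℓ * Kc)) :
    gcsaDecode hm hn p f α ρ 𝓡 (fun s x => ∑ l, ∑ e,
      gcsaShareA n hm hp f A (α s) l x.1 e * gcsaShareB m hp hn f B (α s) l e x.2) t =
      A t * B t := by
  ext row col
  obtain ⟨⟨m', i⟩, rfl⟩ := (blockEquiv hm).surjective row
  obtain ⟨⟨n', j⟩, rfl⟩ := (blockEquiv hn).surjective col
  obtain ⟨b, rfl⟩ := finProdFinEquiv.surjective t
  rw [gcsaDecode, Matrix.of_apply, if_pos h𝓡]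
  simp only [Equiv.symm_apply_apply]
  have hlag : lagrangeSum 𝓡 α (fun s => (∏ l, ∏ k, (f l k - α s) ^ (p * m * n)) *
      if h : s ∈ 𝓡 then ∑ l, ∑ e,
        gcsaShareA n hm hp f A (α s) l i e * gcsaShareB m hp hn f B (α s) l e j else 0) =
      answerNum hm hn hp f A B i j := by
    rw [← lagrangeSum_eq (s := 𝓡) (hfα.injective_right.injOn)
      ((degree_answerNum_lt hℓ hKc hp0 hn0 hm hn hp f A B i j).trans_le (Nat.cast_le.2 h𝓡))]
    refine lagrangeSum_congr fun s hs => ?_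
    rw [eval_answerNum hm hn hp f A B i j fun l k => hfα.ne l k s]
    exact congrArg _ (dif_pos hs)
  have hlt := expAB_lt (n := n) hp0 m' n'
  rw [hlag, hρ b _ _ (pow_dvd_answerNum_sub hm hn hp f A B i j b) _ (by omega),
    show p * m * n - 1 - (p * m * n - 1 - expAB m p m' n') = expAB m p m' n' by omega,
    coeff_sum_sparsePoly_mul]
  rfl

/-- The lower bounds make the Hermite families of the decoder and of the encoder fit into sizes `R`
and `S`; the upper bound turns `R / L` into `O (p m n)`. -/
theorem gcsaThreshold_pos (hℓ : 0 < ℓ) (hKc : 0 < Kc) (hp : 0 < p) (hm : 0 < m) (hn : 0 < n) :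
    ℓ * Kc * (p * m * n) ≤ gcsaThreshold ℓ Kc p m n ∧
      Kc * (p * m * n) ≤ gcsaThreshold ℓ Kc p m n ∧
      gcsaThreshold ℓ Kc p m n ≤ 2 * (ℓ * Kc) * (p * m * n) ∧ 0 < gcsaThreshold ℓ Kc p m n := by
  obtain ⟨ℓ, rfl⟩ : ∃ x, ℓ = x + 1 := ⟨ℓ - 1, by omega⟩
  obtain ⟨Kc, rfl⟩ : ∃ x, Kc = x + 1 := ⟨Kc - 1, by omega⟩
  have e1 : (ℓ + 1 + 1) * (Kc + 1) - 1 = (ℓ + 1) * (Kc + 1) + Kc := by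
    have : (ℓ + 1 + 1) * (Kc + 1) = (ℓ + 1) * (Kc + 1) + Kc + 1 := by ring
    omega
  have hpr : p ≤ p * m * n := by
    rw [mul_assoc]
    exact Nat.le_mul_of_pos_right _ (Nat.mul_pos hm hn)
  have hr : 0 < p * m * n := by positivity
  rw [gcsaThreshold, e1]
  generalize p * m * n = r at *
  have e2 : r * ((ℓ + 1) * (Kc + 1) + Kc) = (ℓ + 1) * (Kc + 1) * r + Kc * r := by ring
  have e3 : (Kc + 1) * r = Kc * r + r := by ring
  have e4 : (ℓ + 1) * (Kc + 1) * r = ℓ * Kc * r + ℓ * r + (Kc + 1) * r := by ring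
  have e5 : 2 * ((ℓ + 1) * (Kc + 1)) * r = 2 * (ℓ * Kc * r) + 2 * (ℓ * r) + 2 * ((Kc + 1) * r) := by
    ring
  rw [e2, e5, e4, e3]
  generalize Kc * r = u
  refine ⟨?_, ?_, ?_, ?_⟩ <;> omega

end Decoder

/-! ### Operation counts of the server, the encoders and the decoder -/

section Complexity

variable {F : Type*} [Field F] {S ℓ Kc p m n lam kap mu : ℕ}

/-- A family of outputs that splits into parts of bounded cost. -/
theorem Comp.range_of_parts {𝒜 ο J : Type*} [CommRing 𝒜] [Algebra F 𝒜] [Fintype J] {V : Set 𝒜}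
    {t : ℕ} {out : ο → 𝒜} (G : J → Set 𝒜) (h : ∀ j, Comp F V t (G j))
    (hout : ∀ o, ∃ j, out o ∈ G j) : Comp F V (Fintype.card J * t) (Set.range out) := by
  refine (Comp.biUnion_const Finset.univ fun j _ => h j).mono_right ?_
  rintro _ ⟨o, rfl⟩
  obtain ⟨j, hj⟩ := hout o
  exact Set.mem_biUnion (Finset.mem_coe.2 (Finset.mem_univ j)) hj

/-- Every entry of the answer is an inner product of length `ℓ (kap / p)`, with one multiplication
and one addition for each term. -/
theorem gcsa_server_ops (ℓ p m n lam kap mu : ℕ) :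
    ∃ t ≤ (lam / m) * (mu / n) * (2 * (ℓ * (kap / p))),
      ComputableWithOps (F := F)
        (fun (i : (Fin ℓ × Fin (lam / m) × Fin (kap / p)) ⊕ (Fin ℓ × Fin (kap / p) × Fin (mu / n)))
          (x : (Fin ℓ × Fin (lam / m) × Fin (kap / p) → F) ×
            (Fin ℓ × Fin (kap / p) × Fin (mu / n) → F)) => Sum.elim x.1 x.2 i)
        (fun (o : Fin (lam / m) × Fin (mu / n)) x =>
          (∑ l : Fin ℓ, (Matrix.of fun i j => x.1 (l, i, j)) * (Matrix.of fun i j => x.2 (l, i, j)) :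
            Matrix (Fin (lam / m)) (Fin (mu / n)) F) o.1 o.2) t := by
  refine Comp.computableWithOps ((Comp.range_of_parts (J := Fin (lam / m) × Fin (mu / n))
    (t := 2 * (ℓ * (kap / p))) (fun o => {_}) (fun o => ?_) (fun o => ⟨o, rfl⟩)).mono_cost
      (by simp))
  have := Comp.sum (F := F) (t := 1) (V := Set.range
    (fun (i : (Fin ℓ × Fin (lam / m) × Fin (kap / p)) ⊕ (Fin ℓ × Fin (kap / p) × Fin (mu / n)))
      (x : (Fin ℓ × Fin (lam / m) × Fin (kap / p) → F) ×
        (Fin ℓ × Fin (kap / p) × Fin (mu / n) → F)) => Sum.elim x.1 x.2 i))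
    (Finset.univ : Finset (Fin ℓ × Fin (kap / p)))
    (v := fun z x => x.1 (z.1, o.1, z.2) * x.2 (z.1, z.2, o.2))
    (fun z _ => Comp.mul (t := 0) (t' := 0) (.of_mem ⟨Sum.inl (z.1, o.1, z.2), rfl⟩)
      (.of_mem ⟨Sum.inr (z.1, z.2, o.2), rfl⟩))
  refine (this.mono_right (Set.singleton_subset_iff.2 ?_)).mono_cost ?_
  · rw [Set.mem_singleton_iff]
    funext x
    simp [Matrix.sum_apply, Matrix.mul_apply, Fintype.sum_prod_type]
  · simp [mul_comm]

/-- For each entry position `(l, i, j)`, the shares of all the servers are the values of one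
numerator, found by a single multipoint evaluation. -/
theorem gcsa_encodeA_ops (hp0 : 0 < p) (hm0 : 0 < m) (hn0 : 0 < n) (hm : m ∣ lam) (hp : p ∣ kap)
    {f : Fin ℓ → Fin Kc → F} {α : Fin S → F} (hfα : DistinctPoints f α)
    (hS : Kc * (p * m * n) ≤ S) {K : ℕ} (hK1 : 1 ≤ K)
    (hK : MulBound F ((Fin (ℓ * Kc) → Matrix (Fin lam) (Fin kap) F) → F) S K) :
    ∃ t ≤ ℓ * ((lam / m) * (kap / p)) * (13 * K * (Nat.log 2 S + 1) * S),
      ComputableWithOps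
        (fun (i : Fin (ℓ * Kc) × Fin lam × Fin kap)
          (A : Fin (ℓ * Kc) → Matrix (Fin lam) (Fin kap) F) => A i.1 i.2.1 i.2.2)
        (fun (o : Σ _ : Fin S, Fin ℓ × Fin (lam / m) × Fin (kap / p)) A =>
          gcsaShareA n hm hp f A (α o.1) o.2.1 o.2.2.1 o.2.2.2) t := by
  suffices parts : ∀ o : Fin ℓ × Fin (lam / m) × Fin (kap / p), Comp F
      (Set.range fun (i : Fin (ℓ * Kc) × Fin lam × Fin kap)
        (A : Fin (ℓ * Kc) → Matrix (Fin lam) (Fin kap) F) => A i.1 i.2.1 i.2.2)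
      (13 * K * (Nat.log 2 S + 1) * S)
      (Set.range fun (s : Fin S) (A : Fin (ℓ * Kc) → Matrix (Fin lam) (Fin kap) F) =>
        gcsaShareA n hm hp f A (α s) o.1 o.2.1 o.2.2) by
    refine Comp.computableWithOps ((Comp.range_of_parts _ parts ?_).mono_cost (by simp))
    exact fun o => ⟨o.2, Set.mem_range_self o.1⟩
  intro o
  have := Comp.fractionNum_eval (σ := Fin S) (by rwa [Fintype.card_fin]) hK1 (f o.1)
    (r := p * m * n) (by positivity) (by simpa using hS) (expA_injective (m := m) (p := p))
    (expA_lt_mul hn0) hfα.injective_right (fun _ => 1)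
    (fun k x (A : Fin (ℓ * Kc) → Matrix (Fin lam) (Fin kap) F) =>
      matrixBlock hm hp (A (finProdFinEquiv (o.1, k))) x.1 x.2 o.2.1 o.2.2)
  rw [Fintype.card_fin] at this
  refine (this.mono_right ?_).mono_left' ?_
  · rintro _ ⟨s, rfl⟩
    refine ⟨s, ?_⟩
    funext A
    refine Eq.trans ?_ (gcsaShareA_apply _ _ _ _ _ _ (fun k => hfα.ne o.1 k s) _ _).symm
    simp [shareNumA, fractionNum, Finset.sum_apply, eval_finsetSum, mul_comm]
  · rintro _ ⟨y, rfl⟩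
    exact ⟨(finProdFinEquiv (o.1, y.1), blockIndex hm y.2.1 o.2.1, blockIndex hp y.2.2 o.2.2), rfl⟩

theorem gcsa_encodeB_ops (hp0 : 0 < p) (hm0 : 0 < m) (hn0 : 0 < n) (hp : p ∣ kap) (hn : n ∣ mu)
    {f : Fin ℓ → Fin Kc → F} {α : Fin S → F} (hfα : DistinctPoints f α)
    (hS : Kc * (p * m * n) ≤ S) {K : ℕ} (hK1 : 1 ≤ K)
    (hK : MulBound F ((Fin (ℓ * Kc) → Matrix (Fin kap) (Fin mu) F) → F) S K) :
    ∃ t ≤ ℓ * ((kap / p) * (mu / n)) * (13 * K * (Nat.log 2 S + 1) * S),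
      ComputableWithOps
        (fun (i : Fin (ℓ * Kc) × Fin kap × Fin mu)
          (B : Fin (ℓ * Kc) → Matrix (Fin kap) (Fin mu) F) => B i.1 i.2.1 i.2.2)
        (fun (o : Σ _ : Fin S, Fin ℓ × Fin (kap / p) × Fin (mu / n)) B =>
          gcsaShareB m hp hn f B (α o.1) o.2.1 o.2.2.1 o.2.2.2) t := by
  suffices parts : ∀ o : Fin ℓ × Fin (kap / p) × Fin (mu / n), Comp F
      (Set.range fun (i : Fin (ℓ * Kc) × Fin kap × Fin mu)
        (B : Fin (ℓ * Kc) → Matrix (Fin kap) (Fin mu) F) => B i.1 i.2.1 i.2.2)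
      (13 * K * (Nat.log 2 S + 1) * S)
      (Set.range fun (s : Fin S) (B : Fin (ℓ * Kc) → Matrix (Fin kap) (Fin mu) F) =>
        gcsaShareB m hp hn f B (α s) o.1 o.2.1 o.2.2) by
    refine Comp.computableWithOps ((Comp.range_of_parts _ parts ?_).mono_cost (by simp))
    exact fun o => ⟨o.2, Set.mem_range_self o.1⟩
  intro o
  have := Comp.fractionNum_eval (σ := Fin S) (by rwa [Fintype.card_fin]) hK1 (f o.1)
    (r := p * m * n) (by positivity) (by simpa using hS) (expB_injective (p := p) (n := n) hm0)
    (expB_lt_mul hm0) hfα.injective_right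
    -- The denominators of the `B`-shares enter as evaluation weights, at no extra cost.
    (fun s => (∏ k, (f o.1 k - α s) ^ (p * m * n))⁻¹)
    (fun k x (B : Fin (ℓ * Kc) → Matrix (Fin kap) (Fin mu) F) =>
      matrixBlock hp hn (B (finProdFinEquiv (o.1, k))) x.1 x.2 o.2.1 o.2.2)
  rw [Fintype.card_fin] at this
  refine (this.mono_right ?_).mono_left' ?_
  · rintro _ ⟨s, rfl⟩
    refine ⟨s, ?_⟩
    funext B
    refine Eq.trans ?_ (gcsaShareB_apply _ _ _ _ _ _ (fun k => hfα.ne o.1 k s) _ _).symm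
    simp [shareNumB, fractionNum, Finset.sum_apply, eval_finsetSum, Finset.mul_sum, mul_comm,
      mul_left_comm, mul_assoc]
  · rintro _ ⟨y, rfl⟩
    exact ⟨(finProdFinEquiv (o.1, y.1), blockIndex hp y.2.1 o.2.1, blockIndex hn y.2.2 o.2.2), rfl⟩

/-- For each position inside a block, one interpolation and one extraction yield the entries of all
blocks of all products together. -/
theorem gcsa_decode_ops (hℓ : 0 < ℓ) (hKc : 0 < Kc) (hp0 : 0 < p) (hm0 : 0 < m) (hn0 : 0 < n)
    (hm : m ∣ lam) (hn : n ∣ mu) (f : Fin ℓ → Fin Kc → F) (α : Fin S → F)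
    (ρ : F[X] →ₗ[F] F) {𝓡 : Finset (Fin S)} (h𝓡 : 𝓡.card = gcsaThreshold ℓ Kc p m n)
    {K : ℕ} (hK1 : 1 ≤ K)
    (hK : MulBound F ((∀ _ : 𝓡, Fin (lam / m) × Fin (mu / n) → F) → F)
      (gcsaThreshold ℓ Kc p m n) K) :
    ∃ t ≤ (lam / m) * (mu / n) * (14 * K * (Nat.log 2 (gcsaThreshold ℓ Kc p m n) + 1) *
        gcsaThreshold ℓ Kc p m n),
      ComputableWithOps
        (fun (i : Σ _ : 𝓡, Fin (lam / m) × Fin (mu / n))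
          (y : ∀ _ : 𝓡, Fin (lam / m) × Fin (mu / n) → F) => y i.1 i.2)
        (fun (o : Fin (ℓ * Kc) × Fin lam × Fin mu) y =>
          gcsaDecode hm hn p f α ρ 𝓡 y o.1 o.2.1 o.2.2) t := by
  have hr : 0 < p * m * n := by positivity
  have hT := gcsaThreshold_pos hℓ hKc hp0 hm0 hn0
  rw [← h𝓡] at hK hT ⊢
  -- The factor that clears the denominators and the Lagrange normalization merge into one constant
  -- for each server.
  set ω : Fin S → F := fun s => (∏ l, ∏ k, (f l k - α s) ^ (p * m * n)) *
    ((hermiteFamily 𝓡 α 1 (s, 0)).eval (α s))⁻¹ with hω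
  set v : Fin (lam / m) × Fin (mu / n) → Fin S → (∀ _ : 𝓡, Fin (lam / m) × Fin (mu / n) → F) → F :=
    fun x s y => if h : s ∈ 𝓡 then y ⟨s, h⟩ x else 0 with hv
  have key := fun x => Comp.lagrange_apply 𝓡 hK hK1 (fun b : Fin ℓ × Fin Kc => f b.1 b.2) hr
    (by simpa using hT.1) α ω ρ (v x)
  refine Comp.computableWithOps ((Comp.range_of_parts (J := Fin (lam / m) × Fin (mu / n))
    (t := 14 * K * (Nat.log 2 𝓡.card + 1) * 𝓡.card) _
    (fun x => (key x).mono_left' ?_) (fun o => ?_)).mono_cost (by simp))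
  · rintro _ ⟨s, hs, rfl⟩
    refine ⟨⟨⟨s, hs⟩, x⟩, ?_⟩
    funext y
    simp only [hv, dif_pos (Finset.mem_coe.1 hs)]
  · obtain ⟨t, row, col⟩ := o
    refine ⟨(((blockEquiv hm).symm row).2, ((blockEquiv hn).symm col).2),
      (finProdFinEquiv.symm t, p * m * n - 1 -
        expAB m p ((blockEquiv hm).symm row).1 ((blockEquiv hn).symm col).1), ?_, ?_⟩
    · simp only [Finset.coe_product, Set.mem_prod, Finset.coe_univ, Set.mem_univ, true_and,
        Finset.coe_range, Set.mem_Iio]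
      omega
    · funext y
      simp only [Finset.sum_apply, Pi.smul_apply, smul_eq_mul]
      rw [gcsaDecode, Matrix.of_apply, if_pos h𝓡.ge, lagrangeSum, Finset.sum_mul, map_sum]
      refine Finset.sum_congr rfl fun s _ => ?_
      rw [mul_assoc (C _), ← smul_eq_C_mul, map_smul, smul_eq_mul]
      simp only [hω, hv]
      ring

end Complexity

/-! ### Recovery threshold, download cost and existence of the points -/

section Costs

theorem exists_distinctPoints {F : Type*} {S ℓ Kc : ℕ}
    (h : ((ℓ * Kc + S : ℕ) : ℕ∞) ≤ ENat.card F) :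
    ∃ (f : Fin ℓ → Fin Kc → F) (α : Fin S → F), DistinctPoints f α := by
  obtain ⟨e⟩ : Nonempty ((Fin ℓ × Fin Kc) ⊕ Fin S ↪ F) := by
    have h1 : ENat.card ((Fin ℓ × Fin Kc) ⊕ Fin S) ≤ ENat.card F := by
      rwa [ENat.card_eq_coe_fintype_card, Fintype.card_sum, Fintype.card_prod, Fintype.card_fin,
        Fintype.card_fin, Fintype.card_fin]
    cases finite_or_infinite F
    · have := Fintype.ofFinite F
      rw [ENat.card_eq_coe_fintype_card, ENat.card_eq_coe_fintype_card, Nat.cast_le] at h1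
      exact Function.Embedding.nonempty_of_card_le h1
    · exact ⟨(Fintype.equivFin _).toEmbedding.trans
        (Fin.valEmbedding.trans (Infinite.natEmbedding F))⟩
  refine ⟨fun l k => e (Sum.inl (l, k)), fun s => e (Sum.inr s), ?_⟩
  have : Sum.elim (fun x : Fin ℓ × Fin Kc => e (Sum.inl (x.1, x.2))) (fun s => e (Sum.inr s)) = e := by
    funext x
    cases x <;> rfl
  rw [DistinctPoints, this]
  exact e.injective

namespace CDBMMCode

variable {F : Type*} [Field F] {S L lam kap mu : ℕ}

theorem recoveryThreshold_eq (𝒞 : CDBMMCode F S L lam kap mu) {R : ℕ} (hR : 𝒞.IsRecoverable R)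
    (h : ∀ r < R, ¬ 𝒞.IsRecoverable r) : 𝒞.recoveryThreshold = R := by
  refine le_antisymm (Nat.sInf_le hR) (le_csInf ⟨R, hR⟩ fun r hr => ?_)
  by_contra hlt
  exact h r (not_le.1 hlt) hr

/-- All sets of responsive servers give the same value; `hS` ensures that there is such a set, since
an empty supremum would be `0`. -/
theorem downloadCost_eq (𝒞 : CDBMMCode F S L lam kap mu) {c : ℕ}
    (hc : ∀ s, Fintype.card (𝒞.Ans s) = c) (hS : 𝒞.recoveryThreshold ≤ S) :
    𝒞.downloadCost = 𝒞.recoveryThreshold * c / (L * lam * mu) := by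
  have hne : (Finset.powersetCard 𝒞.recoveryThreshold (Finset.univ : Finset (Fin S))).Nonempty := by
    rw [Finset.powersetCard_nonempty]
    simpa using hS
  rw [downloadCost, ← Finset.sup_const hne (_ / _)]
  refine Finset.sup_congr rfl fun 𝓡 h𝓡 => ?_
  simp only [hc, Finset.sum_const, nsmul_eq_mul, (Finset.mem_powersetCard.1 h𝓡).2]

/-- If the first column of `A` is all ones and the others are zero, and `B` is all ones, then every
entry of the product is `1`. The bound `r ≤ S` rules out vacuous recoverability. -/
theorem not_isRecoverable_of_eq_zero (𝒞 : CDBMMCode F S L lam kap mu) (hL : 0 < L)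
    (hlam : 0 < lam) (hkap : 0 < kap) (hmu : 0 < mu) {r : ℕ} (hr : r ≤ S)
    (h : ∀ 𝓡 : Finset (Fin S), 𝓡.card = r → ∀ y t, 𝒞.d 𝓡 y t = 0) : ¬ 𝒞.IsRecoverable r := by
  intro hrec
  obtain ⟨𝓡, -, h𝓡⟩ := Finset.exists_subset_card_eq (s := (Finset.univ : Finset (Fin S)))
    (n := r) (by simpa using hr)
  have h1 := congrFun (hrec 𝓡 h𝓡
    (fun _ => Matrix.of fun _ e => if e = ⟨0, hkap⟩ then 1 else 0)
    (fun _ => Matrix.of fun _ _ => 1)) ⟨0, hL⟩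
  rw [h 𝓡 h𝓡] at h1
  have h2 := congrFun (congrFun h1 ⟨0, hlam⟩) ⟨0, hmu⟩
  rw [Matrix.mul_apply] at h2
  simp at h2

end CDBMMCode

variable {F : Type*} [Field F] {S ℓ Kc p m n lam kap mu : ℕ}

theorem gcsaCode_answer (hm : m ∣ lam) (hn : n ∣ mu) (hp : p ∣ kap) (f : Fin ℓ → Fin Kc → F)
    (α : Fin S → F)
    (d : ∀ 𝓡 : Finset (Fin S), (∀ _ : 𝓡, Fin (lam / m) × Fin (mu / n) → F) →
      Fin (ℓ * Kc) → Matrix (Fin lam) (Fin mu) F)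
    (A : Fin (ℓ * Kc) → Matrix (Fin lam) (Fin kap) F)
    (B : Fin (ℓ * Kc) → Matrix (Fin kap) (Fin mu) F) (s : Fin S) :
    (gcsaCode hm hn hp f α d).answer A B s = fun x => ∑ l, ∑ e,
      gcsaShareA n hm hp f A (α s) l x.1 e * gcsaShareB m hp hn f B (α s) l e x.2 := by
  funext x
  simp only [CDBMMCode.answer, gcsaCode]
  rw [Matrix.sum_apply]
  rfl

theorem softLogSq_nonneg (F : Type*) [Field F] {a : ℝ} (ha : 0 ≤ a) (N : ℕ) :
    0 ≤ softLogSq F a N := by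
  have := one_le_lg (lg N)
  rw [softLogSq]
  split_ifs <;> positivity

/-- The decoder fails with few responsive servers. -/
theorem not_isRecoverable_gcsaDecode (hℓ : 0 < ℓ) (hKc : 0 < Kc) (hlam : 0 < lam) (hkap : 0 < kap)
    (hmu : 0 < mu) (hm : m ∣ lam) (hn : n ∣ mu) (hp : p ∣ kap) (f : Fin ℓ → Fin Kc → F)
    (α : Fin S → F) (ρ : F[X] →ₗ[F] F) (hS : gcsaThreshold ℓ Kc p m n ≤ S) {r : ℕ}
    (hr : r < gcsaThreshold ℓ Kc p m n) :
    ¬ (gcsaCode hm hn hp f α (gcsaDecode hm hn p f α ρ)).IsRecoverable r := by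
  refine CDBMMCode.not_isRecoverable_of_eq_zero _ (Nat.mul_pos hℓ hKc) hlam hkap hmu
    (hr.le.trans hS) fun 𝓡 h𝓡 y t => ?_
  ext i j
  exact if_neg (by rw [h𝓡]; exact not_le.2 hr)

end Costs

/-! ### Normalization of the counts -/

section Arithmetic

theorem uploadCost_arith {S ℓ Kc u v M N : ℕ} (hℓ : 0 < ℓ) (hM : 0 < M) (hN : 0 < N)
    (hu : u ∣ M) (hv : v ∣ N) :
    (∑ _s : Fin S, (Fintype.card (Fin ℓ × Fin (M / u) × Fin (N / v)) : ℚ≥0)) /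
      ((ℓ * Kc : ℕ) * M * N) = S / (Kc * (u * v)) := by
  obtain ⟨a, rfl⟩ := hu
  obtain ⟨b, rfl⟩ := hv
  have hu := Nat.pos_of_mul_pos_right hM
  have hv := Nat.pos_of_mul_pos_right hN
  have ha := Nat.pos_of_mul_pos_left hM
  have hb := Nat.pos_of_mul_pos_left hN
  rw [Nat.mul_div_cancel_left _ hu, Nat.mul_div_cancel_left _ hv]
  simp only [Fintype.card_prod, Fintype.card_fin, Finset.sum_const, Finset.card_univ, nsmul_eq_mul]
  push_cast
  field_simp

theorem downloadCost_arith {R ℓ Kc u v M N : ℕ} (hM : 0 < M) (hN : 0 < N)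
    (hu : u ∣ M) (hv : v ∣ N) :
    (R * ((M / u) * (N / v) : ℕ) : ℚ≥0) / ((ℓ * Kc : ℕ) * M * N) = R / (u * v * ℓ * Kc) := by
  obtain ⟨a, rfl⟩ := hu
  obtain ⟨b, rfl⟩ := hv
  have hu := Nat.pos_of_mul_pos_right hM
  have hv := Nat.pos_of_mul_pos_right hN
  have ha := Nat.pos_of_mul_pos_left hM
  have hb := Nat.pos_of_mul_pos_left hN
  rw [Nat.mul_div_cancel_left _ hu, Nat.mul_div_cancel_left _ hv]
  push_cast
  field_simp

theorem serverComplexity_arith {ℓ Kc p m n lam kap mu t : ℕ} (hℓ : 0 < ℓ) (hKc : 0 < Kc)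
    (hm0 : 0 < m) (hn0 : 0 < n) (hp0 : 0 < p) (hm : m ∣ lam) (hn : n ∣ mu) (hp : p ∣ kap)
    (ht : t ≤ (lam / m) * (mu / n) * (2 * (ℓ * (kap / p)))) :
    (t : ℝ) / (ℓ * Kc : ℕ) ≤ 2 * ((lam * kap * mu : ℝ) / (Kc * p * m * n)) := by
  obtain ⟨a, rfl⟩ := hm
  obtain ⟨b, rfl⟩ := hn
  obtain ⟨c, rfl⟩ := hp
  rw [Nat.mul_div_cancel_left _ hm0, Nat.mul_div_cancel_left _ hn0,
    Nat.mul_div_cancel_left _ hp0] at ht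
  have ht' : (t : ℝ) ≤ a * b * (2 * (ℓ * c)) := by exact_mod_cast ht
  calc (t : ℝ) / (ℓ * Kc : ℕ) ≤ a * b * (2 * (ℓ * c)) / (ℓ * Kc : ℕ) := by gcongr
    _ = _ := by push_cast; field_simp

theorem encodingComplexity_arith {F : Type*} [Field F] {S ℓ Kc u v M N K t : ℕ} (hℓ : 0 < ℓ)
    (hKc : 0 < Kc) (hu0 : 0 < u) (hv0 : 0 < v) (hu : u ∣ M) (hv : v ∣ N)
    (hK : ∀ a : ℝ, 0 ≤ a →
      a * (K * (Nat.log 2 S + 1 : ℕ)) ≤ 10206000 * softLogSq F a S)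
    (ht : t ≤ ℓ * ((M / u) * (N / v)) * (13 * K * (Nat.log 2 S + 1) * S)) :
    (t : ℝ) / (ℓ * Kc : ℕ) ≤ 300000000 * softLogSq F ((M * N * S : ℝ) / (Kc * (u * v))) S := by
  obtain ⟨a, rfl⟩ := hu
  obtain ⟨b, rfl⟩ := hv
  rw [Nat.mul_div_cancel_left _ hu0, Nat.mul_div_cancel_left _ hv0] at ht
  have ht' : (t : ℝ) ≤ ℓ * (a * b) * (13 * K * (Nat.log 2 S + 1 : ℕ) * S) := by exact_mod_cast ht
  set A : ℝ := ((u * a : ℕ) * (v * b : ℕ) * S : ℝ) / (Kc * (u * v)) with hA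
  have hA0 : 0 ≤ A := by positivity
  have := softLogSq_nonneg F hA0 S
  calc (t : ℝ) / (ℓ * Kc : ℕ)
      ≤ ℓ * (a * b) * (13 * K * (Nat.log 2 S + 1 : ℕ) * S) / (ℓ * Kc : ℕ) := by gcongr
    _ = 13 * (A * (K * (Nat.log 2 S + 1 : ℕ))) := by rw [hA]; push_cast; field_simp
    _ ≤ 13 * (10206000 * softLogSq F A S) := by linarith [hK A hA0]
    _ ≤ _ := by linarith

theorem decodingComplexity_arith {F : Type*} [Field F] {R ℓ Kc p m n lam mu K t : ℕ} (hℓ : 0 < ℓ)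
    (hKc : 0 < Kc) (hm0 : 0 < m) (hn0 : 0 < n) (hm : m ∣ lam) (hn : n ∣ mu)
    (hR : R ≤ 2 * (ℓ * Kc) * (p * m * n))
    (hK : ∀ a : ℝ, 0 ≤ a →
      a * (K * (Nat.log 2 R + 1 : ℕ)) ≤ 10206000 * softLogSq F a R)
    (ht : t ≤ (lam / m) * (mu / n) * (14 * K * (Nat.log 2 R + 1) * R)) :
    (t : ℝ) / (ℓ * Kc : ℕ) ≤ 300000000 * softLogSq F (lam * mu * p : ℝ) R := by
  obtain ⟨a, rfl⟩ := hm
  obtain ⟨b, rfl⟩ := hn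
  rw [Nat.mul_div_cancel_left _ hm0, Nat.mul_div_cancel_left _ hn0] at ht
  have ht' : (t : ℝ) ≤ a * b * (14 * K * (Nat.log 2 R + 1 : ℕ) * R) := by exact_mod_cast ht
  have hR' : (R : ℝ) ≤ 2 * (ℓ * Kc) * (p * m * n) := by exact_mod_cast hR
  set A : ℝ := ((m * a : ℕ) * (n * b : ℕ) * p : ℝ) with hA
  have hA0 : 0 ≤ A := by positivity
  have := softLogSq_nonneg F hA0 R
  calc (t : ℝ) / (ℓ * Kc : ℕ)
      ≤ a * b * (14 * K * (Nat.log 2 R + 1 : ℕ) * R) / (ℓ * Kc : ℕ) := by gcongr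
    _ ≤ a * b * (14 * K * (Nat.log 2 R + 1 : ℕ) * (2 * (ℓ * Kc) * (p * m * n))) / (ℓ * Kc : ℕ) := by
      gcongr
    _ = 28 * (A * (K * (Nat.log 2 R + 1 : ℕ))) := by
      rw [hA]
      push_cast
      field_simp
      ring
    _ ≤ 28 * (10206000 * softLogSq F A R) := by linarith [hK A hA0]
    _ ≤ _ := by linarith

end Arithmetic

end Preliminaries

/-! ### The main theorem -/

theorem theorem2 :
    ∃ C : ℝ, 0 < C ∧
      ∀ (F : Type*) [Field F] (S ℓ Kc p m n lam kap mu : ℕ),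
        0 < ℓ → 0 < Kc → 0 < p → 0 < m → 0 < n → 0 < lam → 0 < kap → 0 < mu →
        ∀ (hm : m ∣ lam) (hn : n ∣ mu) (hp : p ∣ kap),
          ((ℓ * Kc + S : ℕ) : ℕ∞) ≤ ENat.card F →
          gcsaThreshold ℓ Kc p m n ≤ S →
          (∃ (f : Fin ℓ → Fin Kc → F) (α : Fin S → F), DistinctPoints f α) ∧
          ∀ (f : Fin ℓ → Fin Kc → F) (α : Fin S → F), DistinctPoints f α →
            ∃ d : ∀ 𝓡 : Finset (Fin S), (∀ _ : 𝓡, Fin (lam / m) × Fin (mu / n) → F) →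
                Fin (ℓ * Kc) → Matrix (Fin lam) (Fin mu) F,
              (gcsaCode hm hn hp f α d).IsRecoverable (gcsaThreshold ℓ Kc p m n) ∧
              (gcsaCode hm hn hp f α d).recoveryThreshold = gcsaThreshold ℓ Kc p m n ∧
              (gcsaCode hm hn hp f α d).uploadCostA = S / (Kc * p * m) ∧
              (gcsaCode hm hn hp f α d).uploadCostB = S / (Kc * p * n) ∧
              (gcsaCode hm hn hp f α d).downloadCost =
                gcsaThreshold ℓ Kc p m n / (m * n * ℓ * Kc) ∧
              (gcsaCode hm hn hp f α d).ServerComplexityLE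
                (C * ((lam * kap * mu : ℝ) / (Kc * p * m * n))) ∧
              (gcsaCode hm hn hp f α d).EncodingComplexityALE
                (C * softLogSq F ((lam * kap * S : ℝ) / (Kc * p * m)) S) ∧
              (gcsaCode hm hn hp f α d).EncodingComplexityBLE
                (C * softLogSq F ((kap * mu * S : ℝ) / (Kc * p * n)) S) ∧
              (gcsaCode hm hn hp f α d).DecodingComplexityLE
                (C * softLogSq F (lam * mu * p : ℝ) (gcsaThreshold ℓ Kc p m n)) := by
  -- The decoder is the most expensive: `28 * 10206000 < 300000000`, where `28 = 14 * 2` includes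
  -- the bound `R ≤ 2 L p m n`.
  refine ⟨300000000, by norm_num, ?_⟩
  intro F _ S ℓ Kc p m n lam kap mu hℓ hKc hp0 hm0 hn0 hlam hkap hmu hm hn hp hF hS
  refine ⟨exists_distinctPoints hF, fun f α hfα => ?_⟩
  obtain ⟨ρ, hρ⟩ := exists_taylor_functional hfα.injective_left (p * m * n)
    (cofactor (p * m * n) f) (eval_cofactor_ne_zero _ hfα.injective_left)
  obtain ⟨-, hT1, hT2, hT0⟩ := gcsaThreshold_pos hℓ hKc hp0 hm0 hn0
  have hS0 : 0 < S := hT0.trans_le hS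
  have hrec : (gcsaCode hm hn hp f α (gcsaDecode hm hn p f α ρ)).IsRecoverable
      (gcsaThreshold ℓ Kc p m n) := by
    intro 𝓡 h𝓡 A B
    funext t
    simp only [gcsaCode_answer]
    exact gcsaDecode_answer hℓ hKc hp0 hn0 hm hn hp hfα hρ h𝓡.ge A B t
  have hthr := CDBMMCode.recoveryThreshold_eq _ hrec fun r hr =>
    not_isRecoverable_gcsaDecode hℓ hKc hlam hkap hmu hm hn hp f α ρ hS hr
  refine ⟨gcsaDecode hm hn p f α ρ, hrec, hthr, ?_, ?_, ?_, ?_, ?_, ?_, ?_⟩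
  · rw [mul_assoc, mul_comm (p : ℚ≥0)]
    exact uploadCost_arith hℓ hlam hkap hm hp
  · rw [mul_assoc]
    exact uploadCost_arith hℓ hkap hmu hp hn
  · rw [CDBMMCode.downloadCost_eq _ (c := (lam / m) * (mu / n))
      (fun s => by
        change Fintype.card (Fin (lam / m) × Fin (mu / n)) = _
        simp) (hthr.trans_le hS), hthr]
    exact downloadCost_arith hlam hmu hm hn
  · intro s
    obtain ⟨t, ht, h⟩ := gcsa_server_ops (F := F) ℓ p m n lam kap mu
    refine ⟨t, (serverComplexity_arith hℓ hKc hm0 hn0 hp0 hm hn hp ht).trans ?_, h⟩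
    gcongr
    norm_num
  · obtain ⟨K, hK1, hK, hKb⟩ :=
      exists_mulBound F ((Fin (ℓ * Kc) → Matrix (Fin lam) (Fin kap) F) → F) hS0
    obtain ⟨t, ht, h⟩ := gcsa_encodeA_ops hp0 hm0 hn0 hm hp hfα (hT1.trans hS) hK1 hK
    refine ⟨t, ?_, h⟩
    rw [mul_assoc (Kc : ℝ), mul_comm (p : ℝ)]
    exact encodingComplexity_arith hℓ hKc hm0 hp0 hm hp hKb ht
  · obtain ⟨K, hK1, hK, hKb⟩ :=
      exists_mulBound F ((Fin (ℓ * Kc) → Matrix (Fin kap) (Fin mu) F) → F) hS0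
    obtain ⟨t, ht, h⟩ := gcsa_encodeB_ops hp0 hm0 hn0 hp hn hfα (hT1.trans hS) hK1 hK
    refine ⟨t, ?_, h⟩
    rw [mul_assoc (Kc : ℝ)]
    exact encodingComplexity_arith hℓ hKc hp0 hn0 hp hn hKb ht
  · intro 𝓡 h𝓡
    rw [hthr] at h𝓡
    obtain ⟨K, hK1, hK, hKb⟩ :=
      exists_mulBound F ((∀ _ : 𝓡, Fin (lam / m) × Fin (mu / n) → F) → F) hT0
    obtain ⟨t, ht, h⟩ := gcsa_decode_ops hℓ hKc hp0 hm0 hn0 hm hn f α ρ h𝓡 hK1 hK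
    exact ⟨t, decodingComplexity_arith hℓ hKc hm0 hn0 hm hn hT2 hKb ht, h⟩
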